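/- Let $P\subset\mathbb R^4$ be a regular $5$-cell, $8$-cell, $24$-cell, $120$-cell or $600$-cell centred at the origin, let $\Gamma\subset S^3$ be the radial projection of its $1$-skeleton (the union of its vertices and edges) to the unit sphere, and let $G\le SO(4)$ be the group of orientation-preserving linear isometries that map $P$ to itself; $G$ acts on $S^3\setminus\Gamma$. Let $\mathcal I\to S^3\setminus\Gamma$ be a real line bundle, with a continuous Euclidean fiber metric, whose restriction to every linking circle of $\Gamma$ is the (non-trivial) Möbius line bundle; here a linking circle is the boundary of a smoothly embedded closed disk in $S^3$ that meets $\Gamma$ in exactly one point, which is a transversal intersection of the interior of the disk with the interior of an edge. Let $\widetilde G$ be the group of pairs $(g,\widehat g)$, where $g\in G$ and $\widehat g:\mathcal I\to\mathcal I$ is a fiberwise linear, isometric bundle automorphism covering $g$. Then the projection $(g,\widehat g)\mapsto g$ makes $\widetilde G$ a central extension $$1\longrightarrow\{\pm1\}\longrightarrow\widetilde G\longrightarrow G\longrightarrow 1,$$ where $-1$ acts on $\mathcal I$ as multiplication by $-1$ on each fiber, and this extension splits. Equivalently, the action of $G$ on $S^3\setminus\Gamma$ lifts to an action on the total space of $\mathcal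 I$ by fiberwise linear, isometric bundle automorphisms $\widehat g:\mathcal I\to\mathcal I$ covering $g\in G$, with $\widehat{gh}=\widehat g\circ\widehat h$ for all $g,h\in G$. -/

import Mathlib

open scoped ContDiff

noncomputable section

namespace RegularPolytope

/-- Euclidean four-space. -/
abbrev E4 : Type := EuclideanSpace ℝ (Fin 4)

/-! ### The five polytopes -/

/-- All points obtained from `a` by permuting the coordinates and changing signs. -/
def signedPerms (a : Fin 4 → ℝ) : Set E4 :=
  {x | ∃ (σ : Equiv.Perm (Fin 4)) (ε : Fin 4 → ℤˣ), ∀ i, x i = ((ε i : ℤ) : ℝ) * a (σ i)}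

/-- All points obtained from `a` by permuting the coordinates evenly and changing signs. -/
def evenSignedPerms (a : Fin 4 → ℝ) : Set E4 :=
  {x | ∃ (σ : Equiv.Perm (Fin 4)) (ε : Fin 4 → ℤˣ), Equiv.Perm.sign σ = 1 ∧
    ∀ i, x i = ((ε i : ℤ) : ℝ) * a (σ i)}

/-- The names of the five polytopes. -/
inductive Cell : Type
  | cell5 | cell8 | cell24 | cell120 | cell600

/-- The standard vertex sets, all of them centred at the origin. -/
def Cell.vertices : Cell → Set E4
  | .cell5 =>
      let s : ℝ := √5 / 4
      {!₂[1, 0, 0, 0], !₂[-1 / 4, s, s, s], !₂[-1 / 4, s, -s, -s],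
        !₂[-1 / 4, -s, s, -s], !₂[-1 / 4, -s, -s, s]}
  | .cell8 => signedPerms ![1, 1, 1, 1]
  | .cell24 => signedPerms ![1, 0, 0, 0] ∪ signedPerms ![1 / 2, 1 / 2, 1 / 2, 1 / 2]
  | .cell120 =>
      let φ : ℝ := Real.goldenRatio
      signedPerms ![2, 2, 0, 0] ∪ signedPerms ![√5, 1, 1, 1] ∪
        signedPerms ![(φ ^ 2)⁻¹, φ, φ, φ] ∪ signedPerms ![φ ^ 2, φ⁻¹, φ⁻¹, φ⁻¹] ∪
        evenSignedPerms ![φ ^ 2, (φ ^ 2)⁻¹, 1, 0] ∪ evenSignedPerms ![√5, φ⁻¹, φ, 0] ∪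
        evenSignedPerms ![2, 1, φ, φ⁻¹]
  | .cell600 =>
      let φ : ℝ := Real.goldenRatio
      signedPerms ![1, 0, 0, 0] ∪ signedPerms ![1 / 2, 1 / 2, 1 / 2, 1 / 2] ∪
        evenSignedPerms ![0, 1 / 2, φ / 2, φ⁻¹ / 2]

/-- `P` is a regular `k`-cell centred at the origin: the image of the standard one under a
linear similarity. -/
def IsCentered (k : Cell) (P : Set E4) : Prop :=
  ∃ (c : ℝ) (A : E4 ≃ₗᵢ[ℝ] E4), 0 < c ∧ P = (fun x => c • A x) '' convexHull ℝ k.vertices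

/-! ### The graph in the three-sphere and its complement -/

/-- The closed segment with end points `u`, `v` is a face of `P`, i.e. the intersection of `P`
with a supporting hyperplane. It is an edge if `u ≠ v` and a vertex if `u = v`. -/
def IsSegmentFace (P : Set E4) (u v : E4) : Prop :=
  IsExposed ℝ P (segment ℝ u v)

/-- The `1`-skeleton: the union of all vertices and edges. -/
def oneSkeleton (P : Set E4) : Set E4 :=
  {x | ∃ u v, IsSegmentFace P u v ∧ x ∈ segment ℝ u v}

/-- The radial projection of the `1`-skeleton to the unit sphere. -/
def radialGraph (P : Set E4) : Set E4 :=
  (fun x : E4 => ‖x‖⁻¹ • x) '' (oneSkeleton P \ {0})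

/-- The complement of the graph in the three-sphere. -/
def graphCompl (P : Set E4) : Set E4 :=
  Metric.sphere 0 1 \ radialGraph P

/-! ### The orientation-preserving symmetry group and its action -/

/-- The orientation-preserving linear isometries that map `P` onto itself. -/
def rotationGroup (P : Set E4) : Subgroup (E4 ≃ₗᵢ[ℝ] E4) where
  carrier := {g | LinearMap.det (g.toLinearEquiv : E4 →ₗ[ℝ] E4) = 1 ∧ g '' P = P}
  one_mem' := by
    refine ⟨?_, ?_⟩
    · exact LinearMap.det_id
    · exact Set.image_id P
  mul_mem' := by
    rintro a b ⟨ha, ha'⟩ ⟨hb, hb'⟩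
    refine ⟨?_, ?_⟩
    · have : ((a * b).toLinearEquiv : E4 →ₗ[ℝ] E4) =
          (a.toLinearEquiv : E4 →ₗ[ℝ] E4) ∘ₗ (b.toLinearEquiv : E4 →ₗ[ℝ] E4) := rfl
      rw [this, LinearMap.det_comp, ha, hb, one_mul]
    · have : ((a * b : E4 ≃ₗᵢ[ℝ] E4) : E4 → E4) = a ∘ b := rfl
      rw [this, Set.image_comp, hb', ha']
  inv_mem' := by
    rintro a ⟨ha, ha'⟩
    refine ⟨?_, ?_⟩
    · have h : (a.toLinearEquiv : E4 →ₗ[ℝ] E4) ∘ₗ ((a⁻¹).toLinearEquiv : E4 →ₗ[ℝ] E4) =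
          LinearMap.id := by
        ext1 x
        exact a.apply_symm_apply x
      have h2 := congrArg LinearMap.det h
      rwa [LinearMap.det_comp, ha, one_mul, LinearMap.det_id] at h2
    · conv_lhs => rw [← ha']
      rw [← Set.image_comp]
      have : ((a⁻¹ : E4 ≃ₗᵢ[ℝ] E4) : E4 → E4) ∘ a = id := by
        funext x
        exact a.symm_apply_apply x
      rw [this, Set.image_id]

theorem mem_radialGraph_of_mem {P : Set E4} {g : E4 ≃ₗᵢ[ℝ] E4} (hg : g '' P = P) {x : E4}
    (hx : x ∈ radialGraph P) : g x ∈ radialGraph P := by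
  obtain ⟨y, ⟨⟨u, v, huv, hy⟩, hy0⟩, rfl⟩ := hx
  refine ⟨g y, ⟨⟨g u, g v, ?_, ?_⟩, ?_⟩, ?_⟩
  · intro _
    obtain ⟨l, hl⟩ := huv ⟨u, left_mem_segment ℝ u v⟩
    refine ⟨l.comp (g.symm.toContinuousLinearEquiv : E4 →L[ℝ] E4), ?_⟩
    have him : segment ℝ (g u) (g v) = g '' segment ℝ u v :=
      (image_segment ℝ g.toLinearEquiv.toLinearMap.toAffineMap u v).symm
    rw [him, hl]
    ext z
    constructor
    · rintro ⟨w, ⟨hw, hw'⟩, rfl⟩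
      refine ⟨hg ▸ Set.mem_image_of_mem g hw, ?_⟩
      intro t ht
      rw [← hg] at ht
      obtain ⟨t, ht, rfl⟩ := ht
      simpa using hw' t ht
    · rintro ⟨hz, hz'⟩
      rw [← hg] at hz
      obtain ⟨w, hw, rfl⟩ := hz
      refine ⟨w, ⟨hw, fun t ht => ?_⟩, rfl⟩
      simpa using hz' (g t) (hg ▸ Set.mem_image_of_mem g ht)
  · have him : segment ℝ (g u) (g v) = g '' segment ℝ u v :=
      (image_segment ℝ g.toLinearEquiv.toLinearMap.toAffineMap u v).symm
    rw [him]
    exact Set.mem_image_of_mem g hy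
  · simpa using hy0
  · simp

theorem map_mem_graphCompl {P : Set E4} (g : rotationGroup P) {x : E4}
    (hx : x ∈ graphCompl P) : g.1 x ∈ graphCompl P := by
  refine ⟨?_, fun h => hx.2 ?_⟩
  · simpa using hx.1
  · have h2 := mem_radialGraph_of_mem (g⁻¹).2.2 h
    have h3 : (g⁻¹).1 (g.1 x) = x := g.1.symm_apply_apply x
    rwa [h3] at h2

/-- The action of the rotation group on the complement of the graph. -/
instance (P : Set E4) : MulAction (rotationGroup P) (graphCompl P) where
  smul g x := ⟨g.1 x.1, map_mem_graphCompl g x.2⟩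
  one_smul _ := rfl
  mul_smul _ _ _ := rfl

/-! ### Linking circles and the line bundle -/

/-- `C` is a linking circle of the graph of `P`: the boundary of a smoothly embedded closed disk
in the three-sphere which meets the graph in a single point, that point being a transversal
intersection of the interior of the disk with the interior of an edge.

The disk is the image of the closed unit disk under `D`. The tangent plane to the disk at the
intersection point `D z` is orthogonal to `D z`, while the plane spanned by the edge `u v` is the
sum of the line through `D z` and the tangent line of the projected edge; so the disk is
transversal to the edge exactly when these two planes intersect trivially. -/
def IsLinkingCircle (P : Set E4) (C : Set E4) : Prop :=
  ∃ D : EuclideanSpace ℝ (Fin 2) → E4,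
    ContDiff ℝ ∞ D ∧
    Set.InjOn D (Metric.closedBall 0 1) ∧
    (∀ w ∈ Metric.closedBall (0 : EuclideanSpace ℝ (Fin 2)) 1,
      Function.Injective (fderiv ℝ D w)) ∧
    D '' Metric.closedBall 0 1 ⊆ Metric.sphere 0 1 ∧
    C = D '' Metric.sphere 0 1 ∧
    ∃ z ∈ Metric.ball (0 : EuclideanSpace ℝ (Fin 2)) 1,
      D '' Metric.closedBall 0 1 ∩ radialGraph P = {D z} ∧
      ∃ u v : E4, u ≠ v ∧ IsSegmentFace P u v ∧
        (∃ y ∈ openSegment ℝ u v, D z = ‖y‖⁻¹ • y) ∧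
        Disjoint (fderiv ℝ D z).range (Submodule.span ℝ {u, v})

theorem exists_isometry_of_eq {P : Set E4} {I : graphCompl P → Type*}
    [∀ x, NormedAddCommGroup (I x)] [∀ x, InnerProductSpace ℝ (I x)]
    {x y : graphCompl P} (h : x = y) :
    ∃ L : I x ≃ₗᵢ[ℝ] I y, ∀ v : I x, (⟨x, v⟩ : Bundle.TotalSpace ℝ I) = ⟨y, L v⟩ := by
  subst h
  exact ⟨LinearIsometryEquiv.refl ℝ _, fun _ => rfl⟩

section Bundle

variable {P : Set E4} (I : graphCompl P → Type*)
  [TopologicalSpace (Bundle.TotalSpace ℝ I)]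
  [∀ x, NormedAddCommGroup (I x)] [∀ x, InnerProductSpace ℝ (I x)]

/-- The real line bundle `I` restricts to each linking circle of the graph as the Möbius bundle,
i.e. as a non-trivial line bundle: it has no nowhere vanishing continuous section there. -/
def IsMoebiusOnLinkingCircles : Prop :=
  ∀ C : Set (graphCompl P), IsLinkingCircle P (Subtype.val '' C) →
    ¬ ∃ s : ∀ x, I x,
      ContinuousOn (fun x => (⟨x, s x⟩ : Bundle.TotalSpace ℝ I)) C ∧ ∀ x ∈ C, s x ≠ 0

variable {I}

/-- The homeomorphism `f` of the total space is a lift of `g`: it maps the fiber over each `x`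
to the fiber over `g • x` by a linear isometry. -/
def IsLift (g : rotationGroup P) (f : Bundle.TotalSpace ℝ I ≃ₜ Bundle.TotalSpace ℝ I) : Prop :=
  ∀ x : graphCompl P, ∃ L : I x ≃ₗᵢ[ℝ] I (g • x), ∀ v : I x, f ⟨x, v⟩ = ⟨g • x, L v⟩

variable (I)

/-- The group of lifts: all pairs consisting of a rotation `g` and a fiberwise linear isometric
bundle automorphism that covers `g`. -/
def liftGroup :
    Subgroup (rotationGroup P × (Bundle.TotalSpace ℝ I ≃ₜ Bundle.TotalSpace ℝ I)) where
  carrier := {p | IsLift p.1 p.2}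
  one_mem' := by
    intro x
    exact exists_isometry_of_eq (one_smul (rotationGroup P) x).symm
  mul_mem' := by
    rintro a b ha hb x
    obtain ⟨L, hL⟩ := hb x
    obtain ⟨K, hK⟩ := ha (b.1 • x)
    obtain ⟨J, hJ⟩ := exists_isometry_of_eq (I := I) (mul_smul a.1 b.1 x).symm
    refine ⟨(L.trans K).trans J, fun v => ?_⟩
    change a.2 (b.2 ⟨x, v⟩) = _
    rw [hL, hK, hJ]
    rfl
  inv_mem' := by
    rintro a ha x
    obtain ⟨L, hL⟩ := ha (a.1⁻¹ • x)
    obtain ⟨J, hJ⟩ := exists_isometry_of_eq (I := I) (smul_inv_smul a.1 x)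
    refine ⟨(L.trans J).symm, fun v => ?_⟩
    change a.2.symm ⟨x, v⟩ = _
    rw [Homeomorph.symm_apply_eq]
    change _ = a.2 ⟨a.1⁻¹ • x, (L.trans J).symm v⟩
    rw [hL, hJ]
    exact congrArg (Bundle.TotalSpace.mk x) ((L.trans J).apply_symm_apply v).symm

/-- The projection from the group of lifts to the rotation group. -/
def liftProj : liftGroup I →* rotationGroup P :=
  (MonoidHom.fst _ _).comp (liftGroup I).subtype

end Bundle

end RegularPolytope

end

/-! Cut the complement of Γ into the cones over the facets. A facet cone minus the cones over edges
and vertices is star-shaped about the facet normal, so the line bundle is trivial there and has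
exactly two unit orientations. Two facets meeting in a 2-face compare their orientations by one
sign, since the cone over the open 2-face is convex.

The decisive claim is that the orientations can be chosen to disagree across every 2-face
(`Flag.exists_alternating_section`). With a first choice σ of orientations, let c(n,n') be minus the
comparison sign; the claim is that c is a coboundary f(n)f(n') on adjacent pairs. Around an edge
with r facets, the Möbius condition says that the comparison signs multiply to -1, so the values of
c multiply to -(-1)^r. For the five polytopes r is 3 or 5, so this product is 1 and c is a
coboundary around each edge (`units_cycle`, `Flag.exists_local_potential`). Local potentials glue to
a global one because removing the cones over the vertices does not destroy simple connectivity
(`Flag.exists_potential`). In place of fundamental groups, a generic viewpoint is used from which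
the finitely many relevant segments are visible.

Given alternating orientations, a rotation g is lifted by sending the orientation of each facet n to
that of the facet gn. On a 2-face, replacing one facet by the other flips both source and target, so
the map is well defined; compatibility with products is immediate (`Flag.exists_lift_signs`). Lifts
of the identity are locally constant signs, hence global signs because the complement is connected
(`Flag.eq_of_locally_constant`). This gives the kernel of the extension, and the lifted action
splits it.

All geometry is expressed through the finite set `N` of facet normals: `act N x` consists of the
facets met by the ray through x, and the complement of Γ consists of the unit vectors with at most
two active normals (`Flag.mem_graphCompl_iff`). The polytopes enter only through a `Flag`: simple
roots, barycenters of a flag of faces and a facet normal, with numerical relations. A bundle is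
encoded by the sign cocycle comparing arbitrary unit vectors with local continuous ones, so the
gluing concerns signs only. -/

namespace RegularPolytope

open Filter Topology

/-! ### Sign cocycles -/

/-- A `±1`-valued cocycle: `τ x y` compares the orientation chosen at `x` with the one chosen at
a nearby point `y`. -/
def IsSignCocycle {X : Type*} [TopologicalSpace X] (τ : X → X → ℤˣ) : Prop :=
  ∀ x, ∀ᶠ y in 𝓝 x, ∀ᶠ z in 𝓝 y, τ x z = τ x y * τ y z

namespace IsSignCocycle

variable {X : Type*} [TopologicalSpace X] {τ : X → X → ℤˣ}

theorem self_eq_one (hτ : IsSignCocycle τ) (x : X) : τ x x = 1 := by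
  have h := (hτ x).self_of_nhds.self_of_nhds
  simpa using h

/-- The double cover attached to a sign cocycle. -/
def core (hτ : IsSignCocycle τ) : FiberBundleCore X X ℤˣ where
  baseSet x := interior {y | ∀ᶠ z in 𝓝 y, τ x z = τ x y * τ y z}
  isOpen_baseSet _ := isOpen_interior
  indexAt x := x
  mem_baseSet_at x := mem_interior_iff_mem_nhds.2 (hτ x)
  -- On the overlap this sign is locally constant: passing from y to a nearby z multiplies both
  -- factors by τ y z, which cancels.
  coordChange i j y e := e * (τ i y * τ j y)
  coordChange_self i x _ v := by rw [Int.units_mul_self, mul_one]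
  continuousOn_coordChange i j := by
    rintro ⟨y, e⟩ ⟨⟨hi, hj⟩, -⟩
    have hi' := interior_subset hi
    have hj' := interior_subset hj
    refine ContinuousAt.continuousWithinAt ?_
    refine ContinuousAt.mul continuousAt_snd ?_
    refine ContinuousAt.congr (f := fun _ => τ i y * τ j y) continuousAt_const ?_
    have h1 : ∀ᶠ z in 𝓝 y, τ i y * τ j y = τ i z * τ j z := by
      filter_upwards [hi', hj'] with z h1 h2
      rw [h1, h2, mul_mul_mul_comm, Int.units_mul_self, mul_one]
    exact (continuousAt_fst (p := (y, e))).tendsto.eventually h1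
  coordChange_comp i j k x _ v := by
    rw [mul_assoc, ← mul_assoc (τ i x * τ j x), mul_assoc (τ i x), Int.units_mul_self, mul_one]

/-- A sign cocycle becomes trivial when pulled back along the end of a homotopy that starts at a
constant map. -/
theorem exists_section (hτ : IsSignCocycle τ) {A : Type*} [TopologicalSpace A]
    (H : C(unitInterval × A, X)) (x₀ : X) (hH : ∀ a, H (0, a) = x₀) :
    ∃ s : A → ℤˣ, ∀ a, ∀ᶠ b in 𝓝 a, s b = s a * τ (H (1, a)) (H (1, b)) := by
  have hcov : IsCoveringMap hτ.core.proj := FiberBundle.isCoveringMap (F := ℤˣ) (E := hτ.core.Fiber)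
  -- The homotopy starts at one point, so its start lifts to a constant; the end of the lifted
  -- homotopy is the section.
  let f : C(A, hτ.core.TotalSpace) := ContinuousMap.const A ⟨x₀, (1 : ℤˣ)⟩
  let G := hcov.liftHomotopy H f hH
  have hG : ∀ a, (G (1, a)).1 = H (1, a) := fun a =>
    congrFun (hcov.liftHomotopy_lifts H f hH) (1, a)
  let g : A → hτ.core.TotalSpace := fun a => G (1, a)
  have hg : Continuous g := G.continuous.comp (by fun_prop)
  refine ⟨fun a => (g a).2, fun a => ?_⟩
  have h1 := (FiberBundle.continuousAt_totalSpace ℤˣ (f := g) (x₀ := a)).1 hg.continuousAt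
  have h2 := h1.2
  rw [ContinuousAt, nhds_discrete ℤˣ, tendsto_pure] at h2
  filter_upwards [h2] with b hb
  -- The second component of `g b` is written in the chart indexed by its own base point; this
  -- converts it to the chart at the base point of `g a`, where continuity means local constancy.
  have e : ∀ b, (trivializationAt ℤˣ hτ.core.Fiber (g a).1 (g b)).2 =
      (show ℤˣ from (g b).2) * (τ (H (1, b)) (H (1, b)) * τ (H (1, a)) (H (1, b))) := by
    intro b
    rw [← hG a, ← hG b]
    rfl
  have hb' : (trivializationAt ℤˣ hτ.core.Fiber (g a).1 (g b)).2 =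
    (trivializationAt ℤˣ hτ.core.Fiber (g a).1 (g a)).2 := hb
  rw [e, e, hτ.self_eq_one, hτ.self_eq_one, one_mul, one_mul, mul_one] at hb'
  change (show ℤˣ from (g b).2) = (show ℤˣ from (g a).2) * _
  rw [← hb', mul_assoc, Int.units_mul_self, mul_one]

end IsSignCocycle

/-- A locally constant function is constant on preconnected sets. -/
theorem eq_of_eventually_eq {A B : Type*} [TopologicalSpace A]
    {S : Set A} (hS : IsPreconnected S) {f : A → B} (hf : ∀ x ∈ S, ∀ᶠ y in 𝓝[S] x, f y = f x)
    {x y : A} (hx : x ∈ S) (hy : y ∈ S) : f x = f y := by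
  let : TopologicalSpace B := ⊥
  have : DiscreteTopology B := ⟨rfl⟩
  refine hS.constant (f := f) (fun z hz => ?_) hx hy
  exact tendsto_nhds_of_eventually_eq (hf z hz)

end RegularPolytope

namespace RegularPolytope

open Filter Topology Bundle

/-! ### Riemannian line bundles -/

section LineBundle

variable {B : Type*} [TopologicalSpace B] {I : B → Type*}
  [TopologicalSpace (TotalSpace ℝ I)]
  [∀ x, NormedAddCommGroup (I x)] [∀ x, InnerProductSpace ℝ (I x)]
  [FiberBundle ℝ I] [VectorBundle ℝ ℝ I]

/-- Scaling a continuous family of vectors of a bundle by a continuous function. -/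
theorem continuousWithinAt_smul_bundle {M : Type*} [TopologicalSpace M] {b : M → B} {f : M → ℝ}
    {w : ∀ m, I (b m)} {S : Set M} {m : M} (hf : ContinuousWithinAt f S m)
    (hw : ContinuousWithinAt (fun m => (⟨b m, w m⟩ : TotalSpace ℝ I)) S m) :
    ContinuousWithinAt (fun m => (⟨b m, f m • w m⟩ : TotalSpace ℝ I)) S m := by
  rw [FiberBundle.continuousWithinAt_totalSpace] at hw ⊢
  refine ⟨hw.1, ?_⟩
  have h1 : ContinuousWithinAt
      (fun z => f z • (trivializationAt ℝ I (b m) ⟨b z, w z⟩).2) S m := hf.smul hw.2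
  have hev : ∀ᶠ z in 𝓝[S] m, b z ∈ (trivializationAt ℝ I (b m)).baseSet :=
    hw.1.eventually ((trivializationAt ℝ I (b m)).open_baseSet.mem_nhds
      (FiberBundle.mem_baseSet_trivializationAt' (b m)))
  have key : ∀ z, b z ∈ (trivializationAt ℝ I (b m)).baseSet →
      (trivializationAt ℝ I (b m) ⟨b z, f z • w z⟩).2 =
        f z • (trivializationAt ℝ I (b m) ⟨b z, w z⟩).2 := fun z hz =>
    ((trivializationAt ℝ I (b m)).linear ℝ hz).map_smul (f z) (w z)
  refine h1.congr_of_eventuallyEq ?_ ?_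
  · filter_upwards [hev] with z hz using key z hz
  · exact key m (FiberBundle.mem_baseSet_trivializationAt' (b m))

variable (I) in
theorem exists_norm_eq_one_fiber (x : B) : ∃ v : I x, ‖v‖ = 1 := by
  let e := (trivializationAt ℝ I x).continuousLinearEquivAt ℝ x
    (FiberBundle.mem_baseSet_trivializationAt' x)
  have : Nontrivial (I x) := e.symm.injective.nontrivial
  exact exists_norm_eq (I x) zero_le_one

variable (I) in
/-- An arbitrary unit vector in the fiber over `x`. -/
noncomputable def unitVec (x : B) : I x := (exists_norm_eq_one_fiber I x).choose

theorem norm_unitVec (x : B) : ‖unitVec I x‖ = 1 := (exists_norm_eq_one_fiber I x).choose_spec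

theorem exists_eq_smul_of_norm_eq_one {x : B} {u : I x} (hu : ‖u‖ = 1) (v : I x) :
    ∃ c : ℝ, v = c • u := by
  let e := (trivializationAt ℝ I x).continuousLinearEquivAt ℝ x
    (FiberBundle.mem_baseSet_trivializationAt' x)
  have hu0 : e u ≠ 0 := by
    intro h
    rw [e.map_eq_zero_iff] at h
    simp [h] at hu
  refine ⟨e v / e u, e.injective ?_⟩
  rw [map_smul, smul_eq_mul, div_mul_cancel₀ _ hu0]

theorem eq_inner_smul_unitVec {x : B} (v : I x) :
    v = inner ℝ (unitVec I x) v • unitVec I x := by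
  obtain ⟨c, hc⟩ := exists_eq_smul_of_norm_eq_one (norm_unitVec x) v
  have : inner ℝ (unitVec I x) v = c := by
    rw [hc, inner_smul_right, real_inner_self_eq_norm_sq, norm_unitVec]; simp
  rw [this]; exact hc

/-- The real number `±1`. -/
abbrev sgn (u : ℤˣ) : ℝ := ((u : ℤ) : ℝ)

theorem sgn_mul (u v : ℤˣ) : sgn (u * v) = sgn u * sgn v := by simp [sgn]

theorem sgn_mul_self (u : ℤˣ) : sgn u * sgn u = 1 := by
  rw [← sgn_mul, Int.units_mul_self]; simp [sgn]

theorem sgn_injective : Function.Injective sgn := fun u v h => by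
  have : (u : ℤ) = v := by exact_mod_cast h
  exact Units.ext this

@[simp] theorem sgn_one : sgn 1 = 1 := by simp [sgn]

@[simp] theorem sgn_neg_one : sgn (-1) = -1 := by simp [sgn]

theorem abs_sgn (u : ℤˣ) : |sgn u| = 1 := by
  rcases Int.units_eq_one_or u with rfl | rfl <;> simp [sgn]

theorem eventually_eq_of_sgn {M : Type*} [TopologicalSpace M] {f : M → ℤˣ} {m : M}
    (h : ContinuousAt (fun z => sgn (f z)) m) : ∀ᶠ z in 𝓝 m, f z = f m := by
  have := h.eventually (Metric.ball_mem_nhds _ one_pos)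
  -- Distinct signs have distance two, so distance less than one forces equality.
  filter_upwards [this] with z hz
  simp only [Real.dist_eq] at hz
  rcases Int.units_eq_one_or (f z) with h1 | h1 <;> rcases Int.units_eq_one_or (f m) with h2 | h2 <;>
    rw [h1, h2] at hz ⊢ <;> norm_num [sgn] at hz

variable [IsContinuousRiemannianBundle ℝ I]

/-- The vectors `unitVec` are chosen with no continuity. Near x, the signs t turn them into the
normalized section that is constant in a trivialization, up to a global sign. -/
theorem exists_local_orientation (x : B) : ∃ t : B → ℤˣ, t x = 1 ∧
    ∀ᶠ y in 𝓝 x, ContinuousAt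
      (fun z => (⟨z, sgn (t z) • unitVec I z⟩ : TotalSpace ℝ I)) y := by
  set e := trivializationAt ℝ I x with he
  have hx : x ∈ e.baseSet := FiberBundle.mem_baseSet_trivializationAt' x
  let w : ∀ z, I z := fun z => e.symm z 1
  have hw : ∀ y ∈ e.baseSet, ContinuousAt (fun z => (⟨z, w z⟩ : TotalSpace ℝ I)) y := by
    intro y hy
    have h1 : ContinuousOn (fun z : B => e.toOpenPartialHomeomorph.symm (z, (1 : ℝ))) e.baseSet := by
      refine e.toOpenPartialHomeomorph.symm.continuousOn.comp (by fun_prop) ?_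
      intro z hz
      simpa [e.target_eq] using hz
    refine (h1.continuousAt (e.open_baseSet.mem_nhds hy)).congr ?_
    filter_upwards [e.open_baseSet.mem_nhds hy] with z hz
    exact (e.mk_symm hz 1).symm
  have hw0 : ∀ y ∈ e.baseSet, w y ≠ 0 := by
    intro y hy h
    have h2 := e.apply_mk_symm hy (1 : ℝ)
    have h3 : (e ⟨y, (0 : I y)⟩).2 = 0 := (e.linear ℝ hy).map_zero
    change e ⟨y, w y⟩ = _ at h2
    rw [h, Prod.ext_iff] at h2
    rw [h3] at h2
    exact zero_ne_one h2.2
  let t₀ : B → ℤˣ := fun z => if 0 ≤ inner ℝ (unitVec I z) (w z) then 1 else -1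
  have ht₀ : ∀ y ∈ e.baseSet, sgn (t₀ y) • unitVec I y = ‖w y‖⁻¹ • w y := by
    intro y hy
    have h0 : ‖w y‖ ≠ 0 := norm_ne_zero_iff.2 (hw0 y hy)
    have hc := eq_inner_smul_unitVec (w y)
    set c := inner ℝ (unitVec I y) (w y) with hcdef
    have hn : ‖w y‖ = |c| := by rw [hc, norm_smul, norm_unitVec, mul_one, Real.norm_eq_abs]
    rw [hn] at h0 ⊢
    rw [hc, smul_smul]
    congr 1
    by_cases h : 0 ≤ c
    · have : t₀ y = 1 := if_pos h
      rw [this, abs_of_nonneg h, inv_mul_cancel₀ (by simpa using h0)]; simp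
    · have : t₀ y = -1 := if_neg h
      rw [this, abs_of_neg (not_le.1 h), inv_neg, neg_mul, inv_mul_cancel₀ (by simpa using h0)]; simp
  -- The factor `t₀ x` normalizes the sign at x to 1.
  refine ⟨fun z => t₀ x * t₀ z, Int.units_mul_self _, ?_⟩
  filter_upwards [e.open_baseSet.mem_nhds hx] with y hy
  have hnorm : ContinuousAt (fun z => ‖w z‖) y := by
    have h : ContinuousAt (fun z => √(inner ℝ (w z) (w z))) y :=
      ((hw y hy).inner_bundle (hw y hy)).sqrt
    refine h.congr (Eventually.of_forall fun z => ?_)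
    change √(inner ℝ (w z) (w z)) = ‖w z‖
    rw [real_inner_self_eq_norm_sq, Real.sqrt_sq (norm_nonneg _)]
  have h1 : ContinuousAt (fun z => sgn (t₀ x) * ‖w z‖⁻¹) y :=
    continuousAt_const.mul (hnorm.inv₀ (norm_ne_zero_iff.2 (hw0 y hy)))
  have h2 := continuousWithinAt_smul_bundle (b := fun z : B => z) (S := Set.univ)
    h1.continuousWithinAt (hw y hy).continuousWithinAt
  rw [continuousWithinAt_univ] at h2
  refine h2.congr ?_
  filter_upwards [e.open_baseSet.mem_nhds hy] with z hz
  rw [mul_smul, ← ht₀ z hz, smul_smul, sgn_mul]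

variable (I) in
/-- The sign cocycle of a Riemannian line bundle. -/
noncomputable def bundleSign (x : B) : B → ℤˣ := (exists_local_orientation (I := I) x).choose

theorem bundleSign_self (x : B) : bundleSign I x x = 1 :=
  (exists_local_orientation (I := I) x).choose_spec.1

theorem eventually_continuousAt_bundleSign (x : B) : ∀ᶠ y in 𝓝 x, ContinuousAt
    (fun z => (⟨z, sgn (bundleSign I x z) • unitVec I z⟩ : TotalSpace ℝ I)) y :=
  (exists_local_orientation (I := I) x).choose_spec.2

/-- The inner product of the local unit sections attached to x and to y is a continuous function
with values ±1 near y, hence locally constant; comparing its values at z and at y gives the cocycle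
relation. -/
theorem isSignCocycle_bundleSign : IsSignCocycle (bundleSign I) := by
  intro x
  filter_upwards [eventually_continuousAt_bundleSign (I := I) x] with y hy
  have h := hy.inner_bundle (eventually_continuousAt_bundleSign (I := I) y).self_of_nhds
  have h2 : ContinuousAt (fun z => sgn (bundleSign I x z * bundleSign I y z)) y := by
    refine h.congr (Eventually.of_forall fun z => ?_)
    simp only
    rw [inner_smul_left, inner_smul_right, real_inner_self_eq_norm_sq, norm_unitVec, sgn_mul]
    simp
  filter_upwards [eventually_eq_of_sgn h2] with z hz
  rw [bundleSign_self, mul_one] at hz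
  rw [← hz, mul_assoc, Int.units_mul_self, mul_one]

/-- A choice of signs that locally follows the sign cocycle gives a continuous section. -/
theorem continuousWithinAt_sgn_smul_unitVec {S : Set B} {s : B → ℤˣ} {x : B}
    (hs : ∀ᶠ y in 𝓝[S] x, s y = s x * bundleSign I x y) :
    ContinuousWithinAt (fun y => (⟨y, sgn (s y) • unitVec I y⟩ : TotalSpace ℝ I)) S x := by
  have h := (eventually_continuousAt_bundleSign (I := I) x).self_of_nhds.continuousWithinAt (s := S)
  have h2 := continuousWithinAt_smul_bundle (continuousWithinAt_const (b := sgn (s x))) h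
  refine h2.congr_of_eventuallyEq ?_ ?_
  · filter_upwards [hs] with y hy
    rw [hy, smul_smul, ← sgn_mul]
  · simp [bundleSign_self]

/-- The bundle map over `f` that maps the distinguished unit vector at `x` to `κ x` times the one
at `f x` is continuous if the signs `κ` are compatible with the sign cocycle. -/
theorem continuous_sgn_inner_smul {f : B → B} (hf : Continuous f) {κ : B → ℤˣ}
    (hκ : ∀ x, ∀ᶠ y in 𝓝 x, κ y = κ x * (bundleSign I x y * bundleSign I (f x) (f y))) :
    Continuous (fun p : TotalSpace ℝ I => (⟨f p.1, (sgn (κ p.1) * inner ℝ (unitVec I p.1) p.2) •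
      unitVec I (f p.1)⟩ : TotalSpace ℝ I)) := by
  rw [continuous_iff_continuousAt]
  intro p
  have hπ : ContinuousAt (fun q : TotalSpace ℝ I => q.1) p :=
    (FiberBundle.continuous_proj ℝ I).continuousAt
  have h1 := ContinuousAt.comp (x := p) (f := fun q : TotalSpace ℝ I => q.1)
    (eventually_continuousAt_bundleSign (I := I) p.1).self_of_nhds hπ
  have h2 := ContinuousAt.comp (x := p) (f := fun q : TotalSpace ℝ I => f q.1)
    (eventually_continuousAt_bundleSign (I := I) (f p.1)).self_of_nhds (hf.continuousAt.comp hπ)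
  have h3 : ContinuousAt (fun q : TotalSpace ℝ I =>
      (inner ℝ (sgn (bundleSign I p.1 q.1) • unitVec I q.1) q.2 : ℝ)) p :=
    ContinuousAt.inner_bundle (F := ℝ) (b := fun q : TotalSpace ℝ I => q.1)
      (w := fun q : TotalSpace ℝ I => q.2) h1 continuousAt_id
  have h4 := continuousWithinAt_smul_bundle (S := Set.univ)
    (b := fun q : TotalSpace ℝ I => f q.1)
    (w := fun q : TotalSpace ℝ I => sgn (bundleSign I (f p.1) (f q.1)) • unitVec I (f q.1))
    ((continuousAt_const (y := sgn (κ p.1))).mul h3).continuousWithinAt h2.continuousWithinAt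
  rw [continuousWithinAt_univ] at h4
  refine h4.congr ?_
  filter_upwards [hπ.eventually (hκ p.1)] with q hq
  rw [Pi.mul_apply, hq, inner_smul_left, smul_smul, sgn_mul, sgn_mul, conj_trivial]
  congr 2
  ring

end LineBundle

/-! ### Flags of regular polytopes -/

/-- The reflection in the hyperplane orthogonal to `a`. -/
noncomputable def refl (a : E4) : E4 ≃ₗᵢ[ℝ] E4 := (ℝ ∙ a)ᗮ.reflection

theorem refl_apply (a x : E4) : refl a x = x - (2 * inner ℝ a x / inner ℝ a a) • a := by
  rw [refl, Submodule.reflection_orthogonal_apply, Submodule.reflection_singleton_apply,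
    real_inner_self_eq_norm_sq, neg_sub, ← smul_assoc]
  congr 2
  simp only [RCLike.ofReal_real_eq_id, id_eq, nsmul_eq_mul, Nat.cast_ofNat]
  ring

theorem refl_refl (a x : E4) : refl a (refl a x) = x := Submodule.reflection_reflection _ x

theorem refl_eq_self {a x : E4} (h : inner ℝ a x = 0) : refl a x = x := by
  rw [refl_apply, h]; simp

theorem inner_refl_left (a x y : E4) : inner ℝ (refl a x) y = inner ℝ x (refl a y) := by
  rw [← (refl a).inner_map_map (refl a x) y, refl_refl]

theorem refl_map (c : ℝ) (A : E4 ≃ₗᵢ[ℝ] E4) (a x : E4) :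
    refl (A a) (c • A x) = c • A (refl a x) := by
  rw [refl_apply, refl_apply, inner_smul_right, A.inner_map_map, A.inner_map_map, map_sub, map_smul,
    smul_sub, smul_smul]
  congr 2
  ring

/-- The data of a regular polytope with vertex set `V`, seen from a flag: simple roots `α` of the
symmetry group, the barycenters `b` of the faces of the flag (in the affine chart in which the facet
is `⟨n, x⟩ = 1`), and the normal vector `n` of the facet. The number of facets around an edge is
three if `q = 1` and five if `q` is the golden ratio. -/
structure Flag (V : Set E4) where
  α : Fin 4 → E4
  b : Fin 4 → E4
  n : E4
  q : ℝ
  finite : V.Finite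
  norm_eq : ∀ v ∈ V, ‖v‖ = ‖b 0‖
  b_zero_mem : b 0 ∈ V
  refl_mem : ∀ i, ∀ v ∈ V, refl (α i) v ∈ V
  inner_ne : ∀ i j, i ≠ j → inner ℝ (α i) (b j) = 0
  inner_pos : ∀ i, 0 < inner ℝ (α i) (b i)
  b_mem : ∀ i, b i ∈ convexHull ℝ V
  zero_mem : (0 : E4) ∈ convexHull ℝ V
  b_one : b 1 = (1 / 2 : ℝ) • (b 0 + refl (α 0) (b 0))
  inner_n_b : ∀ i, inner ℝ n (b i) = 1
  inner_α_n : ∀ i, i ≠ 3 → inner ℝ (α i) n = 0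
  inner_α_n_pos : 0 < inner ℝ (α 3) n
  inner_n_le : ∀ v ∈ V, inner ℝ n v ≤ 1
  inner_α₀₂ : inner ℝ (α 0) (α 2) = 0
  inner_α₀₃ : inner ℝ (α 0) (α 3) = 0
  inner_α₁₃ : inner ℝ (α 1) (α 3) = 0
  norm_α : inner ℝ (α 2) (α 2) = (inner ℝ (α 3) (α 3) : ℝ)
  -- As both roots have the same length, q is 2 cos(π/r), with r the number of facets around an
  -- edge.
  inner_α₂₃ : 2 * inner ℝ (α 2) (α 3) = -q * inner ℝ (α 3) (α 3)
  q_eq : q = 1 ∨ q = Real.goldenRatio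

/-- `g` permutes the set `V`. -/
def IsSymm (V : Set E4) (g : E4 ≃ₗᵢ[ℝ] E4) : Prop := g '' V = V

theorem IsSymm.mul {V : Set E4} {g h : E4 ≃ₗᵢ[ℝ] E4} (hg : IsSymm V g) (hh : IsSymm V h) :
    IsSymm V (g * h) := by
  have : ((g * h : E4 ≃ₗᵢ[ℝ] E4) : E4 → E4) = g ∘ h := rfl
  rw [IsSymm, this, Set.image_comp, hh, hg]

theorem IsSymm.one (V : Set E4) : IsSymm V 1 := Set.image_id V

theorem IsSymm.inv {V : Set E4} {g : E4 ≃ₗᵢ[ℝ] E4} (hg : IsSymm V g) : IsSymm V g⁻¹ := by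
  have h : ((g⁻¹ : E4 ≃ₗᵢ[ℝ] E4) : E4 → E4) ∘ g = id := by
    funext x
    exact g.symm_apply_apply x
  change ((g⁻¹ : E4 ≃ₗᵢ[ℝ] E4) : E4 → E4) '' V = V
  conv_lhs => rw [← (show g '' V = V from hg)]
  rw [← Set.image_comp, h, Set.image_id]

theorem IsSymm.pow {V : Set E4} {g : E4 ≃ₗᵢ[ℝ] E4} (hg : IsSymm V g) (k : ℕ) :
    IsSymm V (g ^ k) := by
  induction k with
  | zero => exact IsSymm.one V
  | succ k ih => rw [pow_succ]; exact ih.mul hg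

/-- The elements of `N` whose inner product with `x` is maximal. -/
def act (N : Set E4) (x : E4) : Set E4 := {m ∈ N | ∀ m' ∈ N, inner ℝ m' x ≤ inner ℝ m x}

namespace Flag

variable {V : Set E4} (S : Flag V)

/-- The image of a flag under a similarity. -/
noncomputable def map (c : ℝ) (hc : 0 < c) (A : E4 ≃ₗᵢ[ℝ] E4) {V' : Set E4}
    (hV : V' = (fun x => c • A x) '' V) : Flag V' where
  α i := A (S.α i)
  b i := c • A (S.b i)
  n := c⁻¹ • A S.n
  q := S.q
  finite := hV ▸ S.finite.image _
  norm_eq := by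
    subst hV
    rintro _ ⟨v, hv, rfl⟩
    simp only [norm_smul, A.norm_map, S.norm_eq v hv]
  b_zero_mem := hV ▸ Set.mem_image_of_mem _ S.b_zero_mem
  refl_mem := by
    subst hV
    rintro i _ ⟨v, hv, rfl⟩
    exact ⟨_, S.refl_mem i v hv, (refl_map c A _ _).symm⟩
  inner_ne i j h := by rw [inner_smul_right, A.inner_map_map, S.inner_ne i j h, mul_zero]
  inner_pos i := by
    rw [inner_smul_right, A.inner_map_map]
    exact mul_pos hc (S.inner_pos i)
  b_mem i := by
    have h := (c • A.toLinearEquiv.toLinearMap).image_convexHull V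
    subst hV
    exact h ▸ Set.mem_image_of_mem _ (S.b_mem i)
  zero_mem := by
    have h := (c • A.toLinearEquiv.toLinearMap).image_convexHull V
    subst hV
    rw [← map_zero (c • A.toLinearEquiv.toLinearMap)]
    exact h ▸ Set.mem_image_of_mem _ S.zero_mem
  b_one := by
    rw [refl_map, ← smul_add, ← map_add, S.b_one, map_smul, smul_comm]
  inner_n_b i := by
    rw [inner_smul_right, inner_smul_left, A.inner_map_map, S.inner_n_b]
    simp [hc.ne']
  inner_α_n i hi := by rw [inner_smul_right, A.inner_map_map, S.inner_α_n i hi, mul_zero]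
  inner_α_n_pos := by
    rw [inner_smul_right, A.inner_map_map]
    exact mul_pos (inv_pos.2 hc) S.inner_α_n_pos
  inner_n_le := by
    subst hV
    rintro _ ⟨v, hv, rfl⟩
    have : inner ℝ (c⁻¹ • A S.n) (c • A v) = (inner ℝ S.n v : ℝ) := by
      rw [inner_smul_right, inner_smul_left, A.inner_map_map]
      simp [hc.ne']
    rw [this]
    exact S.inner_n_le v hv
  inner_α₀₂ := by rw [A.inner_map_map, S.inner_α₀₂]
  inner_α₀₃ := by rw [A.inner_map_map, S.inner_α₀₃]
  inner_α₁₃ := by rw [A.inner_map_map, S.inner_α₁₃]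
  norm_α := by rw [A.inner_map_map, A.inner_map_map, S.norm_α]
  inner_α₂₃ := by rw [A.inner_map_map, A.inner_map_map, S.inner_α₂₃]
  q_eq := S.q_eq

/-- The image of a flag under a symmetry. -/
noncomputable def move {g : E4 ≃ₗᵢ[ℝ] E4} (hg : IsSymm V g) : Flag V :=
  S.map 1 one_pos g (by simpa only [one_smul] using hg.symm)

theorem move_α {g : E4 ≃ₗᵢ[ℝ] E4} (hg : IsSymm V g) (i : Fin 4) : (S.move hg).α i = g (S.α i) := rfl

theorem move_b {g : E4 ≃ₗᵢ[ℝ] E4} (hg : IsSymm V g) (i : Fin 4) : (S.move hg).b i = g (S.b i) :=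
  one_smul ℝ _

theorem move_n {g : E4 ≃ₗᵢ[ℝ] E4} (hg : IsSymm V g) : (S.move hg).n = g S.n := by
  change (1 : ℝ)⁻¹ • g S.n = g S.n
  simp

/-- Up to positive factors the roots are dual to the barycenters, so the latter form a basis whose
coordinate functions are the pairings with the roots. -/
theorem eq_zero_of_inner_α {x : E4} (h : ∀ i, inner ℝ (S.α i) x = 0) : x = 0 := by
  have hli : LinearIndependent ℝ S.b := by
    rw [Fintype.linearIndependent_iff]
    intro c hc i
    have h1 := congrArg (fun y => (inner ℝ (S.α i) y : ℝ)) hc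
    simp only [inner_sum, inner_smul_right, inner_zero_right] at h1
    rw [Finset.sum_eq_single i (fun j _ hj => by rw [S.inner_ne i j hj.symm, mul_zero])
      (by simp)] at h1
    exact (mul_eq_zero.1 h1).resolve_right (S.inner_pos i).ne'
  let B := basisOfLinearIndependentOfCardEqFinrank hli (by simp)
  have hx := B.sum_repr x
  have hB : ∀ i, B i = S.b i := fun i => by simp [B]
  simp only [hB] at hx
  have hc : ∀ i, B.repr x i = 0 := by
    intro i
    have h1 := congrArg (fun y => (inner ℝ (S.α i) y : ℝ)) hx
    simp only [inner_sum, inner_smul_right, h i] at h1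
    rw [Finset.sum_eq_single i (fun j _ hj => by rw [S.inner_ne i j hj.symm, mul_zero])
      (by simp)] at h1
    exact (mul_eq_zero.1 h1).resolve_right (S.inner_pos i).ne'
  rw [← hx]
  simp [hc]

/-- The coordinates with respect to the barycenters of the flag. -/
noncomputable def coord (i : Fin 4) (x : E4) : ℝ := inner ℝ (S.α i) x / inner ℝ (S.α i) (S.b i)

theorem sum_coord (x : E4) : ∑ i, S.coord i x • S.b i = x := by
  rw [← sub_eq_zero]
  refine S.eq_zero_of_inner_α fun i => ?_
  rw [inner_sub_right, inner_sum]
  simp only [inner_smul_right]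
  rw [Finset.sum_eq_single i (fun j _ hj => by rw [S.inner_ne i j hj.symm, mul_zero])
      (by simp), coord, div_mul_cancel₀ _ (S.inner_pos i).ne', sub_self]

theorem span_eq_top {V : Set E4} (S : Flag V) : Submodule.span ℝ V = ⊤ := by
  rw [eq_top_iff]
  intro x _
  rw [← S.sum_coord x]
  refine Submodule.sum_mem _ fun i _ => Submodule.smul_mem _ _ ?_
  exact convexHull_min Submodule.subset_span (Submodule.convex _) (S.b_mem i)

/-- A symmetry is determined by its action on the finite spanning set V. -/
theorem finite_isSymm {V : Set E4} (S : Flag V) : {g | IsSymm V g}.Finite := by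
  have : Finite V := S.finite
  refine Set.Finite.of_injOn (f := fun g : E4 ≃ₗᵢ[ℝ] E4 => fun v : V => g v)
    (t := Set.pi Set.univ fun _ : V => V) ?_ ?_ (Set.Finite.pi fun _ => S.finite)
  · intro g hg v _
    have h : IsSymm V g := hg
    exact h.subset (Set.mem_image_of_mem _ v.2)
  · intro g _ h _ hgh
    have h1 : g.toLinearEquiv.toLinearMap = h.toLinearEquiv.toLinearMap :=
      LinearMap.ext_on S.span_eq_top fun v hv => congrFun hgh ⟨v, hv⟩
    ext1 x
    exact LinearMap.congr_fun h1 x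

theorem isSymm_refl (i : Fin 4) : IsSymm V (refl (S.α i)) := by
  refine Set.Subset.antisymm ?_ fun v hv => ⟨_, S.refl_mem i v hv, refl_refl _ _⟩
  rintro _ ⟨v, hv, rfl⟩
  exact S.refl_mem i v hv

/-- Every point can be moved into the chamber of the flag. -/
theorem exists_move_mem_chamber (x : E4) :
    ∃ g, ∃ hg : IsSymm V g, ∀ i, 0 ≤ (S.move hg).coord i x := by
  -- The sum of the barycenters is interior to the chamber. If g x were strictly on the wrong side
  -- of a wall, reflecting it would increase the pairing with this sum.
  obtain ⟨g, hg, hmax⟩ := Set.exists_max_image _ (fun g : E4 ≃ₗᵢ[ℝ] E4 =>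
    (inner ℝ (g x) (∑ i, S.b i) : ℝ)) S.finite_isSymm ⟨1, IsSymm.one V⟩
  refine ⟨g⁻¹, IsSymm.inv hg, fun i => ?_⟩
  have h1 := hmax (refl (S.α i) * g) ((S.isSymm_refl i).mul hg)
  change (inner ℝ (refl (S.α i) (g x)) (∑ i, S.b i) : ℝ) ≤ _ at h1
  have hρ : inner ℝ (S.α i) (∑ i, S.b i) = inner ℝ (S.α i) (S.b i) := by
    rw [inner_sum, Finset.sum_eq_single i (fun j _ hj => S.inner_ne i j hj.symm) (by simp)]
  have hpos := S.inner_pos i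
  have hα : 0 < (inner ℝ (S.α i) (S.α i) : ℝ) := by
    rw [real_inner_self_eq_norm_sq]
    have : S.α i ≠ 0 := by
      intro h
      rw [h, inner_zero_left] at hpos
      exact hpos.false
    positivity
  rw [refl_apply, inner_sub_left, inner_smul_left, hρ, conj_trivial] at h1
  have h2 : 0 ≤ (inner ℝ (S.α i) (g x) : ℝ) := by
    by_contra hneg
    push Not at hneg
    have : 2 * inner ℝ (S.α i) (g x) / inner ℝ (S.α i) (S.α i) * inner ℝ (S.α i) (S.b i) < 0 :=
      mul_neg_of_neg_of_pos (div_neg_of_neg_of_pos (by linarith) hα) hpos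
    linarith
  refine div_nonneg ?_ ((S.move _).inner_pos i).le
  rw [move_α, ← g.inner_map_map]
  have : g (g⁻¹ (S.α i)) = S.α i := g.apply_symm_apply _
  rwa [this]

/-! ### Facet normals -/

/-- The normal vectors of all facets. -/
def N : Set E4 := {m | ∃ g, IsSymm V g ∧ m = g S.n}

theorem n_mem : S.n ∈ S.N := ⟨1, IsSymm.one V, rfl⟩

theorem map_mem_N {g : E4 ≃ₗᵢ[ℝ] E4} (hg : IsSymm V g) {m : E4} (hm : m ∈ S.N) : g m ∈ S.N := by
  obtain ⟨h, hh, rfl⟩ := hm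
  exact ⟨g * h, hg.mul hh, rfl⟩

theorem map_mem_N_iff {g : E4 ≃ₗᵢ[ℝ] E4} (hg : IsSymm V g) {m : E4} : g m ∈ S.N ↔ m ∈ S.N := by
  refine ⟨fun h => ?_, S.map_mem_N hg⟩
  have := S.map_mem_N hg.inv h
  rwa [show g⁻¹ (g m) = m from g.symm_apply_apply m] at this

theorem N_finite : S.N.Finite := by
  refine (S.finite_isSymm.image fun g => g S.n).subset ?_
  rintro _ ⟨g, hg, rfl⟩
  exact ⟨g, hg, rfl⟩

theorem N_move {g : E4 ≃ₗᵢ[ℝ] E4} (hg : IsSymm V g) : (S.move hg).N = S.N := by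
  ext m
  constructor
  · rintro ⟨h, hh, rfl⟩
    rw [move_n]
    exact ⟨h * g, hh.mul hg, rfl⟩
  · rintro ⟨h, hh, rfl⟩
    refine ⟨h * g⁻¹, hh.mul hg.inv, ?_⟩
    rw [move_n]
    exact congrArg h (g.symm_apply_apply S.n).symm

theorem norm_of_mem_N {m : E4} (hm : m ∈ S.N) : ‖m‖ = ‖S.n‖ := by
  obtain ⟨g, _, rfl⟩ := hm
  exact g.norm_map _

theorem inner_le_one {m : E4} (hm : m ∈ S.N) {x : E4} (hx : x ∈ convexHull ℝ V) :
    inner ℝ m x ≤ 1 := by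
  have h : V ⊆ {x | inner ℝ m x ≤ 1} := by
    intro v hv
    obtain ⟨g, hg, rfl⟩ := hm
    have hg' : IsSymm V g := hg
    rw [← hg'] at hv
    obtain ⟨w, hw, rfl⟩ := hv
    change inner ℝ (g S.n) (g w) ≤ 1
    rw [g.inner_map_map]
    exact S.inner_n_le w hw
  refine convexHull_min h ?_ hx
  exact convex_halfSpace_le (innerSL ℝ m).toLinearMap.isLinear 1

theorem eq_of_inner_eq {m m' : E4} (hm : m ∈ S.N) (hm' : m' ∈ S.N)
    (h : inner ℝ m m' = (inner ℝ m m : ℝ)) : m = m' := by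
  rw [← sub_eq_zero, ← norm_eq_zero, ← sq_eq_zero_iff, @norm_sub_sq_real, h,
    real_inner_self_eq_norm_sq, S.norm_of_mem_N hm, S.norm_of_mem_N hm']
  ring

/-- A set of facet normals that contains `n` and is stable under all simple reflections but one
contains all facets through the corresponding barycenter. -/
theorem mem_of_stable (i : Fin 4) {O : Set E4} (hn : S.n ∈ O)
    (hO : ∀ j, j ≠ i → ∀ m ∈ O, refl (S.α j) m ∈ O) {m : E4} (hm : m ∈ S.N)
    (hmb : inner ℝ m (S.b i) = 1) : m ∈ O := by
  by_contra hmO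
  -- Among the normals at `b i` outside O take the one highest over the chamber. The reflections
  -- other than the i-th permute these normals, so maximality makes m pair nonnegatively with the
  -- corresponding roots.
  obtain ⟨m, ⟨⟨hm, hmb⟩, hmO⟩, hmax⟩ := Set.exists_max_image
    ({m ∈ S.N | inner ℝ m (S.b i) = 1} \ O) (fun m => (inner ℝ m (∑ i, S.b i) : ℝ))
    ((S.N_finite.subset (Set.sep_subset _ _)).subset Set.sdiff_subset) ⟨m, ⟨hm, hmb⟩, hmO⟩
  have hα : ∀ j, j ≠ i → 0 ≤ (inner ℝ (S.α j) m : ℝ) := by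
    intro j hj
    have h1 := hmax (refl (S.α j) m) ⟨⟨S.map_mem_N (S.isSymm_refl j) hm, ?_⟩, fun h => hmO ?_⟩
    · have hpos := S.inner_pos j
      have hα : 0 ≤ (inner ℝ (S.α j) (S.α j) : ℝ) := real_inner_self_nonneg
      have hρ : inner ℝ (S.α j) (∑ i, S.b i) = inner ℝ (S.α j) (S.b j) := by
        rw [inner_sum, Finset.sum_eq_single j (fun k _ hk => S.inner_ne j k hk.symm) (by simp)]
      rw [refl_apply, inner_sub_left, inner_smul_left, hρ, conj_trivial] at h1
      have hα' : 0 < (inner ℝ (S.α j) (S.α j) : ℝ) := by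
        refine hα.lt_of_ne' fun h => ?_
        rw [inner_self_eq_zero] at h
        rw [h, inner_zero_left] at hpos
        exact hpos.false
      by_contra hneg
      push Not at hneg
      have : 2 * inner ℝ (S.α j) m / inner ℝ (S.α j) (S.α j) * inner ℝ (S.α j) (S.b j) < 0 :=
        mul_neg_of_neg_of_pos (div_neg_of_neg_of_pos (by linarith) hα') hpos
      linarith
    · rw [inner_refl_left, refl_eq_self (S.inner_ne j i hj), hmb]
    · rw [← refl_refl (S.α j) m]
      exact hO j hj _ h
  -- Expanding m in the barycenters: n - m vanishes on `b i` and is nonnegative on the others, whose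
  -- coefficients in m are nonnegative. As m and n have equal norms, m = n follows.
  have h2 : 0 ≤ (inner ℝ (S.n - m) m : ℝ) := by
    have hs : (inner ℝ (S.n - m) m : ℝ) = ∑ j, S.coord j m * inner ℝ (S.n - m) (S.b j) := by
      conv_lhs => rw [← congrArg (inner ℝ (S.n - m)) (S.sum_coord m)]
      rw [inner_sum]
      simp only [inner_smul_right]
    rw [hs]
    refine Finset.sum_nonneg fun j _ => ?_
    rw [inner_sub_left, S.inner_n_b]
    by_cases hj : j = i
    · rw [hj, hmb, sub_self, mul_zero]
    · exact mul_nonneg (div_nonneg (hα j hj) (S.inner_pos j).le)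
        (sub_nonneg.2 (S.inner_le_one hm (S.b_mem j)))
  have h3 : ‖S.n - m‖ ^ 2 ≤ 0 := by
    have h4 := @norm_sub_sq_real _ _ _ S.n m
    rw [inner_sub_left, real_inner_self_eq_norm_sq, S.norm_of_mem_N hm] at h2
    rw [S.norm_of_mem_N hm] at h4
    linarith
  have h5 : S.n - m = 0 := norm_eq_zero.1 (sq_eq_zero_iff.1 (le_antisymm h3 (sq_nonneg _)))
  exact hmO (sub_eq_zero.1 h5 ▸ hn)

/-- Every facet normal is at most 1 on each barycenter, and n is 1 on all of them. For a nonnegative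
combination of barycenters the maximum is therefore the sum of the coefficients, attained only with
equality in every term of positive weight. -/
theorem mem_act_iff {x : E4} (hx : ∀ i, 0 ≤ S.coord i x) {m : E4} :
    m ∈ act S.N x ↔ m ∈ S.N ∧ ∀ i, 0 < S.coord i x → inner ℝ m (S.b i) = 1 := by
  have hsum : ∀ m : E4, inner ℝ m x = ∑ i, S.coord i x * inner ℝ m (S.b i) := by
    intro m
    conv_lhs => rw [← congrArg (inner ℝ m) (S.sum_coord x)]
    rw [inner_sum]
    simp only [inner_smul_right]
  have hle : ∀ m ∈ S.N, ∀ i, S.coord i x * inner ℝ m (S.b i) ≤ S.coord i x := fun m hm i =>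
    mul_le_of_le_one_right (hx i) (S.inner_le_one hm (S.b_mem i))
  have hle' : ∀ m ∈ S.N, inner ℝ m x ≤ ∑ i, S.coord i x := fun m hm => by
    rw [hsum]
    exact Finset.sum_le_sum fun i _ => hle m hm i
  constructor
  · rintro ⟨hm, hmax⟩
    refine ⟨hm, fun i hi => ?_⟩
    have h1 := hmax _ S.n_mem
    rw [hsum S.n] at h1
    simp only [S.inner_n_b, mul_one] at h1
    have h2 : ∑ i, S.coord i x * inner ℝ m (S.b i) = ∑ i, S.coord i x :=
      le_antisymm (hsum m ▸ hle' m hm) (hsum m ▸ h1)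
    have h3 := (Finset.sum_eq_sum_iff_of_le fun i _ => hle m hm i).1 h2 i (Finset.mem_univ i)
    exact mul_left_cancel₀ hi.ne' (h3.trans (mul_one _).symm)
  · rintro ⟨hm, h⟩
    refine ⟨hm, fun m' hm' => (hle' m' hm').trans_eq ?_⟩
    rw [hsum]
    refine Finset.sum_congr rfl fun i _ => ?_
    rcases (hx i).eq_or_lt with h0 | h0
    · rw [← h0, zero_mul]
    · rw [h i h0, mul_one]

end Flag

/-! ### Active normals under symmetries, scaling and perturbation -/

theorem mem_act_map_iff {V : Set E4} (S : Flag V) {g : E4 ≃ₗᵢ[ℝ] E4} (hg : IsSymm V g) {m x : E4} :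
    g m ∈ act S.N (g x) ↔ m ∈ act S.N x := by
  constructor
  · rintro ⟨h1, h2⟩
    refine ⟨(S.map_mem_N_iff hg).1 h1, fun m' hm' => ?_⟩
    simpa using h2 (g m') (S.map_mem_N hg hm')
  · rintro ⟨h1, h2⟩
    refine ⟨S.map_mem_N hg h1, fun m' hm' => ?_⟩
    have := h2 (g⁻¹ m') (S.map_mem_N hg.inv hm')
    rw [← g.inner_map_map (g⁻¹ m'), show g (g⁻¹ m') = m' from g.apply_symm_apply m'] at this
    rwa [g.inner_map_map]

/-- At most two elements of `N` are active at `x`. -/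
def FewActive (N : Set E4) (x : E4) : Prop := ∃ a b, act N x ⊆ {a, b}

theorem act_smul (N : Set E4) {c : ℝ} (hc : 0 < c) (x : E4) : act N (c • x) = act N x := by
  ext m
  simp only [act, Set.mem_ofPred_eq, inner_smul_right, mul_le_mul_iff_right₀ hc]

/-- An inactive normal is beaten strictly by another one, which is an open condition, and there are
finitely many normals. -/
theorem eventually_act_subset {N : Set E4} (hN : N.Finite) (x : E4) :
    ∀ᶠ y in 𝓝 x, act N y ⊆ act N x := by
  have h : ∀ m ∈ N, m ∉ act N x → ∀ᶠ y in 𝓝 x, m ∉ act N y := by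
    intro m hm hmx
    have : ∃ m' ∈ N, inner ℝ m x < inner ℝ m' x := by
      by_contra hcon
      push Not at hcon
      exact hmx ⟨hm, hcon⟩
    obtain ⟨m', hm', hlt⟩ := this
    have h1 : ContinuousAt (fun y => (inner ℝ m y : ℝ)) x := by fun_prop
    have h2 : ContinuousAt (fun y => (inner ℝ m' y : ℝ)) x := by fun_prop
    filter_upwards [h1.eventually_lt h2 hlt] with y hy hmem
    exact (hmem.2 m' hm').not_gt hy
  have h2 : ∀ᶠ y in 𝓝 x, ∀ m ∈ N, m ∉ act N x → m ∉ act N y := by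
    rw [Filter.eventually_all_finite hN]
    intro m hm
    by_cases hmx : m ∈ act N x
    · exact Eventually.of_forall fun y hy => absurd hmx hy
    · filter_upwards [h m hm hmx] with y hy _ using hy
  filter_upwards [h2] with y hy m hm
  by_contra hmx
  exact hy m hm.1 hmx hm

theorem act_nonempty {N : Set E4} (hN : N.Finite) (hne : N.Nonempty) (x : E4) :
    (act N x).Nonempty := by
  obtain ⟨m, hm, hmax⟩ := Set.exists_max_image N (fun m => (inner ℝ m x : ℝ)) hN hne
  exact ⟨m, hm, hmax⟩

/-! ### The polygon of facet normals around an edge -/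

namespace Flag

variable {V : Set E4} (S : Flag V)

/-- The distance between the normals of adjacent facets. -/
noncomputable def gap : ℝ := ‖S.n - refl (S.α 3) S.n‖

theorem gap_move {g : E4 ≃ₗᵢ[ℝ] E4} (hg : IsSymm V g) : (S.move hg).gap = S.gap := by
  have := refl_map 1 g (S.α 3) S.n
  rw [one_smul, one_smul] at this
  rw [gap, move_n, move_α, this, ← map_sub, g.norm_map, gap]

/-- Pointwise statements about N and the gap may thus be proved with a flag whose chamber contains
the point. -/
theorem exists_flag_chamber (x : E4) :
    ∃ S' : Flag V, S'.N = S.N ∧ S'.gap = S.gap ∧ ∀ i, 0 ≤ S'.coord i x := by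
  obtain ⟨g, hg, h⟩ := S.exists_move_mem_chamber x
  exact ⟨S.move hg, S.N_move hg, S.gap_move hg, h⟩

/-- For the converse, use a flag whose chamber contains x. Then ⟨n, x⟩ is the sum of the coordinates
of x; as it is at most 1, the missing weight can be put on the origin, represented by `none`. -/
theorem mem_convexHull_iff {x : E4} :
    x ∈ convexHull ℝ V ↔ ∀ m ∈ S.N, inner ℝ m x ≤ 1 := by
  refine ⟨fun hx m hm => S.inner_le_one hm hx, fun hx => ?_⟩
  obtain ⟨S', hN, -, hS'⟩ := S.exists_flag_chamber x
  have h1 := hx S'.n (hN ▸ S'.n_mem)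
  rw [← congrArg (inner ℝ S'.n) (S'.sum_coord x), inner_sum] at h1
  simp only [inner_smul_right, S'.inner_n_b, mul_one] at h1
  have h2 := (convex_convexHull ℝ V).sum_mem (t := Finset.univ)
    (w := fun o : Option (Fin 4) => o.elim (1 - ∑ i, S'.coord i x) (fun i => S'.coord i x))
    (z := fun o : Option (Fin 4) => o.elim 0 S'.b) ?_ ?_ ?_
  · rw [Fintype.sum_option] at h2
    simp only [Option.elim_none, smul_zero, Option.elim_some, S'.sum_coord, zero_add] at h2
    exact h2
  · rintro (_ | i) -
    · exact sub_nonneg.2 h1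
    · exact hS' i
  · rw [Fintype.sum_option]
    simp
  · rintro (_ | i) -
    · exact S'.zero_mem
    · exact S'.b_mem i

theorem inner_α_self_pos (i : Fin 4) : 0 < (inner ℝ (S.α i) (S.α i) : ℝ) := by
  refine real_inner_self_nonneg.lt_of_ne' fun h => ?_
  have hpos := S.inner_pos i
  rw [inner_self_eq_zero] at h
  rw [h, inner_zero_left] at hpos
  exact hpos.false

theorem q_pos : 0 < S.q := by
  rcases S.q_eq with h | h <;> rw [h]
  · exact one_pos
  · exact Real.goldenRatio_pos

/-- The size of the polygon of facet normals around the edge of the flag. -/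
noncomputable def size : ℝ := 2 * inner ℝ (S.α 3) S.n / inner ℝ (S.α 3) (S.α 3)

theorem size_pos : 0 < S.size :=
  div_pos (mul_pos two_pos S.inner_α_n_pos) (S.inner_α_self_pos 3)

/-- Points in the plane of the polygon of facet normals around the edge of the flag. -/
noncomputable def pt (x y : ℝ) : E4 := S.n - S.size • (x • S.α 2 + y • S.α 3)

theorem inner_pt_left (x y : ℝ) (z : E4) : inner ℝ (S.pt x y) z =
    inner ℝ S.n z - S.size * (x * inner ℝ (S.α 2) z + y * inner ℝ (S.α 3) z) := by
  rw [pt, inner_sub_left, inner_smul_left, inner_add_left, inner_smul_left, inner_smul_left]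
  rfl

theorem pt_zero : S.pt 0 0 = S.n := by simp [pt]

/-- In the coordinates of `pt`, the last two reflections become affine maps depending on q alone, so
the orbit of n = `pt 0 0` can be computed for all polytopes at once. -/
theorem refl_two_pt (x y : ℝ) : refl (S.α 2) (S.pt x y) = S.pt (S.q * y - x) y := by
  have h2 := S.inner_α_self_pos 2
  have h : 2 * inner ℝ (S.α 2) (S.pt x y) / inner ℝ (S.α 2) (S.α 2) =
      -S.size * (2 * x - S.q * y) := by
    rw [div_eq_iff h2.ne', pt, inner_sub_right, inner_smul_right, inner_add_right,
      inner_smul_right, inner_smul_right, S.inner_α_n 2 (by decide), S.norm_α]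
    linear_combination (-S.size * y) * S.inner_α₂₃
  rw [refl_apply, h, pt, pt]
  module

theorem refl_three_pt (x y : ℝ) : refl (S.α 3) (S.pt x y) = S.pt x (1 - y + S.q * x) := by
  have h3 := S.inner_α_self_pos 3
  have h : 2 * inner ℝ (S.α 3) (S.pt x y) / inner ℝ (S.α 3) (S.α 3) =
      S.size * (1 - 2 * y + S.q * x) := by
    have hs : S.size * inner ℝ (S.α 3) (S.α 3) = 2 * inner ℝ (S.α 3) S.n :=
      div_mul_cancel₀ _ h3.ne'
    rw [div_eq_iff h3.ne', pt, inner_sub_right, inner_smul_right, inner_add_right,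
      inner_smul_right, inner_smul_right, real_inner_comm (S.α 2) (S.α 3)]
    linear_combination (-S.size * x) * S.inner_α₂₃ - hs
  rw [refl_apply, h, pt, pt]
  module

theorem inner_α_pt {i : Fin 4} (hi : i ≠ 3) (h2 : inner ℝ (S.α i) (S.α 2) = 0)
    (h3 : inner ℝ (S.α i) (S.α 3) = 0) (x y : ℝ) : inner ℝ (S.α i) (S.pt x y) = 0 := by
  rw [pt, inner_sub_right, inner_smul_right, inner_add_right, inner_smul_right, inner_smul_right,
    h2, h3, S.inner_α_n i hi]
  simp

theorem refl_zero_pt (x y : ℝ) : refl (S.α 0) (S.pt x y) = S.pt x y :=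
  refl_eq_self (S.inner_α_pt (by decide) S.inner_α₀₂ S.inner_α₀₃ x y)

theorem norm_sub_pt_sq (x y x' y' : ℝ) : ‖S.pt x y - S.pt x' y'‖ ^ 2 =
    S.size ^ 2 * inner ℝ (S.α 3) (S.α 3) *
      ((x - x') ^ 2 + (y - y') ^ 2 - S.q * (x - x') * (y - y')) := by
  have h : S.pt x y - S.pt x' y' = S.size • ((x' - x) • S.α 2 + (y' - y) • S.α 3) := by
    rw [pt, pt]; module
  rw [h, norm_smul, mul_pow, ← real_inner_self_eq_norm_sq (_ + _)]
  simp only [inner_add_left, inner_add_right, inner_smul_left, inner_smul_right, conj_trivial,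
    real_inner_comm (S.α 2) (S.α 3), S.norm_α, Real.norm_eq_abs, sq_abs]
  linear_combination (S.size ^ 2 * (x' - x) * (y' - y)) * S.inner_α₂₃

theorem gap_sq : S.gap ^ 2 = S.size ^ 2 * inner ℝ (S.α 3) (S.α 3) := by
  rw [gap, ← S.pt_zero, refl_three_pt, norm_sub_pt_sq]
  ring

theorem scale_pos : 0 < S.size ^ 2 * inner ℝ (S.α 3) (S.α 3) :=
  mul_pos (pow_pos S.size_pos 2) (S.inner_α_self_pos 3)

theorem eq_one_of_norm_sub_pt {x y x' y' : ℝ} (h : ‖S.pt x y - S.pt x' y'‖ = S.gap) :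
    (x - x') ^ 2 + (y - y') ^ 2 - S.q * (x - x') * (y - y') = 1 := by
  have h1 := S.norm_sub_pt_sq x y x' y'
  rw [h, S.gap_sq] at h1
  exact mul_left_cancel₀ S.scale_pos.ne' (h1.symm.trans (mul_one _).symm)

theorem eq_zero_of_pt_eq {x y x' y' : ℝ} (h : S.pt x y = S.pt x' y') :
    (x - x') ^ 2 + (y - y') ^ 2 - S.q * (x - x') * (y - y') = 0 := by
  have h1 := S.norm_sub_pt_sq x y x' y'
  rw [h, sub_self, norm_zero, zero_pow two_ne_zero] at h1
  exact (mul_eq_zero.1 h1.symm).resolve_left S.scale_pos.ne'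

theorem gap_pos : 0 < S.gap := by
  have h := S.scale_pos
  rw [← S.gap_sq] at h
  exact (norm_nonneg _).lt_of_ne' fun h0 => by
    rw [gap, h0] at h
    simp at h

theorem n_ne_refl : S.n ≠ refl (S.α 3) S.n := fun h => by
  have := S.gap_pos
  rw [gap, ← h, sub_self, norm_zero] at this
  exact this.false

theorem refl_mem_N (i : Fin 4) {m : E4} (hm : m ∈ S.N) : refl (S.α i) m ∈ S.N :=
  S.map_mem_N (S.isSymm_refl i) hm

theorem inner_refl_b {i j : Fin 4} (hij : i ≠ j) (m : E4) :
    inner ℝ (refl (S.α i) m) (S.b j) = inner ℝ m (S.b j) := by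
  rw [inner_refl_left, refl_eq_self (S.inner_ne i j hij)]

/-- The ray through x meets the interior of the facet: the first three reflections fix n, so
`mem_of_stable` applies to {n}. -/
theorem act_of_coord_three_pos {x : E4} (hx : ∀ i, 0 ≤ S.coord i x) (h3 : 0 < S.coord 3 x) :
    act S.N x = {S.n} := by
  ext m
  rw [S.mem_act_iff hx]
  constructor
  · rintro ⟨hm, h⟩
    refine S.mem_of_stable 3 (Set.mem_singleton _) ?_ hm (h 3 h3)
    rintro j hj _ rfl
    exact refl_eq_self (S.inner_α_n j hj)
  · rintro rfl
    exact ⟨S.n_mem, fun i _ => S.inner_n_b i⟩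

/-- The ray meets the interior of the 2-face: reflections 0 and 1 fix both normals and reflection 3
exchanges them. -/
theorem act_of_coord_two_pos {x : E4} (hx : ∀ i, 0 ≤ S.coord i x) (h3 : S.coord 3 x = 0)
    (h2 : 0 < S.coord 2 x) : act S.N x = {S.n, refl (S.α 3) S.n} := by
  ext m
  rw [S.mem_act_iff hx]
  constructor
  · rintro ⟨hm, h⟩
    refine S.mem_of_stable 2 (Or.inl rfl) ?_ hm (h 2 h2)
    have hfix : ∀ j : Fin 4, j ≠ 2 → j ≠ 3 → refl (S.α j) (refl (S.α 3) S.n) =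
        refl (S.α 3) S.n := by
      intro j hj hj3
      refine refl_eq_self ?_
      rw [refl_apply, inner_sub_right, inner_smul_right, S.inner_α_n j hj3]
      have : inner ℝ (S.α j) (S.α 3) = (0 : ℝ) := by
        fin_cases j
        · exact S.inner_α₀₃
        · exact S.inner_α₁₃
        · exact absurd rfl hj
        · exact absurd rfl hj3
      rw [this]; simp
    rintro j hj _ (rfl | rfl)
    · by_cases hj3 : j = 3
      · rw [hj3]; exact Or.inr rfl
      · rw [refl_eq_self (S.inner_α_n j hj3)]; exact Or.inl rfl
    · by_cases hj3 : j = 3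
      · rw [hj3, refl_refl]; exact Or.inl rfl
      · rw [hfix j hj hj3]; exact Or.inr rfl
  · rintro (rfl | rfl)
    · exact ⟨S.n_mem, fun i _ => S.inner_n_b i⟩
    · refine ⟨S.refl_mem_N 3 S.n_mem, fun i hi => ?_⟩
      have hi3 : 3 ≠ i := by
        rintro rfl
        exact hi.ne' h3
      rw [S.inner_refl_b hi3, S.inner_n_b]

theorem pt_zero_one : S.pt 0 1 = refl (S.α 3) S.n := by
  rw [← S.pt_zero, refl_three_pt]; simp

theorem pt_q_one : S.pt S.q 1 = refl (S.α 2) (refl (S.α 3) S.n) := by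
  rw [← S.pt_zero_one, refl_two_pt]; simp

/-- Reflections 2 and 3 preserve the pairing with `b 0` and `b 1`, so three vertices of the polygon
around the edge are active; the distance form separates them as q > 0. -/
theorem not_fewActive {x : E4} (hx : ∀ i, 0 ≤ S.coord i x) (h3 : S.coord 3 x = 0)
    (h2 : S.coord 2 x = 0) : ¬ FewActive S.N x := by
  rintro ⟨a, b, hab⟩
  have hi : ∀ i, 0 < S.coord i x → 2 ≠ i ∧ 3 ≠ i := by
    refine fun i hi => ⟨?_, ?_⟩
    · rintro rfl; exact hi.ne' h2
    · rintro rfl; exact hi.ne' h3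
  have m0 : S.pt 0 0 ∈ act S.N x := by
    rw [pt_zero, S.mem_act_iff hx]
    exact ⟨S.n_mem, fun i _ => S.inner_n_b i⟩
  have m1 : S.pt 0 1 ∈ act S.N x := by
    rw [pt_zero_one, S.mem_act_iff hx]
    exact ⟨S.refl_mem_N 3 S.n_mem, fun i h => by rw [S.inner_refl_b (hi i h).2, S.inner_n_b]⟩
  have m2 : S.pt S.q 1 ∈ act S.N x := by
    rw [pt_q_one, S.mem_act_iff hx]
    exact ⟨S.refl_mem_N 2 (S.refl_mem_N 3 S.n_mem), fun i h => by
      rw [S.inner_refl_b (hi i h).1, S.inner_refl_b (hi i h).2, S.inner_n_b]⟩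
  have hq := S.q_pos
  have d01 : S.pt 0 0 ≠ S.pt 0 1 := fun h => by
    have := S.eq_zero_of_pt_eq h; norm_num at this
  have d02 : S.pt 0 0 ≠ S.pt S.q 1 := fun h => by
    have := S.eq_zero_of_pt_eq h; ring_nf at this; norm_num at this
  have d12 : S.pt 0 1 ≠ S.pt S.q 1 := fun h => by
    have := S.eq_zero_of_pt_eq h; ring_nf at this; exact (pow_pos hq 2).ne' this
  rcases hab m0 with h0 | h0 <;> rcases hab m1 with h1 | h1 <;> rcases hab m2 with h2 | h2 <;>
    first
    | exact d01 (h0.trans h1.symm)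
    | exact d02 (h0.trans h2.symm)
    | exact d12 (h1.trans h2.symm)

/-- The facet normals around the edge of the flag form a polygon with `r` vertices. -/
structure IsPolygon (r : ℕ) [NeZero r] (p : Fin r → E4) : Prop where
  injective : Function.Injective p
  range_eq : Set.range p = {m ∈ S.N | inner ℝ m (S.b 1) = 1}
  adjacent : ∀ j, ∃ g, IsSymm V g ∧ g S.n = p j ∧ g (refl (S.α 3) S.n) = p (j + 1)
  eq_of_dist : ∀ j k, ‖p j - p k‖ = S.gap → k = j + 1 ∨ j = k + 1

/-- The product of the reflections j ↦ -j and j ↦ 1 - j is the rotation j ↦ j + 1, which carries n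
and its neighbour around the polygon. No normal at `b 1` is missed, since the polygon is stable
under reflections 0, 2 and 3. -/
theorem isPolygon_of {r : ℕ} [NeZero r] {p : Fin r → E4} (hinj : Function.Injective p)
    (h0 : p 0 = S.n)
    (hfix : ∀ j, refl (S.α 0) (p j) = p j)
    (h2 : ∀ j, refl (S.α 2) (p j) = p (-j))
    (h3 : ∀ j, refl (S.α 3) (p j) = p (1 - j))
    (hdist : ∀ j k, ‖p j - p k‖ = S.gap → k = j + 1 ∨ j = k + 1) : S.IsPolygon r p := by
  have hrot : ∀ j, refl (S.α 3) (refl (S.α 2) (p j)) = p (j + 1) := fun j => by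
    rw [h2, h3, sub_neg_eq_add, add_comm]
  let R : E4 ≃ₗᵢ[ℝ] E4 := refl (S.α 3) * refl (S.α 2)
  have hR : IsSymm V R := (S.isSymm_refl 3).mul (S.isSymm_refl 2)
  have hpow : ∀ k (hk : k < r), (R ^ k) S.n = p ⟨k, hk⟩ := by
    intro k
    induction k with
    | zero => intro _; rw [← h0]; rfl
    | succ k ih =>
      intro hk
      rw [pow_succ']
      change R ((R ^ k) S.n) = _
      rw [ih (Nat.lt_of_succ_lt hk)]
      refine (hrot _).trans (congrArg p (Fin.ext ?_))
      rw [Fin.val_add, Fin.val_one', Nat.add_mod_mod, Nat.mod_eq_of_lt hk]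
  have hadj : ∀ j, ∃ g, IsSymm V g ∧ g S.n = p j ∧ g (refl (S.α 3) S.n) = p (j + 1) := by
    intro j
    refine ⟨R ^ (j : ℕ), hR.pow _, hpow j j.2, ?_⟩
    have h4 : refl (S.α 3) S.n = R S.n := by
      change _ = refl (S.α 3) (refl (S.α 2) S.n)
      rw [refl_eq_self (S.inner_α_n 2 (by decide))]
    have h5 : (R ^ (j : ℕ)) (R S.n) = R ((R ^ (j : ℕ)) S.n) :=
      congrArg (fun g : E4 ≃ₗᵢ[ℝ] E4 => g S.n) ((pow_succ R j).symm.trans (pow_succ' R j))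
    rw [h4, h5, hpow j j.2]
    exact hrot j
  refine ⟨hinj, ?_, hadj, hdist⟩
  ext m
  constructor
  · rintro ⟨j, rfl⟩
    rw [← hpow j j.2]
    refine ⟨S.map_mem_N (hR.pow _) S.n_mem, ?_⟩
    have : ∀ k : ℕ, inner ℝ ((R ^ k) S.n) (S.b 1) = (1 : ℝ) := by
      intro k
      induction k with
      | zero => exact S.inner_n_b 1
      | succ k ih =>
        rw [pow_succ']
        change inner ℝ (refl (S.α 3) (refl (S.α 2) ((R ^ k) S.n))) (S.b 1) = (1 : ℝ)
        rw [S.inner_refl_b (by decide), S.inner_refl_b (by decide), ih]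
    exact this _
  · rintro ⟨hm, hmb⟩
    refine S.mem_of_stable 1 (O := Set.range p) ⟨0, h0⟩ ?_ hm hmb
    rintro j hj _ ⟨k, rfl⟩
    fin_cases j
    · exact ⟨k, (hfix k).symm⟩
    · exact absurd rfl hj
    · exact ⟨-k, (h2 k).symm⟩
    · exact ⟨1 - k, (h3 k).symm⟩

theorem exists_isPolygon : (∃ p : Fin 3 → E4, S.IsPolygon 3 p) ∨ ∃ p : Fin 5 → E4, S.IsPolygon 5 p := by
  rcases S.q_eq with hq | hq
  · left
    refine ⟨![S.pt 0 0, S.pt 0 1, S.pt 1 1], S.isPolygon_of ?_ S.pt_zero ?_ ?_ ?_ ?_⟩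
    · intro j k h
      fin_cases j <;> fin_cases k <;> first | rfl | (
        exfalso
        have := S.eq_zero_of_pt_eq h
        rw [hq] at this
        norm_num at this)
    · intro j
      fin_cases j <;> exact S.refl_zero_pt _ _
    · intro j
      fin_cases j <;> refine (S.refl_two_pt _ _).trans ?_ <;> rw [hq] <;> norm_num <;> rfl
    · intro j
      fin_cases j <;> refine (S.refl_three_pt _ _).trans ?_ <;> rw [hq] <;> norm_num <;> rfl
    · intro j k h
      have hjk : j ≠ k := by
        rintro rfl
        rw [sub_self, norm_zero] at h
        exact S.gap_pos.ne h
      -- Any two distinct vertices of a triangle are consecutive.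
      revert hjk
      clear h
      revert j k
      decide
  · right
    set φ := Real.goldenRatio with hφ
    have hφ2 : φ ^ 2 = φ + 1 := Real.goldenRatio_sq
    have hφ1 : 1 < φ := Real.one_lt_goldenRatio
    have hφ3 : φ ^ 3 = 2 * φ + 1 := by linear_combination (φ + 1) * hφ2
    have hφ4 : φ ^ 4 = 3 * φ + 2 := by linear_combination φ * hφ3 + 2 * hφ2
    have hφ5 : φ ^ 5 = 5 * φ + 3 := by linear_combination φ * hφ4 + 3 * hφ2
    have hpt : ∀ {x y x' y' : ℝ}, x = x' → y = y' → S.pt x y = S.pt x' y' := by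
      rintro x y _ _ rfl rfl; rfl
    -- The orbit of n under the rotation, which closes up after five steps. Rewriting powers of φ
    -- linearly makes every required identity and inequality linear.
    refine ⟨![S.pt 0 0, S.pt 0 1, S.pt φ (φ ^ 2), S.pt (φ ^ 2) (φ ^ 2), S.pt φ 1],
      S.isPolygon_of ?_ S.pt_zero ?_ ?_ ?_ ?_⟩
    · intro j k h
      fin_cases j <;> fin_cases k <;> first | rfl | (
        exfalso
        have := S.eq_zero_of_pt_eq h
        rw [hq] at this
        linarith)
    · intro j
      fin_cases j <;> exact S.refl_zero_pt _ _
    · intro j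
      fin_cases j <;> refine (S.refl_two_pt _ _).trans (hpt ?_ ?_) <;> first | rfl | (
        rw [hq]; linarith)
    · intro j
      fin_cases j <;> refine (S.refl_three_pt _ _).trans (hpt ?_ ?_) <;> first | rfl | (
        rw [hq]; linarith)
    · intro j k h
      fin_cases j <;> fin_cases k <;> first | exact Or.inl rfl | exact Or.inr rfl | (
        exfalso
        have := S.eq_one_of_norm_sub_pt h
        rw [hq] at this
        linarith)

end Flag

theorem FewActive.smul {N : Set E4} {c : ℝ} (hc : 0 < c) {x : E4} (h : FewActive N x) :
    FewActive N (c • x) := by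
  obtain ⟨a, b, hab⟩ := h
  exact ⟨a, b, by rwa [act_smul N hc]⟩

/-! ### The 1-skeleton in terms of facet normals -/

namespace Flag

variable {V : Set E4} (S : Flag V)

theorem norm_le_of_mem_convexHull {x : E4} (hx : x ∈ convexHull ℝ V) : ‖x‖ ≤ ‖S.b 0‖ := by
  have h : V ⊆ Metric.closedBall 0 ‖S.b 0‖ := fun v hv => by
    rw [mem_closedBall_zero_iff, S.norm_eq v hv]
  exact mem_closedBall_zero_iff.1 (convexHull_min h (convex_closedBall _ _) hx)

theorem coord_b (i j : Fin 4) : S.coord i (S.b j) = if i = j then 1 else 0 := by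
  split_ifs with h
  · subst h
    exact div_self (S.inner_pos i).ne'
  · rw [coord, S.inner_ne i j h, zero_div]

theorem b_ne_zero (i : Fin 4) : S.b i ≠ 0 := fun h => by
  have := S.inner_pos i
  rw [h, inner_zero_right] at this
  exact this.false

theorem b_zero_ne_refl : S.b 0 ≠ refl (S.α 0) (S.b 0) := fun h => by
  have h1 := S.inner_n_b 1
  have h2 := S.b_one
  rw [← h, ← two_smul ℝ, smul_smul] at h2
  norm_num at h2
  have h3 := S.inner_ne 0 1 (by decide)
  rw [h2] at h3
  exact (S.inner_pos 0).ne' h3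

theorem inner_b_one_lt : inner ℝ (S.b 0) (S.b 1) < ‖S.b 0‖ ^ 2 := by
  have h1 : inner ℝ (S.b 0) (refl (S.α 0) (S.b 0)) < ‖S.b 0‖ * ‖refl (S.α 0) (S.b 0)‖ := by
    refine (real_inner_le_norm _ _).lt_of_ne fun h => S.b_zero_ne_refl ?_
    rw [inner_eq_norm_mul_iff_real, LinearIsometryEquiv.norm_map] at h
    exact smul_right_injective E4 (norm_ne_zero_iff.2 (S.b_ne_zero 0)) h.symm |>.symm
  rw [LinearIsometryEquiv.norm_map] at h1
  rw [S.b_one, inner_smul_right, inner_add_right, real_inner_self_eq_norm_sq]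
  linarith

/-- The edge of the flag is a face of the polytope. -/
theorem isSegmentFace : IsSegmentFace (convexHull ℝ V) (S.b 0) (refl (S.α 0) (S.b 0)) := by
  intro _
  have hm : ∀ m ∈ ({S.pt 0 0, S.pt 0 1, S.pt S.q 1} : Set E4), m ∈ S.N ∧ inner ℝ m (S.b 0) = 1 ∧
      refl (S.α 0) m = m := by
    rintro _ (rfl | rfl | rfl)
    · rw [S.refl_zero_pt, S.pt_zero]
      exact ⟨S.n_mem, S.inner_n_b 0, rfl⟩
    · rw [S.refl_zero_pt, S.pt_zero_one, S.inner_refl_b (by decide)]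
      exact ⟨S.refl_mem_N 3 S.n_mem, S.inner_n_b 0, rfl⟩
    · rw [S.refl_zero_pt, S.pt_q_one, S.inner_refl_b (by decide), S.inner_refl_b (by decide)]
      exact ⟨S.refl_mem_N 2 (S.refl_mem_N 3 S.n_mem), S.inner_n_b 0, rfl⟩
  have hm' : ∀ m ∈ ({S.pt 0 0, S.pt 0 1, S.pt S.q 1} : Set E4),
      inner ℝ m (refl (S.α 0) (S.b 0)) = 1 := fun m h => by
    rw [← inner_refl_left, (hm m h).2.2, (hm m h).2.1]
  have e0 : S.pt 0 0 ∈ ({S.pt 0 0, S.pt 0 1, S.pt S.q 1} : Set E4) := by simp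
  have e1 : S.pt 0 1 ∈ ({S.pt 0 0, S.pt 0 1, S.pt S.q 1} : Set E4) := by simp
  have e2 : S.pt S.q 1 ∈ ({S.pt 0 0, S.pt 0 1, S.pt S.q 1} : Set E4) := by simp
  -- A sum of three facet normals at the edge: its maximum 3 is attained exactly where all three
  -- equal 1.
  let l : E4 →L[ℝ] ℝ := innerSL ℝ (S.pt 0 0 + S.pt 0 1 + S.pt S.q 1)
  have hl : ∀ x, l x = inner ℝ (S.pt 0 0) x + inner ℝ (S.pt 0 1) x + inner ℝ (S.pt S.q 1) x :=
    fun x => by simp [l]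
  have hle : ∀ x ∈ convexHull ℝ V, l x ≤ 3 := fun x hx => by
    rw [hl]
    linarith [S.inner_le_one (hm _ e0).1 hx, S.inner_le_one (hm _ e1).1 hx,
      S.inner_le_one (hm _ e2).1 hx]
  have hl0 : l (S.b 0) = 3 := by
    rw [hl, (hm _ e0).2.1, (hm _ e1).2.1, (hm _ e2).2.1]; norm_num
  refine ⟨l, Set.Subset.antisymm ?_ ?_⟩
  · intro x hx
    refine ⟨(convex_convexHull ℝ V).segment_subset (S.b_mem 0)
      (subset_convexHull ℝ V (S.refl_mem 0 _ S.b_zero_mem)) hx, fun y hy => ?_⟩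
    obtain ⟨s, t, -, -, hst, rfl⟩ := hx
    have : l (s • S.b 0 + t • refl (S.α 0) (S.b 0)) = 3 := by
      rw [map_add, map_smul, map_smul, hl0, hl, hm' _ e0, hm' _ e1, hm' _ e2, smul_eq_mul,
        smul_eq_mul]
      linear_combination 3 * hst
    rw [this]
    exact hle y hy
  · rintro x ⟨hx, hmax⟩
    have h3 := hmax _ (S.b_mem 0)
    rw [hl0, hl] at h3
    have i0 := S.inner_le_one (hm _ e0).1 hx
    have i1 := S.inner_le_one (hm _ e1).1 hx
    have i2 := S.inner_le_one (hm _ e2).1 hx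
    have j0 : inner ℝ (S.pt 0 0) x = 1 := by linarith
    have j1 : inner ℝ (S.pt 0 1) x = 1 := by linarith
    have j2 : inner ℝ (S.pt S.q 1) x = 1 := by linarith
    have hs := S.size_pos
    have k0 := j0
    rw [inner_pt_left] at k0
    have k1 := j1
    rw [inner_pt_left] at k1
    have k2 := j2
    rw [inner_pt_left] at k2
    have hα3 : inner ℝ (S.α 3) x = 0 := by
      have : S.size * inner ℝ (S.α 3) x = 0 := by linarith
      exact (mul_eq_zero.1 this).resolve_left hs.ne'
    have hα2 : inner ℝ (S.α 2) x = 0 := by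
      rw [hα3] at k2
      have : (S.size * S.q) * inner ℝ (S.α 2) x = 0 := by linarith
      exact (mul_eq_zero.1 this).resolve_left (mul_pos hs S.q_pos).ne'
    -- Reflection 0 exchanges the halves of the edge, so the half containing `b 0` suffices.
    have half : ∀ x ∈ convexHull ℝ V, inner ℝ (S.α 2) x = 0 → inner ℝ (S.α 3) x = 0 →
        inner ℝ S.n x = 1 → 0 ≤ inner ℝ (S.α 0) x →
        x ∈ segment ℝ (S.b 0) (refl (S.α 0) (S.b 0)) := by
      intro x hx h2 h3 hn h0
      have hx2 := S.sum_coord x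
      simp only [Fin.sum_univ_four] at hx2
      rw [show S.coord 2 x = 0 by rw [coord, h2, zero_div],
        show S.coord 3 x = 0 by rw [coord, h3, zero_div], zero_smul, zero_smul, add_zero,
        add_zero] at hx2
      have ht : S.coord 0 x + S.coord 1 x = 1 := by
        rw [← hn]
        conv_rhs => rw [← hx2, inner_add_right, inner_smul_right, inner_smul_right]
        rw [S.inner_n_b, S.inner_n_b, mul_one, mul_one]
      have ht0 : 0 ≤ S.coord 0 x := div_nonneg h0 (S.inner_pos 0).le
      -- The polytope lies in the ball of radius ‖b 0‖, so the edge line cannot be followed beyond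
      -- the vertex `b 0`.
      have ht1 : 0 ≤ S.coord 1 x := by
        have h4 : inner ℝ (S.b 0) x ≤ ‖S.b 0‖ ^ 2 := by
          refine (real_inner_le_norm _ _).trans ?_
          rw [sq]
          exact mul_le_mul_of_nonneg_left (S.norm_le_of_mem_convexHull hx) (norm_nonneg _)
        rw [← hx2, inner_add_right, inner_smul_right, inner_smul_right,
          real_inner_self_eq_norm_sq] at h4
        have h5 := S.inner_b_one_lt
        have h6 : S.coord 0 x = 1 - S.coord 1 x := by linarith
        rw [h6] at h4
        by_contra hneg
        push Not at hneg
        nlinarith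
      rw [S.b_one] at hx2
      refine ⟨S.coord 0 x + S.coord 1 x / 2, S.coord 1 x / 2, by linarith, by linarith, by linarith,
        ?_⟩
      conv_rhs => rw [← hx2]
      module
    rcases le_total 0 (inner ℝ (S.α 0) x) with h0 | h0
    · exact half x hx hα2 hα3 (by rw [← S.pt_zero]; exact j0) h0
    · have h4 := half (refl (S.α 0) x) ?_ ?_ ?_ ?_ ?_
      · have h5 : refl (S.α 0) '' segment ℝ (S.b 0) (refl (S.α 0) (S.b 0)) =
            segment ℝ (refl (S.α 0) (S.b 0)) (refl (S.α 0) (refl (S.α 0) (S.b 0))) :=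
          image_segment ℝ (refl (S.α 0)).toLinearEquiv.toLinearMap.toAffineMap _ _
        rw [refl_refl] at h5
        rw [segment_symm, ← h5]
        exact ⟨_, h4, refl_refl _ _⟩
      · have h5 := (refl (S.α 0)).toLinearEquiv.toLinearMap.image_convexHull V
        have h6 : (refl (S.α 0)).toLinearEquiv.toLinearMap '' V = V := S.isSymm_refl 0
        rw [h6] at h5
        rw [← h5]
        exact Set.mem_image_of_mem _ hx
      · rw [← inner_refl_left, refl_eq_self S.inner_α₀₂, hα2]
      · rw [← inner_refl_left, refl_eq_self S.inner_α₀₃, hα3]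
      · rw [← inner_refl_left, refl_eq_self (S.inner_α_n 0 (by decide)), ← S.pt_zero]
        exact j0
      · rw [← inner_refl_left, refl, Submodule.reflection_orthogonalComplement_singleton_eq_neg,
          inner_neg_left]
        linarith

/-- The orthogonal complement of two normals has dimension at least two. In all its directions y can
move a little both ways inside the polytope, so an exposed face through y contains these directions
and is not a segment. -/
theorem not_mem_segment_of_fewActive {y u v : E4} (hy : FewActive S.N y)
    (huv : IsSegmentFace (convexHull ℝ V) u v) (hmem : y ∈ segment ℝ u v) : False := by
  obtain ⟨a, b, hab⟩ := hy
  obtain ⟨l, hl⟩ := huv ⟨u, left_mem_segment ℝ u v⟩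
  have hyP : y ∈ convexHull ℝ V := (hl ▸ hmem).1
  have hymax : ∀ z ∈ convexHull ℝ V, l z ≤ l y := (hl ▸ hmem).2
  set D : Submodule ℝ E4 := (Submodule.span ℝ {a, b})ᗮ with hD
  have hDle : D ≤ Submodule.span ℝ {v - u} := by
    intro d hd
    have hda : inner ℝ a d = 0 := hd a (Submodule.subset_span (by simp))
    have hdb : inner ℝ b d = 0 := hd b (Submodule.subset_span (by simp))
    have hev : ∀ᶠ t : ℝ in 𝓝 0, y + t • d ∈ convexHull ℝ V := by
      simp only [S.mem_convexHull_iff]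
      rw [Filter.eventually_all_finite S.N_finite]
      intro m hm
      by_cases hmy : m ∈ act S.N y
      · have hmd : inner ℝ m d = 0 := by
          rcases hab hmy with rfl | rfl
          · exact hda
          · exact hdb
        refine Eventually.of_forall fun t => ?_
        rw [inner_add_right, inner_smul_right, hmd, mul_zero, add_zero]
        exact S.inner_le_one hm hyP
      · have hlt : inner ℝ m y < 1 := by
          by_contra hge
          push Not at hge
          exact hmy ⟨hm, fun m' hm' => (S.inner_le_one hm' hyP).trans hge⟩
        have hc : ContinuousAt (fun t : ℝ => inner ℝ m (y + t • d)) 0 := by fun_prop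
        have := hc.eventually_lt (continuousAt_const (y := (1 : ℝ))) (by simpa using hlt)
        exact this.mono fun t ht => ht.le
    obtain ⟨t, ht, htpos⟩ : ∃ t : ℝ, (y + t • d ∈ convexHull ℝ V ∧ y + (-t) • d ∈ convexHull ℝ V) ∧
        0 < t := by
      have hneg : ∀ᶠ t : ℝ in 𝓝 0, y + (-t) • d ∈ convexHull ℝ V := by
        have : Tendsto (fun t : ℝ => -t) (𝓝 0) (𝓝 0) := by
          simpa using (continuous_neg (G := ℝ)).tendsto 0
        exact this.eventually hev
      have := ((hev.and hneg).filter_mono nhdsWithin_le_nhds).and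
        (self_mem_nhdsWithin : Set.Ioi (0 : ℝ) ∈ 𝓝[>] 0)
      exact this.exists
    have h1 := hymax _ ht.1
    have h2 := hymax _ ht.2
    rw [map_add, map_smul, smul_eq_mul] at h1 h2
    have hmem' : y + t • d ∈ segment ℝ u v := by
      rw [hl]
      refine ⟨ht.1, fun z hz => (hymax z hz).trans ?_⟩
      rw [map_add, map_smul, smul_eq_mul]
      linarith
    rw [segment_eq_image'] at hmem hmem'
    obtain ⟨r, -, hr⟩ := hmem
    obtain ⟨s, -, hs⟩ := hmem'
    rw [Submodule.mem_span_singleton]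
    refine ⟨t⁻¹ * (s - r), ?_⟩
    have : t • d = (s - r) • (v - u) := by
      have h5 : t • d = (y + t • d) - y := by abel
      rw [h5, ← hs, ← hr]
      module
    rw [mul_smul, ← this, smul_smul, inv_mul_cancel₀ htpos.ne', one_smul]
  have h1 := Submodule.finrank_mono hDle
  have h2 : Module.finrank ℝ (Submodule.span ℝ {v - u}) ≤ 1 := by
    have := finrank_span_finset_le_card (R := ℝ) ({v - u} : Finset E4)
    rwa [Finset.coe_singleton, Finset.card_singleton] at this
  have h3 := (Submodule.span ℝ {a, b}).finrank_add_finrank_orthogonal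
  have h4 : Module.finrank ℝ (Submodule.span ℝ {a, b}) ≤ 2 := by
    have := finrank_span_finset_le_card (R := ℝ) ({a, b} : Finset E4)
    rw [Finset.coe_pair] at this
    exact this.trans Finset.card_le_two
  have h5 : Module.finrank ℝ E4 = 4 := by simp
  rw [h5, ← hD] at h3
  omega

/-- In a chamber containing x, more than two active normals force the last two coordinates to
vanish. Then x lies on the cone over the edge of that flag, a face by `isSegmentFace`. -/
theorem mem_radialGraph_iff {x : E4} (hx : ‖x‖ = 1) :
    x ∈ radialGraph (convexHull ℝ V) ↔ ¬ FewActive S.N x := by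
  constructor
  · rintro ⟨y, ⟨⟨u, v, huv, hy⟩, hy0⟩, rfl⟩ hfew
    have hy0' : 0 < ‖y‖ := norm_pos_iff.2 hy0
    have := hfew.smul hy0'
    rw [smul_smul, mul_inv_cancel₀ hy0'.ne', one_smul] at this
    exact S.not_mem_segment_of_fewActive this huv hy
  · intro hnot
    obtain ⟨S', hN, -, hS'⟩ := S.exists_flag_chamber x
    rw [← hN] at hnot
    have h3 : S'.coord 3 x = 0 := by
      by_contra h
      exact hnot ⟨_, _, (S'.act_of_coord_three_pos hS' ((hS' 3).lt_of_ne' h)).trans_subset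
        (Set.singleton_subset_iff.2 (Set.mem_insert _ {S'.n}))⟩
    have h2 : S'.coord 2 x = 0 := by
      by_contra h
      exact hnot ⟨_, _, (S'.act_of_coord_two_pos hS' h3 ((hS' 2).lt_of_ne' h)).subset⟩
    have hx2 := S'.sum_coord x
    simp only [Fin.sum_univ_four] at hx2
    rw [h2, h3, zero_smul, zero_smul, add_zero, add_zero] at hx2
    set t := S'.coord 0 x + S'.coord 1 x with ht
    have htpos : 0 < t := by
      refine (add_nonneg (hS' 0) (hS' 1)).lt_of_ne' fun h => ?_
      have h0 : S'.coord 0 x = 0 := by linarith [hS' 0, hS' 1]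
      have h1 : S'.coord 1 x = 0 := by linarith [hS' 0, hS' 1]
      rw [h0, h1, zero_smul, zero_smul, add_zero] at hx2
      rw [← hx2, norm_zero] at hx
      exact zero_ne_one hx
    have hx0 : x ≠ 0 := by
      rintro rfl
      rw [norm_zero] at hx
      exact zero_ne_one hx
    refine ⟨t⁻¹ • x, ⟨⟨_, _, S'.isSegmentFace, ?_⟩, ?_⟩, ?_⟩
    · refine ⟨t⁻¹ * (S'.coord 0 x + S'.coord 1 x / 2), t⁻¹ * (S'.coord 1 x / 2), ?_, ?_, ?_, ?_⟩
      · have := hS' 0; have := hS' 1; positivity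
      · have := hS' 1; positivity
      · rw [← mul_add, show S'.coord 0 x + S'.coord 1 x / 2 + S'.coord 1 x / 2 = t by ring,
          inv_mul_cancel₀ htpos.ne']
      · conv_rhs => rw [← hx2, S'.b_one]
        module
    · exact smul_ne_zero (inv_ne_zero htpos.ne') hx0
    · simp only [norm_smul, hx, mul_one, norm_inv, Real.norm_eq_abs, abs_of_pos htpos, inv_inv,
        smul_smul, mul_inv_cancel₀ htpos.ne', one_smul]

theorem mem_graphCompl_iff {x : E4} :
    x ∈ graphCompl (convexHull ℝ V) ↔ ‖x‖ = 1 ∧ FewActive S.N x := by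
  rw [graphCompl, Set.mem_sdiff, mem_sphere_zero_iff_norm]
  refine and_congr_right fun h => ?_
  rw [S.mem_radialGraph_iff h, not_not]

end Flag

theorem exists_three_of_not_fewActive {N : Set E4} {x : E4} (hne : (act N x).Nonempty)
    (h : ¬ FewActive N x) : ∃ a ∈ act N x, ∃ b ∈ act N x, ∃ c ∈ act N x, b ≠ a ∧ c ≠ a ∧ c ≠ b := by
  simp only [FewActive, not_exists, Set.not_subset] at h
  obtain ⟨a, ha⟩ := hne
  obtain ⟨b, hb, hb'⟩ := h a a
  obtain ⟨c, hc, hc'⟩ := h a b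
  simp only [Set.mem_insert_iff, Set.mem_singleton_iff, not_or] at hb' hc'
  exact ⟨a, ha, b, hb, c, hc, hb'.1, hc'.1, hc'.2⟩

/-! ### Small linking circles around an edge -/

namespace Flag

variable {V : Set E4} (S : Flag V)

theorem act_b_one : act S.N (S.b 1) = {m ∈ S.N | inner ℝ m (S.b 1) = 1} := by
  ext m
  rw [S.mem_act_iff fun i => by rw [coord_b]; split_ifs <;> norm_num]
  refine and_congr_right fun _ => ⟨fun h => h 1 (by rw [coord_b]; norm_num), fun h i hi => ?_⟩
  rw [coord_b] at hi
  split_ifs at hi with h1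
  · rw [h1, h]
  · exact absurd hi (lt_irrefl _)

theorem not_fewActive_b_one : ¬ FewActive S.N (S.b 1) :=
  S.not_fewActive (fun i => by rw [coord_b]; split_ifs <;> norm_num)
    (by rw [coord_b, if_neg (by decide)]) (by rw [coord_b, if_neg (by decide)])

/-- A facet through the midpoint of an edge contains both ends, as m is at most 1 on each. -/
theorem inner_b_zero_of_inner_b_one {m : E4} (hm : m ∈ S.N) (h : inner ℝ m (S.b 1) = 1) :
    inner ℝ m (S.b 0) = 1 := by
  rw [S.b_one, inner_smul_right, inner_add_right] at h
  have h1 := S.inner_le_one hm (S.b_mem 0)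
  have h2 := S.inner_le_one hm (subset_convexHull ℝ V (S.refl_mem 0 _ S.b_zero_mem))
  linarith

/-- The linear parametrization of the plane orthogonal to the edge of the flag. -/
noncomputable def plane : EuclideanSpace ℝ (Fin 2) →L[ℝ] E4 :=
  (EuclideanSpace.proj 0).smulRight (S.α 2) + (EuclideanSpace.proj 1).smulRight (S.α 3)

theorem plane_apply (w : EuclideanSpace ℝ (Fin 2)) : S.plane w = w 0 • S.α 2 + w 1 • S.α 3 := rfl

theorem inner_b_plane {i : Fin 4} (h2 : i ≠ 2) (h3 : i ≠ 3) (w : EuclideanSpace ℝ (Fin 2)) :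
    inner ℝ (S.b i) (S.plane w) = 0 := by
  rw [plane_apply, inner_add_right, inner_smul_right, inner_smul_right, real_inner_comm,
    real_inner_comm (S.α 3), S.inner_ne 2 i h2.symm, S.inner_ne 3 i h3.symm]
  simp

theorem plane_injective : Function.Injective S.plane := by
  rw [injective_iff_map_eq_zero]
  intro w hw
  have h : ∀ i, inner ℝ (S.plane w) (S.b i) = 0 := fun i => by rw [hw, inner_zero_left]
  have h2 := h 2
  have h3 := h 3
  rw [plane_apply, inner_add_left, inner_smul_left, inner_smul_left] at h2 h3
  rw [S.inner_ne 3 2 (by decide), mul_zero, add_zero] at h2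
  rw [S.inner_ne 2 3 (by decide), mul_zero, zero_add] at h3
  ext i
  fin_cases i
  · exact (mul_eq_zero.1 h2).resolve_right (S.inner_pos 2).ne'
  · exact (mul_eq_zero.1 h3).resolve_right (S.inner_pos 3).ne'

/-- Normals active at both points agree on `b 0`, `b 1` and the displacement, which are independent,
so they lie on one affine line. They also have equal norms, and a line meets a sphere in at most two
points. -/
theorem fewActive_add_plane {w : EuclideanSpace ℝ (Fin 2)} (hw : w ≠ 0)
    (hsub : act S.N (S.b 1 + S.plane w) ⊆ act S.N (S.b 1)) :
    FewActive S.N (S.b 1 + S.plane w) := by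
  by_contra hnot
  obtain ⟨a, ha, b, hb, c, hc, hba, hca, hcb⟩ := exists_three_of_not_fewActive
    (act_nonempty S.N_finite ⟨_, S.n_mem⟩ _) hnot
  set z := S.plane w with hz
  have hz0 : z ≠ 0 := fun h => hw (S.plane_injective (h.trans (map_zero _).symm))
  have hperp : ∀ m ∈ act S.N (S.b 1 + z), inner ℝ (S.b 0) (a - m) = 0 ∧
      inner ℝ (S.b 1) (a - m) = 0 ∧ inner ℝ z (a - m) = 0 := by
    intro m hm
    have hm1 := hsub hm
    have ha1 := hsub ha
    rw [act_b_one] at hm1 ha1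
    refine ⟨?_, ?_, ?_⟩
    · rw [inner_sub_right, real_inner_comm, real_inner_comm m,
        S.inner_b_zero_of_inner_b_one hm1.1 hm1.2, S.inner_b_zero_of_inner_b_one ha1.1 ha1.2, sub_self]
    · rw [inner_sub_right, real_inner_comm, real_inner_comm m, hm1.2, ha1.2, sub_self]
    · have h := le_antisymm (hm.2 a ha.1) (ha.2 m hm.1)
      rw [inner_add_right, inner_add_right, hm1.2, ha1.2] at h
      rw [inner_sub_right, real_inner_comm, real_inner_comm m]
      linarith
  have hli : LinearIndependent ℝ ![S.b 0, S.b 1, z] := by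
    rw [Fintype.linearIndependent_iff]
    intro g hg
    simp only [Fin.sum_univ_three, Matrix.cons_val_zero, Matrix.cons_val_one, Matrix.cons_val] at hg
    have e2 := congrArg (fun y => (inner ℝ y z : ℝ)) hg
    simp only [inner_add_left, inner_smul_left, inner_zero_left,
      S.inner_b_plane (i := 0) (by decide) (by decide) w,
      S.inner_b_plane (i := 1) (by decide) (by decide) w, hz, mul_zero, zero_add] at e2
    have g2 : g 2 = 0 := (mul_eq_zero.1 e2).resolve_right (inner_self_ne_zero.2 hz0)
    rw [g2, zero_smul, add_zero] at hg
    have e0 := congrArg (fun y => (inner ℝ (S.α 0) y : ℝ)) hg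
    have e1 := congrArg (fun y => (inner ℝ (S.α 1) y : ℝ)) hg
    simp only [inner_add_right, inner_smul_right, inner_zero_right, S.inner_ne 0 1 (by decide),
      S.inner_ne 1 0 (by decide), mul_zero, zero_add, add_zero] at e0 e1
    have g0 : g 0 = 0 := (mul_eq_zero.1 e0).resolve_right (S.inner_pos 0).ne'
    have g1 : g 1 = 0 := (mul_eq_zero.1 e1).resolve_right (S.inner_pos 1).ne'
    intro i
    fin_cases i <;> assumption
  set U := Submodule.span ℝ (Set.range ![S.b 0, S.b 1, z]) with hU
  have hU3 : Module.finrank ℝ U = 3 := finrank_span_eq_card hli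
  have hU1 : Module.finrank ℝ Uᗮ = 1 := by
    have := U.finrank_add_finrank_orthogonal
    have h4 : Module.finrank ℝ E4 = 4 := by simp
    omega
  have hmem : ∀ m ∈ act S.N (S.b 1 + z), a - m ∈ Uᗮ := by
    intro m hm
    obtain ⟨h0, h1, h2⟩ := hperp m hm
    rw [Submodule.mem_orthogonal]
    intro u hu
    refine Submodule.span_induction (p := fun u _ => inner ℝ u (a - m) = 0) ?_ ?_ ?_ ?_ hu
    · rintro _ ⟨i, rfl⟩
      fin_cases i
      · exact h0
      · exact h1
      · exact h2
    · exact inner_zero_left _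
    · intro x y _ _ hx hy
      rw [inner_add_left, hx, hy, add_zero]
    · intro r x _ hx
      rw [inner_smul_left, hx, mul_zero]
  have hd0 : (⟨a - b, hmem b hb⟩ : Uᗮ) ≠ 0 := fun h => by
    have := congrArg Subtype.val h
    exact hba (sub_eq_zero.1 this).symm
  obtain ⟨r, hr⟩ := (finrank_eq_one_iff_of_nonzero' _ hd0).1 hU1 ⟨a - c, hmem c hc⟩
  have hr' : r • (a - b) = a - c := congrArg Subtype.val hr
  have hnb := (S.norm_of_mem_N hb.1).trans (S.norm_of_mem_N ha.1).symm
  have hnc := (S.norm_of_mem_N hc.1).trans (S.norm_of_mem_N ha.1).symm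
  have hb2 := norm_sub_sq_real a (a - b)
  have hc2 := norm_sub_sq_real a (a - c)
  rw [sub_sub_cancel, hnb] at hb2
  rw [sub_sub_cancel, hnc, ← hr', inner_smul_right, norm_smul, mul_pow, Real.norm_eq_abs,
    sq_abs] at hc2
  have hprod : r * (r - 1) * ‖a - b‖ ^ 2 = 0 := by linear_combination r * hb2 - hc2
  have hnz : ‖a - b‖ ^ 2 ≠ 0 := pow_ne_zero _ (norm_ne_zero_iff.2 (sub_ne_zero.2 hba.symm))
  rcases mul_eq_zero.1 ((mul_eq_zero.1 hprod).resolve_right hnz) with h | h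
  · rw [h, zero_smul] at hr'
    exact hca (sub_eq_zero.1 hr'.symm).symm
  · rw [sub_eq_zero.1 h, one_smul] at hr'
    exact hcb (sub_right_injective hr').symm

/-- A linking circle around the edge of the flag that meets only the facets around this edge. -/
theorem exists_isLinkingCircle : ∃ C : Set E4, IsLinkingCircle (convexHull ℝ V) C ∧
    ∀ x ∈ C, x ∈ graphCompl (convexHull ℝ V) ∧ act S.N x ⊆ act S.N (S.b 1) := by
  obtain ⟨δ, hδ, hball⟩ := Metric.eventually_nhds_iff.1 (eventually_act_subset S.N_finite (S.b 1))
  -- Small enough for the flat disk around `b 1` to stay where only the facets at the edge can be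
  -- active.
  set ε : ℝ := δ / (2 * (‖S.plane‖ + 1)) with hε
  have hLpos : 0 < ‖S.plane‖ + 1 := by positivity
  have hεpos : 0 < ε := by positivity
  let y : EuclideanSpace ℝ (Fin 2) → E4 := fun w => S.b 1 + S.plane (ε • w)
  have hβ : 0 < ‖S.b 1‖ ^ 2 := pow_pos (norm_pos_iff.2 (S.b_ne_zero 1)) 2
  have hyb : ∀ w, inner ℝ (S.b 1) (y w) = ‖S.b 1‖ ^ 2 := fun w => by
    rw [inner_add_right, S.inner_b_plane (by decide) (by decide), add_zero,
      real_inner_self_eq_norm_sq]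
  have hy0 : ∀ w, y w ≠ 0 := fun w h => by
    have := hyb w
    rw [h, inner_zero_right] at this
    exact hβ.ne this
  have hyn : ∀ w, 0 < ‖y w‖ := fun w => norm_pos_iff.2 (hy0 w)
  have hysub : ∀ w ∈ Metric.closedBall (0 : EuclideanSpace ℝ (Fin 2)) 1,
      act S.N (y w) ⊆ act S.N (S.b 1) := by
    intro w hw
    refine hball ?_
    rw [dist_eq_norm, add_sub_cancel_left]
    have hw' : ‖w‖ ≤ 1 := mem_closedBall_zero_iff.1 hw
    calc ‖S.plane (ε • w)‖ ≤ ‖S.plane‖ * ‖ε • w‖ := S.plane.le_opNorm _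
      _ ≤ ‖S.plane‖ * ε := by
        rw [norm_smul, Real.norm_of_nonneg hεpos.le]
        exact mul_le_mul_of_nonneg_left (mul_le_of_le_one_right hεpos.le hw') (norm_nonneg _)
      _ < (‖S.plane‖ + 1) * (2 * ε) := by nlinarith [norm_nonneg S.plane]
      _ = δ := by rw [hε]; field_simp
  have hyfew : ∀ w ∈ Metric.closedBall (0 : EuclideanSpace ℝ (Fin 2)) 1, w ≠ 0 →
      FewActive S.N (y w) := fun w hw hw0 =>
    S.fewActive_add_plane (smul_ne_zero hεpos.ne' hw0) (hysub w hw)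
  -- The disk is the radial projection of a flat disk orthogonal to the edge plane at the midpoint.
  let D : EuclideanSpace ℝ (Fin 2) → E4 := fun w => ‖y w‖⁻¹ • y w
  have hDn : ∀ w, ‖D w‖ = 1 := fun w => by
    rw [norm_smul, norm_inv, norm_norm, inv_mul_cancel₀ (hyn w).ne']
  have hDfew : ∀ w ∈ Metric.closedBall (0 : EuclideanSpace ℝ (Fin 2)) 1, w ≠ 0 →
      D w ∈ graphCompl (convexHull ℝ V) := fun w hw hw0 =>
    S.mem_graphCompl_iff.2 ⟨hDn w, (hyfew w hw hw0).smul (inv_pos.2 (hyn w))⟩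
  have hyd : ContDiff ℝ ∞ y := by
    have : ContDiff ℝ ∞ fun w : EuclideanSpace ℝ (Fin 2) => S.plane (ε • w) :=
      S.plane.contDiff.comp (contDiff_const_smul ε)
    exact contDiff_const.add this
  have hfd : ContDiff ℝ ∞ fun w => ‖y w‖⁻¹ :=
    (hyd.norm ℝ hy0).inv fun w => (hyn w).ne'
  have hDd : ContDiff ℝ ∞ D := hfd.smul hyd
  have hy' : ∀ w, HasFDerivAt y (ε • S.plane) w := by
    intro w
    have h1 := (ε • S.plane).hasFDerivAt (x := w)
    have h2 := h1.const_add (S.b 1)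
    refine h2.congr_of_eventuallyEq (Eventually.of_forall fun z => ?_)
    simp [y]
  have hD' : ∀ w h, fderiv ℝ D w h =
      (‖y w‖⁻¹ * ε) • S.plane h + (fderiv ℝ (fun w => ‖y w‖⁻¹) w h) • y w := by
    intro w h
    have h1 : HasFDerivAt (fun w => ‖y w‖⁻¹) (fderiv ℝ (fun w => ‖y w‖⁻¹) w) w :=
      (hfd.differentiable (by simp)).differentiableAt.hasFDerivAt
    have h2 := (h1.smul (hy' w)).fderiv
    have h3 : fderiv ℝ D w = _ := h2
    rw [h3]
    simp [smul_smul]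
  -- Pairing with `b 1` kills the displacement and isolates the derivative of the radial factor.
  have hDb : ∀ w h, inner ℝ (S.b 1) (fderiv ℝ D w h) =
      fderiv ℝ (fun w => ‖y w‖⁻¹) w h * ‖S.b 1‖ ^ 2 := by
    intro w h
    rw [hD', inner_add_right, inner_smul_right, inner_smul_right, hyb,
      S.inner_b_plane (by decide) (by decide), mul_zero, zero_add]
  have hy00 : y 0 = S.b 1 := by simp [y]
  have hD00 : D 0 = ‖S.b 1‖⁻¹ • S.b 1 := by simp only [D, hy00]
  refine ⟨D '' Metric.sphere 0 1, ⟨D, hDd, ?_, ?_, ?_, rfl, 0, by simp, ?_, S.b 0,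
    refl (S.α 0) (S.b 0), S.b_zero_ne_refl, S.isSegmentFace, ⟨S.b 1, ?_, hD00⟩, ?_⟩, ?_⟩
  · intro w _ w' _ h
    have h1 := congrArg (fun x => (inner ℝ (S.b 1) x : ℝ)) h
    simp only [D, inner_smul_right, hyb] at h1
    have h2 : ‖y w‖⁻¹ = ‖y w'‖⁻¹ := mul_right_cancel₀ hβ.ne' h1
    simp only [D] at h
    rw [h2] at h
    have h3 : y w = y w' := smul_right_injective E4 (inv_ne_zero (hyn w').ne') h
    have h4 := S.plane_injective (add_left_cancel h3)
    exact smul_right_injective _ hεpos.ne' h4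
  · intro w _
    rw [injective_iff_map_eq_zero]
    intro h hh
    have h1 := hDb w h
    rw [hh, inner_zero_right] at h1
    have h2 := (mul_eq_zero.1 h1.symm).resolve_right hβ.ne'
    have h3 := hD' w h
    rw [hh, h2, zero_smul, add_zero] at h3
    have h4 := (smul_eq_zero.1 h3.symm).resolve_left (mul_pos (inv_pos.2 (hyn w)) hεpos).ne'
    exact S.plane_injective (h4.trans (map_zero _).symm)
  · rintro _ ⟨w, _, rfl⟩
    exact mem_sphere_zero_iff_norm.2 (hDn w)
  · refine Set.Subset.antisymm ?_ ?_
    · rintro _ ⟨⟨w, hw, rfl⟩, hΓ⟩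
      by_contra hne
      have hw0 : w ≠ 0 := by rintro rfl; exact hne rfl
      exact (hDfew w hw hw0).2 hΓ
    · rintro _ rfl
      refine ⟨⟨0, by simp, rfl⟩, (S.mem_radialGraph_iff (hDn 0)).2 fun hfew => ?_⟩
      have := hfew.smul (hyn 0)
      rw [smul_smul, mul_inv_cancel₀ (hyn 0).ne', one_smul, hy00] at this
      exact S.not_fewActive_b_one this
  · refine ⟨1 / 2, 1 / 2, by norm_num, by norm_num, by norm_num, ?_⟩
    rw [S.b_one, smul_add]
  · rw [Submodule.disjoint_def]
    rintro _ ⟨h, rfl⟩ hspan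
    -- D has constant norm, so its derivative is orthogonal to it. At the center the radial factor
    -- thus has zero derivative and the tangent plane is the range of `plane`, orthogonal to both
    -- ends of the edge.
    have h1 : inner ℝ (D 0) (fderiv ℝ D 0 h) = 0 := by
      have h2 : HasFDerivAt D (fderiv ℝ D 0) 0 :=
        (hDd.differentiable (by simp)).differentiableAt.hasFDerivAt
      have h3 := h2.norm_sq
      have h4 : HasFDerivAt (fun w => ‖D w‖ ^ 2) (0 : EuclideanSpace ℝ (Fin 2) →L[ℝ] ℝ) 0 := by
        simp only [hDn]
        exact hasFDerivAt_const _ _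
      have h5 := DFunLike.congr_fun (h3.unique h4) h
      simpa using h5
    rw [hD00, inner_smul_left, hDb] at h1
    have h2 : fderiv ℝ (fun w => ‖y w‖⁻¹) 0 h = 0 := by
      have h6 : 0 < ‖S.b 1‖⁻¹ := inv_pos.2 (norm_pos_iff.2 (S.b_ne_zero 1))
      have h7 := (mul_eq_zero.1 h1).resolve_left h6.ne'
      exact (mul_eq_zero.1 h7).resolve_right hβ.ne'
    have h3 : fderiv ℝ D 0 h = (‖y 0‖⁻¹ * ε) • S.plane h := by
      rw [hD', h2, zero_smul, add_zero]
    have hu : inner ℝ (S.b 0) (fderiv ℝ D 0 h) = 0 := by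
      rw [h3, inner_smul_right, S.inner_b_plane (by decide) (by decide), mul_zero]
    have hv : inner ℝ (refl (S.α 0) (S.b 0)) (fderiv ℝ D 0 h) = 0 := by
      have h8 : refl (S.α 0) (S.plane h) = S.plane h := by
        refine refl_eq_self ?_
        rw [plane_apply, inner_add_right, inner_smul_right, inner_smul_right, S.inner_α₀₂,
          S.inner_α₀₃]
        simp
      rw [inner_refl_left, h3, map_smul, h8, ← h3, hu]
    rw [← inner_self_eq_zero (𝕜 := ℝ)]
    generalize fderiv ℝ D 0 h = x at hu hv hspan
    obtain ⟨s, t, rfl⟩ := Submodule.mem_span_pair.1 hspan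
    rw [inner_add_left, inner_smul_left, inner_smul_left, hu, hv]
    simp
  · rintro _ ⟨w, hw, rfl⟩
    have hw1 : w ∈ Metric.closedBall (0 : EuclideanSpace ℝ (Fin 2)) 1 :=
      Metric.sphere_subset_closedBall hw
    have hw0 : w ≠ 0 := by
      rintro rfl
      rw [mem_sphere_zero_iff_norm, norm_zero] at hw
      exact zero_ne_one hw
    refine ⟨hDfew w hw1 hw0, ?_⟩
    rw [act_smul _ (inv_pos.2 (hyn w))]
    exact hysub w hw1

end Flag

/-! ### Facets active at a point -/

/-- If one normal is maximal at both points, a normal maximal at the combination must attain the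
maximum in each term with positive weight. -/
theorem act_smul_add_smul {N : Set E4} {u v n : E4} (hu : n ∈ act N u) (hv : n ∈ act N v) {s t : ℝ}
    (hs : 0 < s) (ht : 0 ≤ t) : n ∈ act N (s • u + t • v) ∧ act N (s • u + t • v) ⊆ act N u := by
  refine ⟨⟨hu.1, fun m hm => ?_⟩, fun m hm => ⟨hm.1, fun k hk => ?_⟩⟩
  · simp only [inner_add_right, inner_smul_right]
    exact add_le_add (mul_le_mul_of_nonneg_left (hu.2 m hm) hs.le)
      (mul_le_mul_of_nonneg_left (hv.2 m hm) ht)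
  · refine (hu.2 k hk).trans ?_
    have h1 := hm.2 n hu.1
    simp only [inner_add_right, inner_smul_right] at h1
    have h2 := mul_le_mul_of_nonneg_left (hv.2 m hm.1) ht
    exact le_of_mul_le_mul_left (by linarith) hs

theorem FewActive.act_eq {N : Set E4} {x a b : E4} (h : FewActive N x) (ha : a ∈ act N x)
    (hb : b ∈ act N x) (hab : a ≠ b) : act N x = {a, b} := by
  obtain ⟨c, d, h⟩ := h
  refine Set.Subset.antisymm ?_ (Set.insert_subset ha (Set.singleton_subset_iff.2 hb))
  intro m hm
  have h1 := h ha
  have h2 := h hb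
  have h3 := h hm
  simp only [Set.mem_insert_iff, Set.mem_singleton_iff] at h1 h2 h3 ⊢
  grind

theorem fewActive_of_eq {N : Set E4} {x a b : E4} (h : act N x = {a, b}) : FewActive N x :=
  ⟨a, b, h.subset⟩

/-- A function on a subset of `E4` that is locally constant along a segment takes the same value at
its end points. -/
theorem eq_of_segment {A : Set E4} {β : Type*} {f : A → β} {K : Set E4} {x y : E4}
    (hK : ∀ z ∈ K, ∀ h : z ∈ A, ∀ᶠ w in 𝓝 (⟨z, h⟩ : A), w.1 ∈ K → f w = f ⟨z, h⟩)
    (hxy : ∀ z ∈ segment ℝ x y, z ∈ A ∧ z ∈ K) (hx : x ∈ A) (hy : y ∈ A) :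
    f ⟨x, hx⟩ = f ⟨y, hy⟩ := by
  have hconn : IsPreconnected (Subtype.val ⁻¹' segment ℝ x y : Set A) := by
    rw [← Topology.IsInducing.subtypeVal.isPreconnected_image, Subtype.image_preimage_coe,
      Set.inter_eq_self_of_subset_right fun z hz => (hxy z hz).1]
    exact (convex_segment x y).isPreconnected
  refine eq_of_eventually_eq hconn ?_ (left_mem_segment ℝ x y) (right_mem_segment ℝ x y)
  rintro ⟨z, h⟩ hz
  have hz' : z ∈ segment ℝ x y := hz
  filter_upwards [(hK z (hxy z hz').2 h).filter_mono nhdsWithin_le_nhds, self_mem_nhdsWithin]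
    with w hw hw'
  exact hw (hxy w.1 hw').2

/-- Two normals are adjacent if their facets share a two-dimensional face. -/
def Adj (N : Set E4) (n n' : E4) : Prop := n ≠ n' ∧ ∃ w, act N w = {n, n'}

theorem Adj.symm {N : Set E4} {n n' : E4} (h : Adj N n n') : Adj N n' n :=
  ⟨h.1.symm, by obtain ⟨w, hw⟩ := h.2; exact ⟨w, by rw [hw, Set.pair_comm]⟩⟩

theorem Adj.mem {N : Set E4} {n n' : E4} (h : Adj N n n') : n ∈ N ∧ n' ∈ N := by
  obtain ⟨w, hw⟩ := h.2
  exact ⟨(hw ▸ Set.mem_insert n _ : n ∈ act N w).1,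
    (hw ▸ Set.mem_insert_of_mem n rfl : n' ∈ act N w).1⟩

/-- The only obstruction is the product around the cycle. If it is -1, negating every entry repairs
it because the length is odd; this is where the parity of the number of facets around an edge
enters. -/
theorem units_cycle_three (C : Fin 3 → ℤˣ) : (∃ φ : Fin 3 → ℤˣ, ∀ j, φ j * φ (j + 1) = C j) ∨
    ∃ φ : Fin 3 → ℤˣ, ∀ j, φ j * φ (j + 1) = -C j := by
  revert C
  decide

theorem units_cycle_five (C : Fin 5 → ℤˣ) : (∃ φ : Fin 5 → ℤˣ, ∀ j, φ j * φ (j + 1) = C j) ∨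
    ∃ φ : Fin 5 → ℤˣ, ∀ j, φ j * φ (j + 1) = -C j := by
  rcases Int.units_eq_one_or (C 0 * C 1 * C 2 * C 3 * C 4) with h | h
  · refine .inl ⟨![1, C 0, C 0 * C 1, C 0 * C 1 * C 2, C 0 * C 1 * C 2 * C 3], ?_⟩
    intro j
    fin_cases j
    all_goals rcases Int.units_eq_one_or (C 0) with h0 | h0 <;>
      rcases Int.units_eq_one_or (C 1) with h1 | h1 <;>
      rcases Int.units_eq_one_or (C 2) with h2 | h2 <;>
      rcases Int.units_eq_one_or (C 3) with h3 | h3 <;>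
      rcases Int.units_eq_one_or (C 4) with h4 | h4 <;>
      simp_all
  · refine .inr ⟨![1, -C 0, C 0 * C 1, -(C 0 * C 1 * C 2), C 0 * C 1 * C 2 * C 3], ?_⟩
    intro j
    fin_cases j
    all_goals rcases Int.units_eq_one_or (C 0) with h0 | h0 <;>
      rcases Int.units_eq_one_or (C 1) with h1 | h1 <;>
      rcases Int.units_eq_one_or (C 2) with h2 | h2 <;>
      rcases Int.units_eq_one_or (C 3) with h3 | h3 <;>
      rcases Int.units_eq_one_or (C 4) with h4 | h4 <;>
      simp_all

/-- The sequence of values on a cycle of odd length can be written as a product of consecutive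
values of another sequence, up to a global sign. -/
theorem units_cycle {r : ℕ} [NeZero r] (hr : r = 3 ∨ r = 5) (C : Fin r → ℤˣ) :
    (∃ φ : Fin r → ℤˣ, ∀ j, φ j * φ (j + 1) = C j) ∨
    ∃ φ : Fin r → ℤˣ, ∀ j, φ j * φ (j + 1) = -C j := by
  rcases hr with rfl | rfl
  · exact units_cycle_three C
  · exact units_cycle_five C

theorem eq_of_cycle {r : ℕ} [NeZero r] {β : Type*} {h : Fin r → β} (hh : ∀ j, h (j + 1) = h j)
    (j k : Fin r) : h j = h k := by
  have key : ∀ m : ℕ, h (Fin.ofNat r m) = h 0 := by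
    intro m
    induction m with
    | zero => rfl
    | succ m ih =>
      rw [← ih, ← hh (Fin.ofNat r m)]
      congr 1
      ext
      simp [Fin.ofNat, Fin.add_def, Nat.add_mod]
  have h1 := key j
  have h2 := key k
  rw [Fin.ofNat_val_eq_self] at h1 h2
  rw [h1, h2]

namespace Flag

variable {V : Set E4} (S : Flag V)

/-- All normals have the same norm, so Cauchy–Schwarz singles out n. Hence n itself serves as the
center of its facet cone. -/
theorem act_self {n : E4} (hn : n ∈ S.N) : act S.N n = {n} := by
  have hle : ∀ m ∈ S.N, inner ℝ m n ≤ (inner ℝ n n : ℝ) := fun m hm => by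
    rw [real_inner_self_eq_norm_mul_norm, S.norm_of_mem_N hn, ← S.norm_of_mem_N hm]
    nth_rw 2 [S.norm_of_mem_N hm]
    rw [← S.norm_of_mem_N hn]
    exact real_inner_le_norm m n
  ext m
  rw [Set.mem_singleton_iff]
  constructor
  · intro hm
    refine (S.eq_of_inner_eq hn hm.1 ?_).symm
    rw [real_inner_comm]
    exact le_antisymm (hle m hm.1) (hm.2 n hn)
  · rintro rfl
    exact ⟨hn, hle⟩

theorem not_fewActive_zero : ¬ FewActive S.N 0 :=
  S.not_fewActive (fun i => by simp [coord]) (by simp [coord]) (by simp [coord])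

theorem act_nonempty' (x : E4) : (act S.N x).Nonempty :=
  act_nonempty S.N_finite ⟨_, S.n_mem⟩ x

/-- Adjacent pairs are the pairs of a moved flag. Combined with `eq_of_dist`, this shows that only
consecutive facets around an edge are adjacent. -/
theorem norm_sub_of_adj {n n' : E4} (h : Adj S.N n n') : ‖n - n'‖ = S.gap := by
  obtain ⟨hne, w, hw⟩ := h
  obtain ⟨S', hN, hgap, hS'⟩ := S.exists_flag_chamber w
  rw [← hN] at hw
  rw [← hgap]
  rcases (hS' 3).lt_or_eq with h3 | h3
  · rw [S'.act_of_coord_three_pos hS' h3] at hw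
    have h1 : n ∈ ({n, n'} : Set E4) := Set.mem_insert _ _
    have h2 : n' ∈ ({n, n'} : Set E4) := Set.mem_insert_of_mem _ rfl
    rw [← hw] at h1 h2
    exact absurd (h1.trans h2.symm) hne
  rcases (hS' 2).lt_or_eq with h2 | h2
  · rw [S'.act_of_coord_two_pos hS' h3.symm h2, Set.pair_eq_pair_iff] at hw
    rcases hw with ⟨rfl, rfl⟩ | ⟨rfl, rfl⟩
    · rfl
    · rw [norm_sub_rev, gap]
  · exact absurd (fewActive_of_eq hw) (S'.not_fewActive hS' h3.symm h2.symm)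

theorem IsPolygon.adj {r : ℕ} [NeZero r] {p : Fin r → E4} {S : Flag V} (hp : S.IsPolygon r p)
    (j : Fin r) : Adj S.N (p j) (p (j + 1)) := by
  obtain ⟨g, hg, h1, h2⟩ := hp.adjacent j
  rw [← h1, ← h2]
  refine ⟨fun h => S.n_ne_refl (g.injective h), g (S.b 2), ?_⟩
  have hb := S.act_of_coord_two_pos (x := S.b 2) (fun i => by rw [coord_b]; split_ifs <;> norm_num)
    (by rw [coord_b, if_neg (by decide)]) (by rw [coord_b, if_pos rfl]; norm_num)
  ext m
  obtain ⟨m, rfl⟩ := g.surjective m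
  rw [mem_act_map_iff S hg, hb]
  simp

/-- The complement of the cones over the vertices. -/
def offVertices : Set E4 := {x | ∀ g, IsSymm V g → ∀ t : ℝ, 0 ≤ t → x ≠ t • g (S.b 0)}

theorem not_fewActive_vertex {g : E4 ≃ₗᵢ[ℝ] E4} (hg : IsSymm V g) {t : ℝ} (ht : 0 ≤ t) :
    ¬ FewActive S.N (t • g (S.b 0)) := by
  rcases ht.eq_or_lt with rfl | ht
  · rw [zero_smul]
    exact S.not_fewActive_zero
  · have h : ¬ FewActive (S.move hg).N ((S.move hg).b 0) :=
      (S.move hg).not_fewActive (fun i => by rw [coord_b]; split_ifs <;> norm_num)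
        (by rw [coord_b, if_neg (by decide)]) (by rw [coord_b, if_neg (by decide)])
    rwa [S.N_move, move_b, FewActive, ← act_smul _ ht] at h

/-- The facets at a point of the polytope different from the vertices: one, two, or the facets
around an edge. -/
theorem act_cases {x : E4} (hx : x ∈ S.offVertices) : FewActive S.N x ∨
    ∃ S' : Flag V, S'.N = S.N ∧ S'.gap = S.gap ∧ act S.N x = act S'.N (S'.b 1) := by
  obtain ⟨g, hg, h⟩ := S.exists_move_mem_chamber x
  have hN := S.N_move hg
  have hb := S.move_b hg 0
  have hgap := S.gap_move hg
  generalize S.move hg = S' at *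
  rw [← hN]
  rcases (h 3).lt_or_eq with h3 | h3
  · exact .inl ⟨S'.n, S'.n, by rw [S'.act_of_coord_three_pos h h3]; simp⟩
  rcases (h 2).lt_or_eq with h2 | h2
  · exact .inl (fewActive_of_eq (S'.act_of_coord_two_pos h h3.symm h2))
  refine .inr ⟨S', rfl, hgap, ?_⟩
  -- Otherwise only the coordinate along `b 0` could survive, putting x on the cone over a vertex.
  have h1 : 0 < S'.coord 1 x := by
    refine (h 1).lt_of_ne fun h1 => hx g hg _ (h 0) ?_
    conv_lhs => rw [← S'.sum_coord x]
    rw [Fin.sum_univ_four, ← h1, ← h2, ← h3, hb]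
    simp
  ext m
  rw [S'.mem_act_iff h, S'.act_b_one]
  refine and_congr_right fun hm => ⟨fun h => h 1 h1, fun h i hi => ?_⟩
  fin_cases i
  · exact S'.inner_b_zero_of_inner_b_one hm h
  · exact h
  · exact absurd h2 hi.ne
  · exact absurd h3 hi.ne

theorem exists_polygon : ∃ (r : ℕ) (_ : NeZero r) (p : Fin r → E4), (r = 3 ∨ r = 5) ∧
    S.IsPolygon r p := by
  rcases S.exists_isPolygon with ⟨p, hp⟩ | ⟨p, hp⟩
  · exact ⟨3, _, p, .inl rfl, hp⟩
  · exact ⟨5, _, p, .inr rfl, hp⟩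

/-- The facets at a point different from the vertices are connected by adjacency. -/
theorem eq_of_adj {β : Type*} {h : E4 → β} {x : E4} (hx : x ∈ S.offVertices)
    (hh : ∀ n ∈ act S.N x, ∀ n' ∈ act S.N x, Adj S.N n n' → h n = h n') {n n' : E4}
    (hn : n ∈ act S.N x) (hn' : n' ∈ act S.N x) : h n = h n' := by
  rcases S.act_cases hx with hf | ⟨S', hN, -, hact⟩
  · rcases eq_or_ne n n' with rfl | hne
    · rfl
    · exact hh n hn n' hn' ⟨hne, x, hf.act_eq hn hn' hne⟩
  · obtain ⟨r, _, p, -, hp⟩ := S'.exists_polygon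
    have hr : act S.N x = Set.range p := by rw [hact, S'.act_b_one, hp.range_eq]
    rw [hr] at hh hn hn'
    obtain ⟨j, rfl⟩ := hn
    obtain ⟨k, rfl⟩ := hn'
    exact eq_of_cycle (h := fun j => h (p j))
      (fun j => hh _ ⟨_, rfl⟩ _ ⟨_, rfl⟩ (hN ▸ (hp.adj j).symm)) j k

/-- A point from which the points of finitely many given segments are visible, if the cones over the
vertices are opaque. -/
theorem exists_viewpoint {W : Set (E4 × E4)} (hW : W.Finite) (hne : W.Nonempty)
    (hfew : ∀ w ∈ W, ∀ z ∈ segment ℝ w.1 w.2, FewActive S.N z) :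
    ∃ p ∈ S.offVertices, ∀ w ∈ W, ∀ z ∈ segment ℝ w.1 w.2, segment ℝ p z ⊆ S.offVertices := by
  have hfin : (W ×ˢ {g : E4 ≃ₗᵢ[ℝ] E4 | IsSymm V g}).Finite := hW.prod S.finite_isSymm
  -- If a vertex ray blocked the view of a point of the segment, p would lie in the span of the
  -- vertex and the two end points. These spans have dimension at most three, and finitely many of
  -- them do not fill the space.
  let U : (E4 × E4) × (E4 ≃ₗᵢ[ℝ] E4) → Submodule ℝ E4 :=
    fun k => Submodule.span ℝ (({k.1.1, k.1.2, k.2 (S.b 0)} : Finset E4) : Set E4)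
  have htop : (⊤ : Submodule ℝ E4) ∉ (hfin.image U).toFinset := by
    rw [Set.Finite.mem_toFinset]
    rintro ⟨k, -, hk⟩
    have h1 : Module.finrank ℝ (U k) ≤ 3 := (finrank_span_finset_le_card _).trans Finset.card_le_three
    rw [hk, finrank_top] at h1
    simp at h1
  obtain ⟨p, hp⟩ := (Set.ne_univ_iff_exists_notMem _).1
    (Subspace.biUnion_ne_univ_of_top_notMem htop)
  simp only [Set.mem_iUnion, Set.Finite.mem_toFinset, not_exists] at hp
  have hp' : ∀ w ∈ W, ∀ g, IsSymm V g → ∀ a b c : ℝ,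
      p ≠ a • w.1 + b • w.2 + c • g (S.b 0) := by
    rintro w hw g hg a b c rfl
    refine hp (U (w, g)) ⟨(w, g), ⟨hw, hg⟩, rfl⟩ ?_
    exact add_mem (add_mem (Submodule.smul_mem _ _ (Submodule.subset_span (by simp)))
      (Submodule.smul_mem _ _ (Submodule.subset_span (by simp))))
      (Submodule.smul_mem _ _ (Submodule.subset_span (by simp)))
  refine ⟨p, fun g hg t ht h => ?_, ?_⟩
  · obtain ⟨w, hw⟩ := hne
    exact hp' w hw g hg 0 0 t (by rw [h]; simp)
  · rintro w hw z hz y ⟨a, b, ha, hb, hab, rfl⟩ g hg t ht h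
    -- The target itself is off the vertex rays, having few active facets; at any other point of the
    -- line of sight the relation can be solved for p.
    rcases ha.eq_or_lt with rfl | ha
    · rw [zero_add] at hab
      rw [hab, zero_smul, zero_add, one_smul] at h
      exact S.not_fewActive_vertex hg ht (h ▸ hfew w hw z hz)
    · obtain ⟨c, d, -, -, -, rfl⟩ := hz
      refine hp' w hw g hg (-(a⁻¹ * b * c)) (-(a⁻¹ * b * d)) (a⁻¹ * t) ?_
      rw [mul_smul, ← h, smul_add, smul_smul, inv_mul_cancel₀ ha.ne']
      module

end Flag

/-! ### Sign cocycles on the stars of facets -/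

namespace Flag

variable {V : Set E4} (S : Flag V)

/-- The points at which at most two facets are active. -/
def fewSet : Set E4 := {x | FewActive S.N x}

theorem eventually_act_subset_sub {A : Set E4} (x : A) :
    ∀ᶠ y in 𝓝 x, act S.N y.1 ⊆ act S.N x.1 :=
  continuous_subtype_val.continuousAt.eventually (eventually_act_subset S.N_finite x.1)

/-- Moving from x towards n leaves n as the only active normal at once; so the star of a facet is
star-shaped about n. -/
theorem segment_facet {n x : E4} (hn : n ∈ act S.N x) {z : E4} (hz : z ∈ segment ℝ n x) :
    n ∈ act S.N z ∧ (z ≠ x → act S.N z = {n}) := by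
  obtain ⟨a, b, ha, hb, hab, rfl⟩ := hz
  have hnn : n ∈ act S.N n := by rw [S.act_self hn.1]; rfl
  rcases ha.eq_or_lt with rfl | ha
  · rw [zero_add] at hab
    rw [hab, zero_smul, zero_add, one_smul]
    exact ⟨hn, fun h => absurd rfl h⟩
  · have h := act_smul_add_smul hnn hn ha hb
    refine ⟨h.1, fun _ => Set.Subset.antisymm ?_ (Set.singleton_subset_iff.2 h.1)⟩
    rw [← S.act_self hn.1]
    exact h.2

theorem segment_facet_few {n x : E4} (hx : FewActive S.N x) (hn : n ∈ act S.N x) {z : E4}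
    (hz : z ∈ segment ℝ n x) : FewActive S.N z := by
  by_cases h : z = x
  · rwa [h]
  · exact ⟨n, n, by rw [(S.segment_facet hn hz).2 h]; simp⟩

variable {τ : S.fewSet → S.fewSet → ℤˣ}

/-- On the star of a facet a sign cocycle is trivial. -/
theorem exists_star_section (hτ : IsSignCocycle τ) (n : E4) : ∃ σ : S.fewSet → ℤˣ,
    ∀ x, n ∈ act S.N x.1 → ∀ᶠ y in 𝓝 x, n ∈ act S.N y.1 → σ y = σ x * τ x y := by
  classical
  by_cases hn : n ∈ S.N
  swap
  · exact ⟨1, fun x hx => absurd hx.1 hn⟩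
  let A : Set S.fewSet := {x | n ∈ act S.N x.1}
  have hseg : ∀ (t : unitInterval) (a : A), n + (t : ℝ) • (a.1.1 - n) ∈ S.fewSet := fun t a =>
    S.segment_facet_few a.1.2 a.2 (by
      rw [segment_eq_image']
      exact ⟨t, t.2, rfl⟩)
  let H : C(unitInterval × A, S.fewSet) :=
    ⟨fun z => ⟨n + (z.1 : ℝ) • (z.2.1.1 - n), hseg z.1 z.2⟩, by
      refine Continuous.subtype_mk ?_ _
      have : Continuous fun z : unitInterval × A => z.2.1.1 :=
        continuous_subtype_val.comp (continuous_subtype_val.comp continuous_snd)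
      fun_prop⟩
  have hfew : n ∈ S.fewSet := ⟨n, n, by rw [S.act_self hn]; simp⟩
  obtain ⟨s, hs⟩ := hτ.exists_section H ⟨n, hfew⟩ (fun a => Subtype.ext (by simp [H]))
  have hH : ∀ a, H (1, a) = a.1 := fun a => Subtype.ext (by simp [H])
  simp only [hH] at hs
  -- The value off the star is immaterial.
  refine ⟨fun x => if h : n ∈ act S.N x.1 then s ⟨x, h⟩ else 1, fun x hx => ?_⟩
  have h1 := hs ⟨x, hx⟩
  rw [nhds_subtype_eq_comap, Filter.eventually_comap] at h1
  filter_upwards [h1] with y hy hny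
  simp only [dif_pos hx, dif_pos hny]
  exact hy ⟨y, hny⟩ rfl

variable {σ : E4 → S.fewSet → ℤˣ}

/-- Two star sections have constant ratio on the cone over a common two-dimensional face. -/
theorem star_section_ratio
    (hσ : ∀ n x, n ∈ act S.N x.1 → ∀ᶠ y in 𝓝 x, n ∈ act S.N y.1 → σ n y = σ n x * τ x y)
    {n n' : E4} {x y : S.fewSet} (hx : act S.N x.1 = {n, n'}) (hy : act S.N y.1 = {n, n'}) :
    σ n x * σ n' x = σ n y * σ n' y := by
  refine eq_of_segment (A := S.fewSet) (f := fun x => σ n x * σ n' x)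
    (K := {x | act S.N x = {n, n'}}) ?_ ?_ x.2 y.2
  · intro z hz h
    have hz' : act S.N z = {n, n'} := hz
    have h1 : n ∈ act S.N z := by rw [hz']; simp
    have h2 : n' ∈ act S.N z := by rw [hz']; simp
    filter_upwards [hσ n ⟨z, h⟩ h1, hσ n' ⟨z, h⟩ h2] with w hw1 hw2 hw
    have hw' : act S.N w.1 = {n, n'} := hw
    rw [hw1 (by rw [hw']; simp), hw2 (by rw [hw']; simp), mul_mul_mul_comm, Int.units_mul_self,
      mul_one]
  -- The cone over the open 2-face is convex.
  · have key : ∀ z ∈ segment ℝ x.1 y.1, act S.N z = {n, n'} := by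
      rintro z ⟨a, b, ha, hb, hab, rfl⟩
      rcases ha.eq_or_lt with rfl | ha
      · rw [zero_add] at hab
        rw [hab, zero_smul, zero_add, one_smul, hy]
      · refine Set.Subset.antisymm ?_ ?_
        · rw [← hx]
          exact (act_smul_add_smul (n := n) (by rw [hx]; simp) (by rw [hy]; simp) ha hb).2
        · rintro m hm
          exact (act_smul_add_smul (n := m) (by rw [hx]; exact hm) (by rw [hy]; exact hm) ha hb).1
    exact fun z hz => ⟨fewActive_of_eq (key z hz), key z hz⟩

/-- Around every edge, the signs of the two-dimensional faces come from signs of the facets. -/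
theorem exists_local_potential
    (hσ : ∀ n x, n ∈ act S.N x.1 → ∀ᶠ y in 𝓝 x, n ∈ act S.N y.1 → σ n y = σ n x * τ x y)
    {c : E4 → E4 → ℤˣ} (hsymm : ∀ n n', c n n' = c n' n)
    (hc : ∀ n n' (x : S.fewSet), n ≠ n' → act S.N x.1 = {n, n'} → c n n' = -(σ n x * σ n' x))
    (hτ : ∀ S' : Flag V, S'.N = S.N → ∀ s : S.fewSet → ℤˣ,
      ∃ x, act S.N x.1 ⊆ act S.N (S'.b 1) ∧
        ¬ ∀ᶠ y in 𝓝 x, act S.N y.1 ⊆ act S.N (S'.b 1) → s y = s x * τ x y)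
    {x : E4} (hx : x ∈ S.offVertices) :
    ∃ F : E4 → ℤˣ, ∀ n ∈ act S.N x, ∀ n' ∈ act S.N x, Adj S.N n n' → c n n' = F n * F n' := by
  classical
  rcases S.act_cases hx with hf | ⟨S', hN, hgap, hact⟩
  · obtain ⟨a, ha⟩ := S.act_nonempty' x
    -- With at most two active facets there is no cycle: one value is 1 and c prescribes the other.
    refine ⟨fun m => if m = a then 1 else c a m, fun n hn n' hn' h => ?_⟩
    by_cases hna : n = a
    · subst hna
      simp [h.1.symm]
    · by_cases hna' : n' = a
      · subst hna'
        simp [h.1, hsymm n' n]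
      · have h3 := hf.act_eq ha hn (Ne.symm hna)
        rw [h3] at hn'
        rcases hn' with h4 | h4
        · exact absurd h4 hna'
        · exact absurd h4.symm h.1
  · obtain ⟨r, _, p, hr, hp⟩ := S'.exists_polygon
    have hrange : act S.N (S'.b 1) = Set.range p := by rw [← hN, S'.act_b_one, hp.range_eq]
    have hact' : act S.N x = Set.range p := by rw [hact, hN, hrange]
    have hadj : ∀ j k, Adj S.N (p j) (p k) → k = j + 1 ∨ j = k + 1 := fun j k h =>
      hp.eq_of_dist j k (by rw [hgap, S.norm_sub_of_adj h])
    have hext : ∀ φ : Fin r → ℤˣ, ∃ F : E4 → ℤˣ, ∀ j, F (p j) = φ j := fun φ =>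
      ⟨Function.extend p φ 1, fun j => hp.injective.extend_apply φ 1 j⟩
    rcases units_cycle hr (fun j => c (p j) (p (j + 1))) with ⟨φ, hφ⟩ | ⟨φ, hφ⟩
    · obtain ⟨F, hF⟩ := hext φ
      refine ⟨F, fun n hn n' hn' h => ?_⟩
      rw [hact'] at hn hn'
      obtain ⟨j, rfl⟩ := hn
      obtain ⟨k, rfl⟩ := hn'
      rcases hadj j k h with rfl | rfl
      · rw [hF, hF, hφ]
      · rw [hF, hF, hsymm, mul_comm, hφ]
    -- Here F n F n' = -c n n' = σ n y · σ n' y, so the values F n · σ n y agree for all facets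
    -- active at y. They glue to a section around the edge, against the Möbius condition.
    · exfalso
      obtain ⟨F, hF⟩ := hext φ
      have hpick : ∀ x, ∃ n, n ∈ act S.N x := fun x => S.act_nonempty' x
      choose pick hpick using hpick
      have hval : ∀ y : S.fewSet, act S.N y.1 ⊆ act S.N (S'.b 1) → ∀ n ∈ act S.N y.1,
          ∀ n' ∈ act S.N y.1, F n * σ n y = F n' * σ n' y := by
        intro y hy n hn n' hn'
        rcases eq_or_ne n n' with rfl | hne
        · rfl
        have h1 := FewActive.act_eq y.2 hn hn' hne
        have h2 : Adj S.N n n' := ⟨hne, y.1, h1⟩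
        have h3 := hc n n' y hne h1
        have h4 : F n * F n' = -c n n' := by
          have hn1 := hy hn
          have hn2 := hy hn'
          rw [hrange] at hn1 hn2
          obtain ⟨j, rfl⟩ := hn1
          obtain ⟨k, rfl⟩ := hn2
          rcases hadj j k h2 with rfl | rfl
          · rw [hF, hF, hφ]
          · rw [hF, hF, hsymm, mul_comm, hφ]
        rw [h3, neg_neg] at h4
        rcases Int.units_eq_one_or (F n) with e1 | e1 <;>
          rcases Int.units_eq_one_or (F n') with e2 | e2 <;>
          rcases Int.units_eq_one_or (σ n y) with e3 | e3 <;>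
          rcases Int.units_eq_one_or (σ n' y) with e4 | e4 <;>
          simp_all
      obtain ⟨y, hy, hcon⟩ := hτ S' hN (fun y => F (pick y.1) * σ (pick y.1) y)
      refine hcon ?_
      have h5 : ∀ᶠ z in 𝓝 y, ∀ n ∈ S.N, n ∈ act S.N y.1 → n ∈ act S.N z.1 →
          σ n z = σ n y * τ y z := by
        rw [Filter.eventually_all_finite S.N_finite]
        intro n _
        by_cases hny : n ∈ act S.N y.1
        · filter_upwards [hσ n y hny] with z hz _ using hz
        · exact Eventually.of_forall fun z h => absurd h hny
      filter_upwards [h5, S.eventually_act_subset_sub y] with z hz hsub hz'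
      have hmem := hpick z.1
      rw [hz _ hmem.1 (hsub hmem) hmem, ← mul_assoc, hval y hy _ (hsub hmem) _ (hpick y.1)]

end Flag

theorem units_mul_eq_mul_of_mul_eq_mul {a b c d : ℤˣ} (h : a * b = c * d) : a * c = b * d := by
  revert a b c d
  decide

theorem units_mul_eq_neg_mul {a b c d : ℤˣ} (h : -(c * d) = a * b) : b * d = -(a * c) := by
  revert a b c d
  decide

/-! ### Gluing over the complement of the vertex cones -/

namespace Flag

variable {V : Set E4} (S : Flag V)

/-- A function on pairs of adjacent facets that is locally a coboundary is a coboundary, because the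
complement of the cones over the vertices is simply connected. -/
theorem exists_potential {c : E4 → E4 → ℤˣ}
    (hc : ∀ x ∈ S.offVertices, ∃ F : E4 → ℤˣ,
      ∀ n ∈ act S.N x, ∀ n' ∈ act S.N x, Adj S.N n n' → c n n' = F n * F n') :
    ∃ f : E4 → ℤˣ, ∀ n n', Adj S.N n n' → c n n' = f n * f n' := by
  classical
  choose! F hF using hc
  have hpick : ∀ x, ∃ n, n ∈ act S.N x := fun x => S.act_nonempty' x
  choose pick hpick using hpick
  have hconst : ∀ x ∈ S.offVertices, ∀ y ∈ S.offVertices, act S.N y ⊆ act S.N x →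
      -- Two potentials of the same c differ by a sign constant along adjacency, and the facets
      -- active at y are connected by adjacency.
      ∀ n ∈ act S.N y, ∀ n' ∈ act S.N y, F x n * F y n = F x n' * F y n' := by
    intro x hx y hy hsub n hn n' hn'
    refine S.eq_of_adj (h := fun n => F x n * F y n) hy (fun m hm m' hm' hadj => ?_) hn hn'
    refine units_mul_eq_mul_of_mul_eq_mul ?_
    rw [← hF x hx m (hsub hm) m' (hsub hm') hadj, ← hF y hy m hm m' hm' hadj]
  let τ : S.offVertices → S.offVertices → ℤˣ := fun x y => F x (pick y) * F y (pick y)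
  have hτ : IsSignCocycle τ := by
    intro x
    filter_upwards [S.eventually_act_subset_sub x] with y hxy
    filter_upwards [S.eventually_act_subset_sub y] with z hyz
    have h := hconst x.1 x.2 y.1 y.2 hxy _ (hpick y.1) _ (hyz (hpick z.1))
    change F x _ * F z _ = F x _ * F y _ * (F y _ * F z _)
    rw [h, ← mul_assoc, mul_assoc (F x _), Int.units_mul_self, mul_one]
  have hw : ∀ n n', ∃ w, Adj S.N n n' → act S.N w = {n, n'} := fun n n' => by
    by_cases h : Adj S.N n n'
    · obtain ⟨w, hw⟩ := h.2
      exact ⟨w, fun _ => hw⟩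
    · exact ⟨0, fun h' => absurd h' h⟩
  choose w hw using hw
  -- The finitely many segments from a facet center to a chosen point of an adjacent 2-face; the
  -- extra degenerate one ensures that the set is nonempty.
  let W : Set (E4 × E4) := insert (S.n, S.n)
    ((fun k : E4 × E4 => (k.1, w k.1 k.2)) '' {k | k ∈ S.N ×ˢ S.N ∧ Adj S.N k.1 k.2} ∪
      (fun k : E4 × E4 => (k.2, w k.1 k.2)) '' {k | k ∈ S.N ×ˢ S.N ∧ Adj S.N k.1 k.2})
  have hfin : {k : E4 × E4 | k ∈ S.N ×ˢ S.N ∧ Adj S.N k.1 k.2}.Finite :=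
    (S.N_finite.prod S.N_finite).subset fun k hk => hk.1
  have hW : W.Finite := ((hfin.image _).union (hfin.image _)).insert _
  have hWact : ∀ k ∈ W, k.1 ∈ act S.N k.2 ∧ FewActive S.N k.2 := by
    rintro k (rfl | ⟨k, ⟨-, hk⟩, rfl⟩ | ⟨k, ⟨-, hk⟩, rfl⟩)
    · have := S.act_self S.n_mem
      exact ⟨by rw [this]; rfl, S.n, S.n, by rw [this]; simp⟩
    · exact ⟨by rw [hw _ _ hk]; simp, fewActive_of_eq (hw _ _ hk)⟩
    · exact ⟨by rw [hw _ _ hk]; simp, fewActive_of_eq (hw _ _ hk)⟩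
  obtain ⟨p, hp, hvis⟩ := S.exists_viewpoint hW ⟨_, Set.mem_insert _ _⟩
    (fun k hk z hz => S.segment_facet_few (hWact k hk).2 (hWact k hk).1 hz)
  -- The points visible from p. Contracting along the lines of sight trivializes the cocycle of
  -- local potentials on T.
  let T : Set E4 := {x | segment ℝ p x ⊆ S.offVertices}
  have hseg : ∀ (t : unitInterval) (x : T), p + (t : ℝ) • (x.1 - p) ∈ S.offVertices := fun t x =>
    x.2 (by
      rw [segment_eq_image']
      exact ⟨t, t.2, rfl⟩)
  let H : C(unitInterval × T, S.offVertices) :=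
    ⟨fun z => ⟨p + (z.1 : ℝ) • (z.2.1 - p), hseg z.1 z.2⟩, by
      refine Continuous.subtype_mk ?_ _
      fun_prop⟩
  obtain ⟨s, hs⟩ := hτ.exists_section H ⟨p, hp⟩ (fun a => Subtype.ext (by simp [H]))
  have hT : ∀ x : T, x.1 ∈ S.offVertices := fun x => x.2 (right_mem_segment ℝ p x.1)
  have hH : ∀ x : T, H (1, x) = ⟨x.1, hT x⟩ := fun x => Subtype.ext (by simp [H])
  simp only [hH] at hs
  -- After correction by s, the local potentials of a fixed facet no longer vary along its star.
  -- Evaluating at the facet center gives the global potential, and transport along W compares two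
  -- centers at their common 2-face.
  let E : E4 → T → ℤˣ := fun n x => s x * F x n
  have hE : ∀ n, ∀ z ∈ {x | n ∈ act S.N x}, ∀ h : z ∈ T, ∀ᶠ y in 𝓝 (⟨z, h⟩ : T),
      y.1 ∈ {x | n ∈ act S.N x} → E n y = E n ⟨z, h⟩ := by
    intro n z hz h
    filter_upwards [hs ⟨z, h⟩, S.eventually_act_subset_sub (A := T) ⟨z, h⟩] with y hy hsub hn
    have hn' : n ∈ act S.N y.1 := hn
    have h1 := hconst z (hT ⟨z, h⟩) y.1 (hT y) hsub _ (hpick y.1) _ hn'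
    change s y * F y n = s ⟨z, h⟩ * F z n
    rw [hy]
    change s ⟨z, h⟩ * (F z (pick y.1) * F y.1 (pick y.1)) * F y.1 n = _
    rw [h1, mul_assoc, mul_assoc, Int.units_mul_self, mul_one]
  have hTW : ∀ k ∈ W, ∀ z ∈ segment ℝ k.1 k.2, z ∈ T := hvis
  have hEW : ∀ k (hk : k ∈ W), E k.1 ⟨k.1, hTW k hk _ (left_mem_segment ℝ k.1 k.2)⟩ =
      E k.1 ⟨k.2, hTW k hk _ (right_mem_segment ℝ k.1 k.2)⟩ := fun k hk =>
    eq_of_segment (hE k.1) (fun z hz => ⟨hTW k hk z hz, (S.segment_facet (hWact k hk).1 hz).1⟩) _ _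
  refine ⟨fun n => if h : n ∈ T then E n ⟨n, h⟩ else 1, fun n n' h => ?_⟩
  have hmem : (n, n') ∈ {k : E4 × E4 | k ∈ S.N ×ˢ S.N ∧ Adj S.N k.1 k.2} := ⟨h.mem, h⟩
  have hk : (n, w n n') ∈ W := .inr (.inl ⟨(n, n'), hmem, rfl⟩)
  have hk' : (n', w n n') ∈ W := .inr (.inr ⟨(n, n'), hmem, rfl⟩)
  have e1 := hEW _ hk
  have e2 := hEW _ hk'
  beta_reduce
  rw [dif_pos (hTW _ hk _ (left_mem_segment ℝ n _)), dif_pos (hTW _ hk' _ (left_mem_segment ℝ n' _)),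
    e1, e2]
  change c n n' = s _ * F (w n n') n * (s _ * F (w n n') n')
  rw [mul_mul_mul_comm, Int.units_mul_self, one_mul]
  have hoff := hT ⟨w n n', hTW _ hk _ (right_mem_segment ℝ n _)⟩
  exact hF _ hoff n (by rw [hw _ _ h]; simp) n' (by rw [hw _ _ h]; simp) h

/-- A sign cocycle that is non-trivial around every edge has sections over the stars of the facets
which disagree wherever two of them meet. -/
theorem exists_alternating_section {τ : S.fewSet → S.fewSet → ℤˣ} (hτ : IsSignCocycle τ)
    (hmoeb : ∀ S' : Flag V, S'.N = S.N → ∀ s : S.fewSet → ℤˣ,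
      ∃ x, act S.N x.1 ⊆ act S.N (S'.b 1) ∧
        ¬ ∀ᶠ y in 𝓝 x, act S.N y.1 ⊆ act S.N (S'.b 1) → s y = s x * τ x y) :
    ∃ ε : E4 → S.fewSet → ℤˣ,
      (∀ x, ∀ᶠ y in 𝓝 x, ∀ n ∈ act S.N y.1, ε n y = ε n x * τ x y) ∧
      ∀ x : S.fewSet, ∀ n ∈ act S.N x.1, ∀ n' ∈ act S.N x.1, n ≠ n' → ε n' x = -ε n x := by
  classical
  choose σ hσ using S.exists_star_section hτ
  -- The minus sign turns a coboundary of c into orientations that disagree across 2-faces.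
  let c : E4 → E4 → ℤˣ := fun n n' =>
    if h : ∃ x : S.fewSet, act S.N x.1 = {n, n'} then -(σ n h.choose * σ n' h.choose) else 1
  have hc : ∀ n n' (x : S.fewSet), n ≠ n' → act S.N x.1 = {n, n'} →
      c n n' = -(σ n x * σ n' x) := by
    intro n n' x _ hx
    have h : ∃ x : S.fewSet, act S.N x.1 = {n, n'} := ⟨x, hx⟩
    rw [← S.star_section_ratio hσ h.choose_spec hx]
    exact dif_pos h
  have hsymm : ∀ n n', c n n' = c n' n := by
    intro n n'
    rcases eq_or_ne n n' with rfl | hne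
    · rfl
    by_cases h : ∃ x : S.fewSet, act S.N x.1 = {n, n'}
    · obtain ⟨x, hx⟩ := h
      rw [hc n n' x hne hx, hc n' n x hne.symm (hx.trans (Set.pair_comm n n')), mul_comm]
    · have h' : ¬ ∃ x : S.fewSet, act S.N x.1 = {n', n} := by rwa [Set.pair_comm]
      exact (show c n n' = 1 from dif_neg h).trans (show c n' n = 1 from dif_neg h').symm
  obtain ⟨f, hf⟩ := S.exists_potential fun x hx => S.exists_local_potential hσ hsymm hc hmoeb hx
  refine ⟨fun n x => f n * σ n x, fun x => ?_, fun x n hn n' hn' hne => ?_⟩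
  · have h : ∀ᶠ z in 𝓝 x, ∀ n ∈ S.N, n ∈ act S.N x.1 → n ∈ act S.N z.1 →
        σ n z = σ n x * τ x z := by
      rw [Filter.eventually_all_finite S.N_finite]
      intro n _
      by_cases hny : n ∈ act S.N x.1
      · filter_upwards [hσ n x hny] with z hz _ using hz
      · exact Eventually.of_forall fun z h => absurd h hny
    filter_upwards [h, S.eventually_act_subset_sub x] with y hy hsub n hn
    rw [hy n hn.1 (hsub hn) hn, mul_assoc]
  · have h1 := FewActive.act_eq x.2 hn hn' hne
    have h2 := hf n n' ⟨hne, x.1, h1⟩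
    rw [hc n n' x hne h1] at h2
    exact units_mul_eq_neg_mul h2

/-- Locally constant functions on the set of points with few active facets are constant. -/
theorem eq_of_locally_constant {β : Type*} {f : S.fewSet → β}
    (hf : ∀ x, ∀ᶠ y in 𝓝 x, f y = f x) (x y : S.fewSet) : f x = f y := by
  classical
  have hself : ∀ n ∈ S.N, n ∈ S.fewSet := fun n hn => ⟨n, n, by rw [S.act_self hn]; simp⟩
  have hstar : ∀ (x : S.fewSet) n (hn : n ∈ act S.N x.1), f ⟨n, hself n hn.1⟩ = f x := by
    intro x n hn
    exact eq_of_segment (A := S.fewSet) (K := Set.univ) (fun z _ h => (hf ⟨z, h⟩).mono fun w hw _ => hw)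
      (fun z hz => ⟨S.segment_facet_few x.2 hn hz, trivial⟩) (hself n hn.1) x.2
  -- Each star is connected, so f descends to a function on facets that is constant along adjacency.
  let g : E4 → β := fun n => if h : n ∈ S.N then f ⟨n, hself n h⟩ else f x
  have hg : ∀ n (h : n ∈ S.N), g n = f ⟨n, hself n h⟩ := fun n h => dif_pos h
  have hadj : ∀ n n', Adj S.N n n' → g n = g n' := by
    rintro n n' h
    obtain ⟨w, hw⟩ := h.2
    have hw' : w ∈ S.fewSet := fewActive_of_eq hw
    rw [hg n h.mem.1, hg n' h.mem.2, hstar ⟨w, hw'⟩ n (by rw [hw]; simp),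
      hstar ⟨w, hw'⟩ n' (by rw [hw]; simp)]
  have hpick : ∀ x, ∃ n, n ∈ act S.N x := fun x => S.act_nonempty' x
  choose pick hpick using hpick
  -- From a generic p every facet center is visible. Along a line of sight the value on active
  -- facets is locally constant, since active facets are connected by adjacency.
  obtain ⟨p, hp, hvis⟩ := S.exists_viewpoint (W := (fun n => (n, n)) '' S.N) (S.N_finite.image _)
    ⟨_, S.n, S.n_mem, rfl⟩ (by
      rintro _ ⟨n, hn, rfl⟩ z hz
      rw [segment_same] at hz
      rw [hz]
      exact hself n hn)
  have hN : ∀ n ∈ S.N, g (pick n) = g (pick p) := by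
    intro n hn
    have hseg := hvis (n, n) ⟨n, hn, rfl⟩ n (left_mem_segment ℝ n n)
    refine (eq_of_segment (A := S.offVertices) (K := Set.univ) (f := fun x => g (pick x.1)) ?_
      (fun z hz => ⟨hseg hz, trivial⟩) hp (hseg (right_mem_segment ℝ p n))).symm
    intro z _ h
    filter_upwards [S.eventually_act_subset_sub (A := S.offVertices) ⟨z, h⟩] with w hw _
    exact S.eq_of_adj h (fun n _ n' _ => hadj n n') (hw (hpick _)) (hpick _)
  have hall : ∀ x : S.fewSet, f x = g (pick p) := by
    intro x
    have h := hpick x.1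
    rw [← hstar x _ h, ← hg _ h.1, ← hN _ h.1]
    congr 1
    have := hpick (pick x.1)
    rw [S.act_self h.1] at this
    exact this.symm
  rw [hall x, hall y]

end Flag

end RegularPolytope

namespace RegularPolytope

open Filter Topology Bundle

/-! ### Signed bundle maps -/

section FiberMap

variable {B : Type*} [TopologicalSpace B] {I : B → Type*}
  [TopologicalSpace (TotalSpace ℝ I)]
  [∀ x, NormedAddCommGroup (I x)] [∀ x, InnerProductSpace ℝ (I x)]
  [FiberBundle ℝ I] [VectorBundle ℝ ℝ I]

theorem inner_unitVec_smul (x : B) (c : ℝ) : inner ℝ (unitVec I x) (c • unitVec I x) = c := by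
  rw [inner_smul_right, real_inner_self_eq_norm_sq, norm_unitVec]; simp

variable (I) in
/-- The bundle map over `f` that maps the distinguished unit vector at `x` to `κ x` times the one
at `f x`. -/
noncomputable def fiberMap (f : B → B) (κ : B → ℤˣ) (p : TotalSpace ℝ I) : TotalSpace ℝ I :=
  ⟨f p.1, (sgn (κ p.1) * inner ℝ (unitVec I p.1) p.2) • unitVec I (f p.1)⟩

theorem fiberMap_comp (f g : B → B) (κ μ : B → ℤˣ) (p : TotalSpace ℝ I) :
    fiberMap I f κ (fiberMap I g μ p) = fiberMap I (f ∘ g) (fun x => κ (g x) * μ x) p := by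
  change (⟨f (g p.1), (sgn (κ (g p.1)) * inner ℝ (unitVec I (g p.1))
    ((sgn (μ p.1) * inner ℝ (unitVec I p.1) p.2) • unitVec I (g p.1))) • unitVec I (f (g p.1))⟩ :
      TotalSpace ℝ I) = _
  rw [inner_unitVec_smul, ← mul_assoc, ← sgn_mul]
  rfl

theorem fiberMap_id (u : ℤˣ) (x : B) (v : I x) :
    fiberMap I id (fun _ => u) ⟨x, v⟩ = ⟨x, sgn u • v⟩ := by
  change (⟨x, (sgn u * inner ℝ (unitVec I x) v) • unitVec I x⟩ : TotalSpace ℝ I) = _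
  rw [mul_smul, ← eq_inner_smul_unitVec v]

theorem fiberMap_id_one (p : TotalSpace ℝ I) : fiberMap I id (fun _ => 1) p = p := by
  obtain ⟨x, v⟩ := p
  rw [fiberMap_id, sgn_one, one_smul]

/-- The isometry of fibers that underlies a signed bundle map. -/
noncomputable def fiberIsometry (u : ℤˣ) (x y : B) : I x ≃ₗᵢ[ℝ] I y where
  toFun v := (sgn u * inner ℝ (unitVec I x) v) • unitVec I y
  invFun v := (sgn u * inner ℝ (unitVec I y) v) • unitVec I x
  map_add' v w := by rw [inner_add_right, mul_add, add_smul]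
  map_smul' c v := by rw [inner_smul_right, mul_left_comm, mul_smul, RingHom.id_apply]
  left_inv v := by
    beta_reduce
    rw [inner_unitVec_smul, ← mul_assoc, sgn_mul_self, one_mul, ← eq_inner_smul_unitVec]
  right_inv v := by
    beta_reduce
    rw [inner_unitVec_smul, ← mul_assoc, sgn_mul_self, one_mul, ← eq_inner_smul_unitVec]
  norm_map' v := by
    change ‖(sgn u * inner ℝ (unitVec I x) v) • unitVec I y‖ = ‖v‖
    conv_rhs => rw [eq_inner_smul_unitVec v]
    simp only [norm_smul, norm_unitVec, norm_mul, Real.norm_eq_abs, abs_sgn, one_mul]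

theorem exists_sign_of_isometry {x : B} (L : I x ≃ₗᵢ[ℝ] I x) : ∃ u : ℤˣ, ∀ v, L v = sgn u • v := by
  obtain ⟨c, hc⟩ := exists_eq_smul_of_norm_eq_one (norm_unitVec (I := I) x) (L (unitVec I x))
  have hc1 : |c| = 1 := by
    have := congrArg norm hc
    rwa [L.norm_map, norm_smul, norm_unitVec, mul_one, Real.norm_eq_abs, eq_comm] at this
  have key : ∀ v, L v = c • v := fun v => by
    rw [eq_inner_smul_unitVec v, map_smul, hc, smul_comm]
  rcases eq_or_eq_neg_of_abs_eq hc1 with rfl | rfl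
  · exact ⟨1, fun v => by rw [key, sgn_one]⟩
  · exact ⟨-1, fun v => by rw [key, sgn_neg_one]⟩

/-- Two inverse signed bundle maps form a homeomorphism of the total space. -/
noncomputable def fiberHomeomorph [IsContinuousRiemannianBundle ℝ I] (f g : B → B) (κ μ : B → ℤˣ)
    (hf : Continuous f) (hg : Continuous g)
    (hκ : ∀ x, ∀ᶠ y in 𝓝 x, κ y = κ x * (bundleSign I x y * bundleSign I (f x) (f y)))
    (hμ : ∀ x, ∀ᶠ y in 𝓝 x, μ y = μ x * (bundleSign I x y * bundleSign I (g x) (g y)))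
    (hfg : f ∘ g = id) (hgf : g ∘ f = id) (hκμ : ∀ x, κ (g x) * μ x = 1)
    (hμκ : ∀ x, μ (f x) * κ x = 1) : TotalSpace ℝ I ≃ₜ TotalSpace ℝ I where
  toFun := fiberMap I f κ
  invFun := fiberMap I g μ
  left_inv p := by
    rw [fiberMap_comp, funext hμκ, hgf]
    exact fiberMap_id_one p
  right_inv p := by
    rw [fiberMap_comp, funext hκμ, hfg]
    exact fiberMap_id_one p
  continuous_toFun := continuous_sgn_inner_smul hf hκ
  continuous_invFun := continuous_sgn_inner_smul hg hμ

variable [IsContinuousRiemannianBundle ℝ I]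

/-- The signs of a continuous bundle automorphism over the identity are locally constant. -/
theorem eventually_eq_of_continuous {F : TotalSpace ℝ I → TotalSpace ℝ I} (hF : Continuous F)
    {l : B → ℤˣ} (hl : ∀ x v, F ⟨x, v⟩ = ⟨x, sgn (l x) • v⟩) (x : B) : ∀ᶠ y in 𝓝 x, l y = l x := by
  have h1 := (eventually_continuousAt_bundleSign (I := I) x).self_of_nhds
  have h2 : ContinuousAt (fun y => (⟨y, sgn (l y) • sgn (bundleSign I x y) • unitVec I y⟩ :
      TotalSpace ℝ I)) x := by
    have := hF.continuousAt.comp h1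
    refine this.congr (Eventually.of_forall fun y => ?_)
    exact hl y _
  have h3 := h1.inner_bundle h2
  refine eventually_eq_of_sgn (h3.congr (Eventually.of_forall fun y => ?_))
  change inner ℝ (sgn (bundleSign I x y) • unitVec I y)
    (sgn (l y) • sgn (bundleSign I x y) • unitVec I y) = sgn (l y)
  rw [inner_smul_left, inner_smul_right, inner_unitVec_smul, conj_trivial, mul_left_comm,
    sgn_mul_self, mul_one]

end FiberMap

end RegularPolytope

namespace RegularPolytope

open Filter Topology Bundle

/-! ### Alternating orientations and the signs of the lift -/

namespace Flag

variable {V : Set E4} (S : Flag V)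

/-- By the strict Cauchy–Schwarz inequality, a point of the circumscribed sphere outside V is
strictly separated from the hull. Hence isometries preserving the polytope preserve V. -/
theorem mem_of_norm_eq {x : E4} (hx : x ∈ convexHull ℝ V) (hn : ‖x‖ = ‖S.b 0‖) : x ∈ V := by
  by_contra hxV
  have h : V ⊆ {y | inner ℝ x y < ‖S.b 0‖ ^ 2} := by
    intro v hv
    have hv1 := S.norm_eq v hv
    have h0 : ‖S.b 0‖ ≠ 0 := norm_ne_zero_iff.2 (S.b_ne_zero 0)
    have := (inner_lt_norm_mul_iff_real (x := x) (y := v)).2 fun h => by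
      rw [hv1, hn] at h
      exact hxV (smul_right_injective E4 h0 h ▸ hv)
    rwa [hv1, hn, ← sq] at this
  have hconv : Convex ℝ {y : E4 | inner ℝ x y < ‖S.b 0‖ ^ 2} :=
    convex_halfSpace_lt (innerSL ℝ x).isLinear _
  have h1 : inner ℝ x x < ‖S.b 0‖ ^ 2 := convexHull_min h hconv hx
  rw [real_inner_self_eq_norm_sq, hn] at h1
  exact h1.false

theorem isSymm_of_mem {V : Set E4} (S : Flag V) (g : rotationGroup (convexHull ℝ V)) : IsSymm V g.1 := by
  have key : ∀ g : rotationGroup (convexHull ℝ V), ∀ v ∈ V, g.1 v ∈ V := by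
    intro g v hv
    refine S.mem_of_norm_eq ?_ ?_
    · exact g.2.2.subset (Set.mem_image_of_mem _ (subset_convexHull ℝ V hv))
    · rw [g.1.norm_map, S.norm_eq v hv]
  refine Set.Subset.antisymm ?_ fun v hv => ⟨_, key g⁻¹ v hv, ?_⟩
  · rintro _ ⟨v, hv, rfl⟩
    exact key g v hv
  · exact g.1.apply_symm_apply v

/-- The radial projection to the complement of the graph. -/
noncomputable def proj (v : S.fewSet) : graphCompl (convexHull ℝ V) :=
  ⟨‖v.1‖⁻¹ • v.1, by
    have h0 : v.1 ≠ 0 := fun h => S.not_fewActive_zero (h ▸ v.2)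
    refine S.mem_graphCompl_iff.2 ⟨?_, FewActive.smul (inv_pos.2 (norm_pos_iff.2 h0)) v.2⟩
    rw [norm_smul, norm_inv, norm_norm, inv_mul_cancel₀ (norm_ne_zero_iff.2 h0)]⟩

theorem continuous_proj : Continuous S.proj := by
  refine Continuous.subtype_mk ?_ _
  have h : Continuous fun v : S.fewSet => ‖v.1‖ := by fun_prop
  refine Continuous.smul (h.inv₀ fun v h => ?_) continuous_subtype_val
  exact S.not_fewActive_zero (norm_eq_zero.1 h ▸ v.2)

/-- The inclusion of the complement of the graph. -/
def incl (x : graphCompl (convexHull ℝ V)) : S.fewSet := ⟨x.1, (S.mem_graphCompl_iff.1 x.2).2⟩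

theorem continuous_incl : Continuous S.incl := by
  unfold incl
  fun_prop

theorem proj_incl (x : graphCompl (convexHull ℝ V)) : S.proj (S.incl x) = x := by
  refine Subtype.ext ?_
  change ‖x.1‖⁻¹ • x.1 = x.1
  rw [(S.mem_graphCompl_iff.1 x.2).1, inv_one, one_smul]

theorem eq_of_eventually_eq_graphCompl {V : Set E4} (S : Flag V) {β : Type*} {f : graphCompl (convexHull ℝ V) → β}
    (hf : ∀ x, ∀ᶠ y in 𝓝 x, f y = f x) (x y : graphCompl (convexHull ℝ V)) : f x = f y := by
  have h := S.eq_of_locally_constant (f := f ∘ S.proj)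
    (fun x => S.continuous_proj.continuousAt.eventually (hf (S.proj x))) (S.incl x) (S.incl y)
  rwa [Function.comp, Function.comp, S.proj_incl, S.proj_incl] at h

variable {I : graphCompl (convexHull ℝ V) → Type*} [TopologicalSpace (TotalSpace ℝ I)]
  [∀ x, NormedAddCommGroup (I x)] [∀ x, InnerProductSpace ℝ (I x)]
  [FiberBundle ℝ I] [VectorBundle ℝ ℝ I] [IsContinuousRiemannianBundle ℝ I]

/-- A line bundle that is Möbius on the linking circles has orientations over the stars of the
facets which disagree wherever two of them meet. -/
theorem exists_alternating_orientation (hI : IsMoebiusOnLinkingCircles I) :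
    ∃ ε : E4 → graphCompl (convexHull ℝ V) → ℤˣ,
      (∀ x, ∀ᶠ y in 𝓝 x, act S.N y.1 ⊆ act S.N x.1 ∧
        ∀ n ∈ act S.N y.1, ε n y = ε n x * bundleSign I x y) ∧
      ∀ x : graphCompl (convexHull ℝ V), ∀ n ∈ act S.N x.1, ∀ n' ∈ act S.N x.1, n ≠ n' →
        ε n' x = -ε n x := by
  -- Pulling back along the radial projection allows straight segments in place of spherical arcs.
  let τ : S.fewSet → S.fewSet → ℤˣ := fun v w => bundleSign I (S.proj v) (S.proj w)
  have hτ : IsSignCocycle τ := by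
    intro v
    have h := S.continuous_proj.continuousAt.eventually (isSignCocycle_bundleSign (I := I) (S.proj v))
    filter_upwards [h] with w hw
    exact S.continuous_proj.continuousAt.eventually hw
  obtain ⟨ε, h1, h2⟩ := S.exists_alternating_section hτ fun S' hN s => by
    -- Signs following the cocycle around an edge would give a nowhere vanishing section over a
    -- small linking circle of that edge.
    by_contra! hcon
    obtain ⟨C, hC, hC'⟩ := S'.exists_isLinkingCircle
    rw [hN] at hC'
    have himg : Subtype.val '' (Subtype.val ⁻¹' C : Set (graphCompl (convexHull ℝ V))) = C := by
      rw [Subtype.image_preimage_coe]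
      exact Set.inter_eq_self_of_subset_right fun x hx => (hC' x hx).1
    refine hI (Subtype.val ⁻¹' C) (by rwa [himg])
      ⟨fun x => sgn (s (S.incl x)) • unitVec I x, fun x hx => ?_, fun x _ h => ?_⟩
    · refine continuousWithinAt_sgn_smul_unitVec (s := fun x => s (S.incl x)) ?_
      have h := S.continuous_incl.continuousAt.eventually (hcon (S.incl x) (hC' x.1 hx).2)
      filter_upwards [h.filter_mono nhdsWithin_le_nhds, self_mem_nhdsWithin] with y hy hyC
      rw [hy (hC' y.1 hyC).2]
      simp only [τ, S.proj_incl]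
    · have := congrArg norm h
      rw [norm_smul, norm_unitVec, norm_zero, mul_one, Real.norm_eq_abs, abs_sgn] at this
      exact one_ne_zero this
  refine ⟨fun n x => ε n (S.incl x), fun x => ?_, fun x => h2 (S.incl x)⟩
  filter_upwards [S.continuous_incl.continuousAt.eventually (h1 (S.incl x)),
    S.eventually_act_subset_sub x] with y hy hsub
  refine ⟨hsub, fun n hn => ?_⟩
  rw [hy n hn]
  simp only [τ, S.proj_incl]

/-- The signs of a lift of the action of the rotation group. -/
theorem exists_lift_signs (S : Flag V) (hI : IsMoebiusOnLinkingCircles I) :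
    ∃ κ : rotationGroup (convexHull ℝ V) → graphCompl (convexHull ℝ V) → ℤˣ,
      (∀ x, κ 1 x = 1) ∧ (∀ g h x, κ (g * h) x = κ g (h • x) * κ h x) ∧
      ∀ g x, ∀ᶠ y in 𝓝 x,
        κ g y = κ g x * (bundleSign I x y * bundleSign I (g • x) (g • y)) := by
  obtain ⟨ε, h1, h2⟩ := S.exists_alternating_orientation hI
  have hpick : ∀ x, ∃ n, n ∈ act S.N x := fun x => S.act_nonempty' x
  choose pick hpick using hpick
  have hmap : ∀ (g : rotationGroup (convexHull ℝ V)) {x n}, n ∈ act S.N x →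
      g.1 n ∈ act S.N (g.1 x) := fun g _ _ hn => (mem_act_map_iff S (S.isSymm_of_mem g)).2 hn
  -- The lift of g carries the orientation of a facet n at x to that of g n at g x.
  let κ : rotationGroup (convexHull ℝ V) → graphCompl (convexHull ℝ V) → ℤˣ :=
    fun g x => ε (pick x.1) x * ε (g.1 (pick x.1)) (g • x)
  have hκ : ∀ g x, ∀ n ∈ act S.N x.1, κ g x = ε n x * ε (g.1 n) (g • x) := by
    intro g x n hn
    rcases eq_or_ne n (pick x.1) with rfl | hne
    · rfl
    · change ε (pick x.1) x * ε (g.1 (pick x.1)) (g • x) = _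
      -- Changing the facet flips both orientations, so the product is unchanged.
      rw [h2 x n hn _ (hpick x.1) hne,
        h2 (g • x) (g.1 n) (hmap g hn) _ (hmap g (hpick x.1)) fun h => hne (g.1.injective h), neg_mul_neg]
  refine ⟨κ, fun x => ?_, fun g h x => ?_, fun g x => ?_⟩
  · exact Int.units_mul_self _
  -- Computed with the facets n, h n and g h n, the intermediate orientation occurs twice and
  -- cancels.
  · rw [hκ h x _ (hpick x.1), hκ g (h • x) _ (hmap h (hpick x.1)), hκ (g * h) x _ (hpick x.1),
      mul_comm (ε _ x) (ε (h.1 _) _), mul_mul_mul_comm, Int.units_mul_self, one_mul, mul_comm]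
    rfl
  · have hcont : Continuous fun x : graphCompl (convexHull ℝ V) => g • x :=
      Continuous.subtype_mk (g.1.continuous.comp continuous_subtype_val) _
    filter_upwards [h1 x, hcont.continuousAt.eventually (h1 (g • x))] with y hy hgy
    have hn := hpick y.1
    rw [hκ g y _ hn, hκ g x _ (hy.1 hn), hy.2 _ hn, hgy.2 _ (hmap g hn)]
    exact mul_mul_mul_comm _ _ _ _

end Flag

end RegularPolytope

namespace RegularPolytope

open Filter Topology Bundle

/-! ### The lifted action and the central extension -/

namespace Flag

variable {V : Set E4}
  {I : graphCompl (convexHull ℝ V) → Type*} [TopologicalSpace (TotalSpace ℝ I)]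
  [∀ x, NormedAddCommGroup (I x)] [∀ x, InnerProductSpace ℝ (I x)]
  [FiberBundle ℝ I] [VectorBundle ℝ ℝ I] [IsContinuousRiemannianBundle ℝ I]

/-- The action of the rotation group lifts to the line bundle. -/
theorem exists_lift (S : Flag V) (hI : IsMoebiusOnLinkingCircles I) :
    ∃ ρ : rotationGroup (convexHull ℝ V) →* (TotalSpace ℝ I ≃ₜ TotalSpace ℝ I),
      ∀ g, IsLift g (ρ g) := by
  obtain ⟨κ, h1, hmul, hκ⟩ := S.exists_lift_signs hI
  have hcont : ∀ g : rotationGroup (convexHull ℝ V),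
      Continuous fun x : graphCompl (convexHull ℝ V) => g • x := fun g =>
    Continuous.subtype_mk (g.1.continuous.comp continuous_subtype_val) _
  let ρ : rotationGroup (convexHull ℝ V) → (TotalSpace ℝ I ≃ₜ TotalSpace ℝ I) := fun g =>
    fiberHomeomorph (g • ·) (g⁻¹ • ·) (κ g) (κ g⁻¹) (hcont g) (hcont g⁻¹) (hκ g) (hκ g⁻¹)
      (funext fun x => smul_inv_smul g x) (funext fun x => inv_smul_smul g x)
      (fun x => by rw [← hmul, mul_inv_cancel, h1]) (fun x => by rw [← hmul, inv_mul_cancel, h1])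
  have hρ : ∀ g p, ρ g p = fiberMap I (g • ·) (κ g) p := fun _ _ => rfl
  refine ⟨⟨⟨ρ, Homeomorph.ext fun p => ?_⟩, fun g h => Homeomorph.ext fun p => ?_⟩, fun g x => ?_⟩
  · rw [hρ, funext h1]
    exact fiberMap_id_one p
  · change ρ (g * h) p = ρ g (ρ h p)
    rw [hρ, hρ, hρ, fiberMap_comp, funext (hmul g h)]
    rfl
  · exact ⟨fiberIsometry (κ g x) x (g • x), fun _ => rfl⟩

variable (I) in
/-- Multiplication by a sign, as a lift of the identity. -/
noncomputable def signLift : ℤˣ →* liftGroup I where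
  toFun u := ⟨(1, fiberHomeomorph id id (fun _ => u) (fun _ => u) continuous_id continuous_id
      (fun _ => Eventually.of_forall fun _ => by rw [id, id, Int.units_mul_self, mul_one])
      (fun _ => Eventually.of_forall fun _ => by rw [id, id, Int.units_mul_self, mul_one])
      rfl rfl (fun _ => Int.units_mul_self u) (fun _ => Int.units_mul_self u)),
    fun x => ⟨fiberIsometry u x x, fun _ => rfl⟩⟩
  map_one' := Subtype.ext (Prod.ext rfl (Homeomorph.ext fiberMap_id_one))
  map_mul' u v := Subtype.ext (Prod.ext (one_mul 1).symm
    (Homeomorph.ext fun p => (fiberMap_comp id id (fun _ => u) (fun _ => v) p).symm))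

theorem signLift_apply (u : ℤˣ) (x : graphCompl (convexHull ℝ V)) (v : I x) :
    (signLift I u).1.2 ⟨x, v⟩ = ⟨x, sgn u • v⟩ := fiberMap_id u x v

theorem signLift_injective (S : Flag V) : Function.Injective (signLift I) := by
  have hn : S.n ∈ S.fewSet := ⟨S.n, S.n, by rw [S.act_self S.n_mem]; simp⟩
  let x := S.proj ⟨S.n, hn⟩
  intro u v huv
  have h := congrArg (fun F : liftGroup I => F.1.2 ⟨x, unitVec I x⟩) huv
  simp only [signLift_apply, TotalSpace.mk.injEq, heq_eq_eq, true_and] at h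
  have h2 := congrArg (inner ℝ (unitVec I x)) h
  rw [inner_unitVec_smul, inner_unitVec_smul] at h2
  exact sgn_injective h2

/-- An isometry of a line is a sign; by continuity it is locally constant in the base point, and the
complement of the graph is connected. -/
theorem range_signLift (S : Flag V) : (signLift I).range = (liftProj I).ker := by
  ext F
  constructor
  · rintro ⟨u, rfl⟩
    rfl
  · obtain ⟨⟨g, F⟩, hF⟩ := F
    intro hg
    obtain rfl : g = 1 := hg
    have hF' : ∀ x : graphCompl (convexHull ℝ V), ∃ u : ℤˣ, ∀ v : I x, F ⟨x, v⟩ = ⟨x, sgn u • v⟩ := by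
      intro x
      obtain ⟨L, hL⟩ := hF x
      obtain ⟨u, hu⟩ := exists_sign_of_isometry (I := I) (x := x) L
      exact ⟨u, fun v => (hL v).trans (congrArg (TotalSpace.mk x) (hu v))⟩
    choose l hl using hF'
    have hconst := S.eq_of_eventually_eq_graphCompl
      (eventually_eq_of_continuous (I := I) F.continuous hl)
    have hn : S.n ∈ S.fewSet := ⟨S.n, S.n, by rw [S.act_self S.n_mem]; simp⟩
    refine ⟨l (S.proj ⟨S.n, hn⟩), Subtype.ext (Prod.ext rfl (Homeomorph.ext ?_))⟩
    rintro ⟨x, v⟩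
    rw [signLift_apply]
    change _ = F ⟨x, v⟩
    rw [hl, hconst x]

theorem range_signLift_le_center : (signLift I).range ≤ Subgroup.center (liftGroup I) := by
  rintro _ ⟨u, rfl⟩
  rw [Subgroup.mem_center_iff]
  rintro ⟨⟨g, F⟩, hF⟩
  refine Subtype.ext (Prod.ext ((mul_one g).trans (one_mul g).symm) (Homeomorph.ext ?_))
  rintro ⟨x, v⟩
  obtain ⟨L, hL⟩ := hF x
  change F ((signLift I u).1.2 ⟨x, v⟩) = (signLift I u).1.2 (F ⟨x, v⟩)
  have hL' : ∀ v, F ⟨x, v⟩ = ⟨g • x, L v⟩ := hL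
  rw [signLift_apply, hL', hL', signLift_apply, map_smul]

/-- The lifts of the rotation group form a split central extension. -/
theorem exists_split_extension (S : Flag V) (hI : IsMoebiusOnLinkingCircles I) :
    ∃ E : GroupExtension ℤˣ (liftGroup I) (rotationGroup (convexHull ℝ V)),
      E.rightHom = liftProj I ∧
      (∀ (x : graphCompl (convexHull ℝ V)) (v : I x), (E.inl (-1)).1.2 ⟨x, v⟩ = ⟨x, -v⟩) ∧
      E.inl.range ≤ Subgroup.center (liftGroup I) ∧
      Nonempty E.Splitting := by
  obtain ⟨ρ, hρ⟩ := S.exists_lift hI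
  let s : rotationGroup (convexHull ℝ V) →* liftGroup I :=
    { toFun := fun g => ⟨(g, ρ g), hρ g⟩
      map_one' := Subtype.ext (Prod.ext rfl (map_one ρ))
      map_mul' := fun g h => Subtype.ext (Prod.ext rfl (map_mul ρ g h)) }
  refine ⟨⟨signLift I, liftProj I, signLift_injective S, range_signLift S, fun g => ⟨s g, rfl⟩⟩, rfl,
    fun x v => ?_, range_signLift_le_center, ⟨⟨s, fun _ => rfl⟩⟩⟩
  change (signLift I (-1)).1.2 ⟨x, v⟩ = _
  rw [signLift_apply, sgn_neg_one, neg_one_smul]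

end Flag

/-! ### Flags of the five regular polytopes -/

theorem inner_E4 (x y : E4) : inner ℝ x y = x 0 * y 0 + x 1 * y 1 + x 2 * y 2 + x 3 * y 3 := by
  rw [PiLp.inner_apply, Fin.sum_univ_four]
  simp only [RCLike.inner_apply, conj_trivial]
  ring

theorem norm_sq_E4 (x : E4) : ‖x‖ ^ 2 = x 0 ^ 2 + x 1 ^ 2 + x 2 ^ 2 + x 3 ^ 2 := by
  rw [← real_inner_self_eq_norm_sq, inner_E4]
  ring

theorem ext_E4 {x y : E4} (h0 : x 0 = y 0) (h1 : x 1 = y 1) (h2 : x 2 = y 2) (h3 : x 3 = y 3) :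
    x = y := by
  ext i
  fin_cases i <;> assumption

theorem midpoint_mem_convexHull {V : Set E4} {x y z : E4} (hx : x ∈ convexHull ℝ V)
    (hy : y ∈ convexHull ℝ V) (h : z = (1 / 2 : ℝ) • (x + y)) : z ∈ convexHull ℝ V := by
  rw [h, smul_add]
  exact convex_convexHull ℝ V hx hy (by norm_num) (by norm_num) (by norm_num)

theorem mem_convexHull_of_sum_eq {V : Set E4} {ι : Type*} [Fintype ι] [Nonempty ι] {f : ι → E4}
    (hf : ∀ i, f i ∈ V) {z : E4} (h : (Fintype.card ι : ℝ) • z = ∑ i, f i) :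
    z ∈ convexHull ℝ V := by
  have hc : (Fintype.card ι : ℝ) ≠ 0 := Nat.cast_ne_zero.2 Fintype.card_ne_zero
  have : z = ∑ i, (Fintype.card ι : ℝ)⁻¹ • f i := by
    rw [← Finset.smul_sum, ← h, smul_smul, inv_mul_cancel₀ hc, one_smul]
  rw [this]
  refine (convex_convexHull ℝ V).sum_mem (fun _ _ => by positivity) ?_
    fun i _ => subset_convexHull ℝ V (hf i)
  rw [Finset.sum_const, Finset.card_univ, nsmul_eq_mul, mul_inv_cancel₀ hc]

theorem refl_sub_left {u v : E4} (h : ‖u‖ = ‖v‖) : refl (u - v) u = v := by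
  rcases eq_or_ne u v with rfl | hne
  · exact refl_eq_self (by simp)
  have h0 : inner ℝ (u - v) (u - v) ≠ (0 : ℝ) := inner_self_ne_zero.2 (sub_ne_zero.2 hne)
  have h1 : 2 * inner ℝ (u - v) u = (inner ℝ (u - v) (u - v) : ℝ) := by
    rw [inner_sub_right, inner_sub_left, inner_sub_left, real_inner_self_eq_norm_sq,
      real_inner_self_eq_norm_sq, h, real_inner_comm u v]
    ring
  rw [refl_apply, h1, div_self h0, one_smul, sub_sub_cancel]

theorem norm_simplex {v : Fin 5 → E4}
    (hv : ∀ i j, inner ℝ (v i) (v j) = if i = j then (1 : ℝ) else -1 / 4) (i : Fin 5) :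
    ‖v i‖ = 1 := by
  rw [norm_eq_sqrt_real_inner, hv, if_pos rfl, Real.sqrt_one]

/-- The flag of a regular simplex. -/
noncomputable def simplexFlag (v : Fin 5 → E4)
    (hv : ∀ i j, inner ℝ (v i) (v j) = if i = j then (1 : ℝ) else -1 / 4)
    (hsum : ∑ i, v i = 0) : Flag (Set.range v) where
  -- The reflections are the adjacent transpositions of the vertices.
  α i := v i.castSucc - v i.succ
  b := ![v 0, (1 / 2 : ℝ) • (v 0 + v 1), (1 / 3 : ℝ) • (v 0 + v 1 + v 2),
    (1 / 4 : ℝ) • (v 0 + v 1 + v 2 + v 3)]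
  -- The facet is opposite `v 4`, whose inner product with its vertices is -1/4.
  n := (-4 : ℝ) • v 4
  q := 1
  finite := Set.finite_range v
  norm_eq := by
    rintro _ ⟨i, rfl⟩
    exact (norm_simplex hv i).trans (norm_simplex hv 0).symm
  b_zero_mem := ⟨0, rfl⟩
  refl_mem := by
    rintro i _ ⟨j, rfl⟩
    rcases eq_or_ne j i.castSucc with rfl | h1
    · exact ⟨i.succ, (refl_sub_left ((norm_simplex hv _).trans (norm_simplex hv _).symm)).symm⟩
    rcases eq_or_ne j i.succ with rfl | h2
    · refine ⟨i.castSucc, ?_⟩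
      nth_rw 1 [← refl_refl (v i.castSucc - v i.succ) (v i.castSucc)]
      rw [refl_sub_left ((norm_simplex hv _).trans (norm_simplex hv _).symm)]
    · refine ⟨j, (refl_eq_self ?_).symm⟩
      rw [inner_sub_left, hv, hv, if_neg h1.symm, if_neg h2.symm, sub_self]
  inner_ne i j hij := by
    fin_cases i <;> fin_cases j <;> first
      | exact absurd rfl hij
      | (simp [inner_sub_left, inner_add_right, inner_smul_right, hv, norm_simplex hv]; try norm_num)
  inner_pos i := by
    fin_cases i <;> (simp [inner_sub_left, inner_add_right, inner_smul_right, hv, norm_simplex hv]; try norm_num)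
  b_mem i := by
    refine mem_convexHull_of_sum_eq (f := fun j : Fin (i + 1) => v (j.castLE (by omega)))
      (fun j => Set.mem_range_self _) ?_
    fin_cases i <;> simp [Fin.sum_univ_succ] <;> module
  zero_mem := mem_convexHull_of_sum_eq (f := v) Set.mem_range_self (by rw [hsum, smul_zero])
  b_one := by
    change _ = (1 / 2 : ℝ) • (v 0 + refl (v 0 - v 1) (v 0))
    rw [refl_sub_left ((norm_simplex hv _).trans (norm_simplex hv _).symm)]
    rfl
  inner_n_b i := by
    fin_cases i <;> (simp [inner_add_right, inner_smul_right, inner_smul_left, hv]; try norm_num)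
  inner_α_n i hi := by
    fin_cases i <;> first
      | exact absurd rfl hi
      | (simp [inner_sub_left, inner_smul_right, hv])
  inner_α_n_pos := by
    simp [inner_sub_left, inner_smul_right, hv, norm_simplex hv]; try norm_num
  inner_n_le := by
    rintro _ ⟨i, rfl⟩
    rw [inner_smul_left, hv]
    split_ifs <;> norm_num
  inner_α₀₂ := by simp [inner_sub_left, inner_sub_right, hv]
  inner_α₀₃ := by simp [inner_sub_left, inner_sub_right, hv]
  inner_α₁₃ := by simp [inner_sub_left, inner_sub_right, hv]
  norm_α := by
    simp only [inner_sub_left, inner_sub_right, hv]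
    simp
  inner_α₂₃ := by
    simp only [inner_sub_left, inner_sub_right, hv]
    simp
    norm_num
  q_eq := .inl rfl

theorem exists_flag_cell5 : Nonempty (Flag Cell.cell5.vertices) := by
  have h5 : √5 * √5 = 5 := Real.mul_self_sqrt (by norm_num)
  let v : Fin 5 → E4 := ![!₂[1, 0, 0, 0], !₂[-1 / 4, √5 / 4, √5 / 4, √5 / 4],
    !₂[-1 / 4, √5 / 4, -(√5 / 4), -(√5 / 4)],
    !₂[-1 / 4, -(√5 / 4), √5 / 4, -(√5 / 4)], !₂[-1 / 4, -(√5 / 4), -(√5 / 4), √5 / 4]]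
  have hrange : Set.range v = Cell.cell5.vertices := by
    simp only [v, Matrix.range_cons, Matrix.range_empty, Set.union_empty, Cell.vertices]
    rfl
  rw [← hrange]
  refine ⟨simplexFlag v (fun i j => ?_) ?_⟩
  · rw [inner_E4]
    fin_cases i <;> fin_cases j <;> simp [v] <;> linarith
  · refine ext_E4 ?_ ?_ ?_ ?_ <;> (simp [v, Fin.sum_univ_five]; try ring)

theorem refl_e0_sub_e1 (x : E4) : refl !₂[1, -1, 0, 0] x = !₂[x 1, x 0, x 2, x 3] := by
  rw [refl_apply, inner_E4, inner_E4]
  refine ext_E4 ?_ ?_ ?_ ?_ <;> simp <;> ring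

theorem refl_e1_sub_e2 (x : E4) : refl !₂[0, 1, -1, 0] x = !₂[x 0, x 2, x 1, x 3] := by
  rw [refl_apply, inner_E4, inner_E4]
  refine ext_E4 ?_ ?_ ?_ ?_ <;> simp <;> ring

theorem refl_e2_sub_e3 (x : E4) : refl !₂[0, 0, 1, -1] x = !₂[x 0, x 1, x 3, x 2] := by
  rw [refl_apply, inner_E4, inner_E4]
  refine ext_E4 ?_ ?_ ?_ ?_ <;> simp <;> ring

theorem refl_e3 (x : E4) {c : ℝ} (hc : c ≠ 0) :
    refl !₂[0, 0, 0, c] x = !₂[x 0, x 1, x 2, -x 3] := by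
  rw [refl_apply, inner_E4, inner_E4]
  refine ext_E4 ?_ ?_ ?_ ?_ <;> simp
  field_simp
  ring

theorem vertices_cell8 : Cell.cell8.vertices = {x : E4 | ∀ i, x i = 1 ∨ x i = -1} := by
  have hone : ∀ i : Fin 4, (![1, 1, 1, 1] : Fin 4 → ℝ) i = 1 := fun i => by fin_cases i <;> rfl
  ext x
  constructor
  · rintro ⟨σ, ε, h⟩ i
    rw [h i, hone]
    rcases Int.units_eq_one_or (ε i) with h1 | h1 <;> rw [h1] <;> simp
  · intro h
    refine ⟨1, fun i => if x i = 1 then 1 else -1, fun i => ?_⟩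
    rw [hone]
    rcases h i with h1 | h1 <;> simp only [h1] <;> norm_num

theorem exists_flag_cell8 : Nonempty (Flag Cell.cell8.vertices) := by
  have hV := vertices_cell8
  generalize Cell.cell8.vertices = V at *
  have hmem : ∀ a b c d : ℝ, (a = 1 ∨ a = -1) → (b = 1 ∨ b = -1) → (c = 1 ∨ c = -1) →
      (d = 1 ∨ d = -1) → (!₂[a, b, c, d] : E4) ∈ V := by
    intro a b c d ha hb hc hd
    rw [hV]
    intro i
    fin_cases i <;> assumption
  have hcoord : ∀ v ∈ V, ∀ i, v i = 1 ∨ v i = -1 := fun v hv => by rwa [hV] at hv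
  have hneg : ∀ r : ℝ, (r = 1 ∨ r = -1) → (-r = 1 ∨ -r = -1) := fun r h =>
    h.symm.imp (fun h => by rw [h, neg_neg]) (fun h => by rw [h])
  have hh : ∀ a b c d : ℝ, (a = 1 ∨ a = -1) → (b = 1 ∨ b = -1) → (c = 1 ∨ c = -1) →
      (d = 1 ∨ d = -1) → (!₂[a, b, c, d] : E4) ∈ convexHull ℝ V := fun a b c d ha hb hc hd =>
    subset_convexHull ℝ V (hmem a b c d ha hb hc hd)
  have hnorm : ∀ v ∈ V, ‖v‖ ^ 2 = 4 := by
    intro v hv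
    have h : ∀ i, v i ^ 2 = 1 := fun i => by rcases hcoord v hv i with h | h <;> rw [h] <;> norm_num
    rw [norm_sq_E4, h, h, h, h]
    norm_num
  have h1 : (1 : ℝ) = 1 ∨ (1 : ℝ) = -1 := .inl rfl
  have h2 : (-1 : ℝ) = 1 ∨ (-1 : ℝ) = -1 := .inr rfl
  refine ⟨{
    α := ![!₂[0, 0, 0, 1], !₂[0, 0, 1, -1], !₂[0, 1, -1, 0], !₂[1, -1, 0, 0]]
    -- A vertex and the centers of an edge, a square and a cube of the tesseract.
    b := ![!₂[1, 1, 1, 1], !₂[1, 1, 1, 0], !₂[1, 1, 0, 0], !₂[1, 0, 0, 0]]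
    n := !₂[1, 0, 0, 0]
    q := 1
    finite := ?_
    norm_eq := ?_
    b_zero_mem := hmem 1 1 1 1 h1 h1 h1 h1
    refl_mem := ?_
    inner_ne := ?_
    inner_pos := ?_
    b_mem := ?_
    zero_mem := ?_
    b_one := ?_
    inner_n_b := ?_
    inner_α_n := ?_
    inner_α_n_pos := ?_
    inner_n_le := ?_
    inner_α₀₂ := ?_
    inner_α₀₃ := ?_
    inner_α₁₃ := ?_
    norm_α := ?_
    inner_α₂₃ := ?_
    q_eq := .inl rfl }⟩
  · refine Set.Finite.of_injOn (f := fun x : E4 => fun i => x i)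
      (t := Set.pi Set.univ fun _ => {1, -1}) (fun x hx i _ => hcoord x hx i) ?_
      (Set.Finite.pi fun _ => Set.toFinite _)
    intro x _ y _ h
    exact PiLp.ext fun i => congrFun h i
  · intro v hv
    exact (sq_eq_sq₀ (norm_nonneg _) (norm_nonneg _)).1
      ((hnorm v hv).trans (hnorm _ (hmem 1 1 1 1 h1 h1 h1 h1)).symm)
  · intro i v hv
    have hc := hcoord v hv
    fin_cases i
    · change refl !₂[0, 0, 0, 1] v ∈ V
      rw [refl_e3 v one_ne_zero]
      exact hmem _ _ _ _ (hc 0) (hc 1) (hc 2) (hneg _ (hc 3))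
    · change refl !₂[0, 0, 1, -1] v ∈ V
      rw [refl_e2_sub_e3]
      exact hmem _ _ _ _ (hc 0) (hc 1) (hc 3) (hc 2)
    · change refl !₂[0, 1, -1, 0] v ∈ V
      rw [refl_e1_sub_e2]
      exact hmem _ _ _ _ (hc 0) (hc 2) (hc 1) (hc 3)
    · change refl !₂[1, -1, 0, 0] v ∈ V
      rw [refl_e0_sub_e1]
      exact hmem _ _ _ _ (hc 1) (hc 0) (hc 2) (hc 3)
  · intro i j hij
    rw [inner_E4]
    fin_cases i <;> fin_cases j <;> first
      | exact absurd rfl hij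
      | simp
  · intro i
    rw [inner_E4]
    fin_cases i <;> simp
  · intro i
    fin_cases i
    · exact hh 1 1 1 1 h1 h1 h1 h1
    · exact midpoint_mem_convexHull (hh 1 1 1 1 h1 h1 h1 h1) (hh 1 1 1 (-1) h1 h1 h1 h2)
        (by refine ext_E4 ?_ ?_ ?_ ?_ <;> simp <;> norm_num)
    · exact midpoint_mem_convexHull (hh 1 1 1 1 h1 h1 h1 h1) (hh 1 1 (-1) (-1) h1 h1 h2 h2)
        (by refine ext_E4 ?_ ?_ ?_ ?_ <;> simp <;> norm_num)
    · exact midpoint_mem_convexHull (hh 1 1 1 1 h1 h1 h1 h1) (hh 1 (-1) (-1) (-1) h1 h2 h2 h2)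
        (by refine ext_E4 ?_ ?_ ?_ ?_ <;> simp <;> norm_num)
  · exact midpoint_mem_convexHull (hh 1 1 1 1 h1 h1 h1 h1) (hh (-1) (-1) (-1) (-1) h2 h2 h2 h2)
        (by refine ext_E4 ?_ ?_ ?_ ?_ <;> simp)
  · change _ = (1 / 2 : ℝ) • (!₂[1, 1, 1, 1] + refl !₂[0, 0, 0, 1] !₂[1, 1, 1, 1])
    rw [refl_e3 _ one_ne_zero]
    refine ext_E4 ?_ ?_ ?_ ?_ <;> simp <;> norm_num
  · intro i
    rw [inner_E4]
    fin_cases i <;> simp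
  · intro i hi
    rw [inner_E4]
    fin_cases i <;> first
      | exact absurd rfl hi
      | simp
  · rw [inner_E4]
    simp
  · intro v hv
    rw [inner_E4]
    rcases hcoord v hv 0 with h | h <;> simp [h]
  all_goals
    rw [inner_E4]
    try rw [inner_E4]
    simp
    try norm_num

/-- Membership in `signedPerms` from a permutation of the absolute values. -/
theorem mem_signedPerms_of_abs {a : Fin 4 → ℝ} {x : E4} (σ : Equiv.Perm (Fin 4))
    (h : ∀ i, |x i| = a (σ i)) : x ∈ signedPerms a := by
  refine ⟨σ, fun i => if 0 ≤ x i then 1 else -1, fun i => ?_⟩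
  rw [← h]
  beta_reduce
  split_ifs with h0
  · simp [abs_of_nonneg h0]
  · simp [abs_of_neg (not_le.1 h0)]

theorem mem_evenSignedPerms_of_abs {a : Fin 4 → ℝ} {x : E4} (σ : Equiv.Perm (Fin 4))
    (hσ : Equiv.Perm.sign σ = 1) (h : ∀ i, |x i| = a (σ i)) : x ∈ evenSignedPerms a := by
  refine ⟨σ, fun i => if 0 ≤ x i then 1 else -1, hσ, fun i => ?_⟩
  rw [← h]
  beta_reduce
  split_ifs with h0
  · simp [abs_of_nonneg h0]
  · simp [abs_of_neg (not_le.1 h0)]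

theorem norm_sq_of_mem_signedPerms {a : Fin 4 → ℝ} {x : E4} (hx : x ∈ signedPerms a) :
    ‖x‖ ^ 2 = ∑ i, a i ^ 2 := by
  obtain ⟨σ, ε, h⟩ := hx
  rw [EuclideanSpace.norm_sq_eq, ← Equiv.sum_comp σ fun i => a i ^ 2]
  refine Finset.sum_congr rfl fun i _ => ?_
  rw [h, Real.norm_eq_abs, sq_abs, mul_pow]
  have := sgn_mul_self (ε i)
  rw [sq, this, one_mul]

/-- The points of norm two of the lattice of Hurwitz quaternions, scaled by two. -/
def hurwitzSphere : Set E4 :=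
  {x | ‖x‖ ^ 2 = 4 ∧ ∃ p : Fin 4 → ℤ, (∀ i, x i = (p i : ℝ)) ∧ ∀ i, (p i - p 0) % 2 = 0}

theorem eq_of_hurwitz : ∀ a b c d : Fin 3,
    (a : ℕ) ^ 2 + (b : ℕ) ^ 2 + (c : ℕ) ^ 2 + (d : ℕ) ^ 2 = 4 →
    (∃ σ : Equiv.Perm (Fin 4), ∀ i, (![a, b, c, d] i : ℕ) = ![2, 0, 0, 0] (σ i)) ∨
    (∃ σ : Equiv.Perm (Fin 4), ∀ i, (![a, b, c, d] i : ℕ) = ![1, 1, 1, 1] (σ i)) := by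
  decide

/-- Doubling makes the coordinates integers. The lattice description reduces stability under
reflections to congruences. -/
theorem vertices_cell24 : Cell.cell24.vertices = (fun x : E4 => (1 / 2 : ℝ) • x) '' hurwitzSphere := by
  ext x
  constructor
  · intro hx
    refine ⟨(2 : ℝ) • x, ?_, by simp [smul_smul]⟩
    rcases hx with hx | hx
    · refine ⟨?_, ?_⟩
      · rw [norm_smul, mul_pow, norm_sq_of_mem_signedPerms hx, Fin.sum_univ_four]
        simp
        try norm_num
      · obtain ⟨σ, ε, h⟩ := hx
        refine ⟨fun i => 2 * ((ε i : ℤ) * ![1, 0, 0, 0] (σ i)), fun i => ?_, fun i => ?_⟩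
        · rw [PiLp.smul_apply, h, smul_eq_mul]
          push_cast
          congr 2
          generalize σ i = j
          fin_cases j <;> simp
        · exact Int.emod_eq_zero_of_dvd (by rw [← mul_sub]; exact dvd_mul_right _ _)
    · refine ⟨?_, ?_⟩
      · rw [norm_smul, mul_pow, norm_sq_of_mem_signedPerms hx, Fin.sum_univ_four]
        simp
        try norm_num
      · obtain ⟨σ, ε, h⟩ := hx
        refine ⟨fun i => (ε i : ℤ), fun i => ?_, fun i => ?_⟩
        · rw [PiLp.smul_apply, h, smul_eq_mul, mul_left_comm]
          generalize σ i = j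
          fin_cases j <;> simp
        · rcases Int.units_eq_one_or (ε i) with h1 | h1 <;>
            rcases Int.units_eq_one_or (ε 0) with h2 | h2 <;> simp [h1, h2]
  · rintro ⟨x, ⟨hn, p, hp, -⟩, rfl⟩
    have hsum : (p 0).natAbs ^ 2 + (p 1).natAbs ^ 2 + (p 2).natAbs ^ 2 + (p 3).natAbs ^ 2 = 4 := by
      rw [norm_sq_E4, hp, hp, hp, hp] at hn
      zify
      simp only [sq_abs]
      have hn' : (p 0 : ℝ) ^ 2 + (p 1 : ℝ) ^ 2 + (p 2 : ℝ) ^ 2 + (p 3 : ℝ) ^ 2 = 4 := hn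
      exact_mod_cast hn'
    have hlt : ∀ i, (p i).natAbs < 3 := by
      intro i
      by_contra h
      have h3 : 9 ≤ (p i).natAbs ^ 2 := by nlinarith [not_lt.1 h]
      fin_cases i <;> simp at h3 <;> omega
    have habs : ∀ i, |x i| = (![(p 0).natAbs, (p 1).natAbs, (p 2).natAbs, (p 3).natAbs] i : ℕ) := by
      intro i
      rw [hp]
      fin_cases i <;> simp [Nat.cast_natAbs]
    have key : ∀ (a : Fin 4 → ℕ) (σ : Equiv.Perm (Fin 4)),
        (∀ i, (![⟨_, hlt 0⟩, ⟨_, hlt 1⟩, ⟨_, hlt 2⟩, ⟨_, hlt 3⟩] i : Fin 3).1 = a (σ i)) →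
        ∀ i, |((1 / 2 : ℝ) • x) i| = a (σ i) / 2 := by
      intro a σ h i
      rw [← h, PiLp.smul_apply, smul_eq_mul, abs_mul, habs]
      fin_cases i <;> simp <;> ring
    rcases eq_of_hurwitz ⟨_, hlt 0⟩ ⟨_, hlt 1⟩ ⟨_, hlt 2⟩ ⟨_, hlt 3⟩ hsum with ⟨σ, h⟩ | ⟨σ, h⟩
    · refine .inl (mem_signedPerms_of_abs σ fun i => ?_)
      exact (key _ σ h i).trans (by generalize σ i = j; fin_cases j <;> simp)
    · refine .inr (mem_signedPerms_of_abs σ fun i => ?_)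
      exact (key _ σ h i).trans (by generalize σ i = j; fin_cases j <;> simp)

open scoped goldenRatio

/-! ### Icosians -/

/-- The congruences that define the ring of icosians, scaled by two, in terms of the coefficients
of `p + q φ`. -/
def IsIcosian (p q : Fin 4 → ℤ) : Prop :=
  (p 0 + p 1 + p 2 + p 3) % 2 = 0 ∧ (q 0 + q 1 + q 2 + q 3) % 2 = 0 ∧
  (p 2 - p 0 - q 0 - q 1) % 2 = 0 ∧ (q 2 - p 0 - p 1 - q 1) % 2 = 0

instance (p q : Fin 4 → ℤ) : Decidable (IsIcosian p q) := by
  unfold IsIcosian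
  infer_instance

theorem IsIcosian.congr {p q p' q' : Fin 4 → ℤ} (h : IsIcosian p q)
    (hp : ∀ i, p' i % 2 = p i % 2) (hq : ∀ i, q' i % 2 = q i % 2) : IsIcosian p' q' := by
  obtain ⟨h1, h2, h3, h4⟩ := h
  have a0 := hp 0
  have a1 := hp 1
  have a2 := hp 2
  have a3 := hp 3
  have b0 := hq 0
  have b1 := hq 1
  have b2 := hq 2
  have b3 := hq 3
  refine ⟨?_, ?_, ?_, ?_⟩ <;> omega

/-- The vector with coordinates `p i + q i * φ`. -/
noncomputable def goldenVec (p q : Fin 4 → ℤ) : E4 :=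
  WithLp.toLp 2 fun i => (p i : ℝ) + (q i : ℝ) * φ

theorem goldenVec_apply (p q : Fin 4 → ℤ) (i : Fin 4) :
    goldenVec p q i = (p i : ℝ) + (q i : ℝ) * φ := rfl

theorem inner_goldenVec (p q p' q' : Fin 4 → ℤ) : inner ℝ (goldenVec p q) (goldenVec p' q') =
    ((∑ i, (p i * p' i + q i * q' i) : ℤ) : ℝ) +
      ((∑ i, (p i * q' i + q i * p' i + q i * q' i) : ℤ) : ℝ) * φ := by
  rw [inner_E4]
  simp only [goldenVec_apply, Fin.sum_univ_four]
  push_cast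
  linear_combination ((q 0 : ℝ) * q' 0 + q 1 * q' 1 + q 2 * q' 2 + q 3 * q' 3) * Real.goldenRatio_sq

theorem goldenRatio_bounds : (1618 / 1000 : ℝ) < φ ∧ φ < 1619 / 1000 := by
  have h := Real.goldenRatio_sq
  have h1 := Real.one_lt_goldenRatio
  constructor <;> nlinarith

theorem eq_zero_of_add_mul_goldenRatio {a b : ℤ} (h : (a : ℝ) + b * φ = 0) : a = 0 ∧ b = 0 := by
  have hb : b = 0 := by
    by_contra hb
    have hb' : (b : ℝ) ≠ 0 := by exact_mod_cast hb
    refine Real.goldenRatio_irrational ⟨-(a : ℚ) / b, ?_⟩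
    push_cast
    rw [div_eq_iff hb']
    linarith
  subst hb
  simpa using h

/-- The points of the given norm of the lattice of icosians, scaled by two. -/
def icosianSphere (r : ℕ) : Set E4 :=
  {x | ‖x‖ ^ 2 = r ∧ ∃ p q : Fin 4 → ℤ, x = goldenVec p q ∧ IsIcosian p q}

/-- As φ is irrational, a rational norm splits into two integer equations; the first bounds all
coefficients. -/
theorem norm_goldenVec_sq {p q : Fin 4 → ℤ} {r : ℕ} (h : ‖goldenVec p q‖ ^ 2 = r) :
    ∑ i, (p i ^ 2 + q i ^ 2) = r ∧ ∑ i, (2 * p i * q i + q i ^ 2) = 0 := by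
  rw [← real_inner_self_eq_norm_sq, inner_goldenVec] at h
  have h1 := eq_zero_of_add_mul_goldenRatio
    (a := (∑ i, (p i * p i + q i * q i)) - r) (b := ∑ i, (p i * q i + q i * p i + q i * q i))
    (by rw [← sub_eq_zero] at h; rw [← h]; push_cast; ring)
  refine ⟨?_, ?_⟩
  · rw [← sub_eq_zero, ← h1.1]
    congr 1
    exact Finset.sum_congr rfl fun i _ => by ring
  · rw [← h1.2]
    exact Finset.sum_congr rfl fun i _ => by ring

theorem goldenVec_mem {p q : Fin 4 → ℤ} {r : ℕ} (h : IsIcosian p q)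
    (h1 : ∑ i, (p i * p i + q i * q i) = r) (h2 : ∑ i, (p i * q i + q i * p i + q i * q i) = 0) :
    goldenVec p q ∈ icosianSphere r := by
  refine ⟨?_, p, q, rfl, h⟩
  rw [← real_inner_self_eq_norm_sq, inner_goldenVec, h1, h2]
  simp

theorem finite_icosianSphere (r : ℕ) : (icosianSphere r).Finite := by
  refine (((Set.finite_Icc (fun _ : Fin 4 => -(r : ℤ)) fun _ => (r : ℤ)).prod
    (Set.finite_Icc (fun _ : Fin 4 => -(r : ℤ)) fun _ => (r : ℤ))).image
      fun k => goldenVec k.1 k.2).subset ?_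
  rintro _ ⟨hn, p, q, rfl, -⟩
  have h := (norm_goldenVec_sq hn).1
  have hle : ∀ i, p i ^ 2 + q i ^ 2 ≤ r := fun i => by
    rw [← h]
    exact Finset.single_le_sum (f := fun i => p i ^ 2 + q i ^ 2) (fun i _ => by positivity)
      (Finset.mem_univ i)
  refine ⟨(p, q), ⟨⟨fun i => ?_, fun i => ?_⟩, ⟨fun i => ?_, fun i => ?_⟩⟩, rfl⟩ <;>
    have := hle i <;> simp only <;> nlinarith

/-- The coefficients of the absolute values of the coordinates of the vertices:
`0, 1, 2, φ, φ⁻¹, φ², φ⁻², √5`. -/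
def absP : Fin 8 → ℤ := ![0, 1, 2, 0, -1, 1, 2, -1]

/-- The coefficient of the golden ratio in the `k`th possible absolute value. -/
def absQ : Fin 8 → ℤ := ![0, 0, 0, 1, 1, 1, -1, 2]

/-- The absolute value with given coefficients. -/
noncomputable def absVal (k : Fin 8) : ℝ := (absP k : ℝ) + (absQ k : ℝ) * φ

theorem absVal_eq : absVal = ![0, 1, 2, φ, φ⁻¹, φ ^ 2, (φ ^ 2)⁻¹, √5] := by
  have h := Real.goldenRatio_sq
  have h5 : √5 = 2 * φ - 1 := by rw [Real.goldenRatio]; ring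
  have h1 : φ⁻¹ = φ - 1 := by
    refine inv_eq_of_mul_eq_one_right ?_
    linarith
  have h2 : (φ ^ 2)⁻¹ = 2 - φ := by
    rw [← inv_pow, h1]
    linarith
  rw [h1, h2, h5, h]
  funext k
  fin_cases k <;> simp [absVal, absP, absQ] <;> ring

theorem absVal_nonneg (k : Fin 8) : 0 ≤ absVal k := by
  have h := Real.goldenRatio_pos
  rw [absVal_eq]
  fin_cases k <;> simp <;> positivity

/-- The hypotheses bound the squares of p + qφ and of its conjugate. Replacing φ by 1.618, on the
side fixed by the sign of the coefficient, leaves a finite integer check. -/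
theorem exists_abs {p q : ℤ} (hp : |p| ≤ 2) (hq : |q| ≤ 2)
    (h1 : ((p ^ 2 + q ^ 2 : ℤ) : ℝ) + ((2 * p * q + q ^ 2 : ℤ) : ℝ) * φ ≤ 8)
    (h2 : ((p ^ 2 + q ^ 2 : ℤ) : ℝ) + ((2 * p * q + q ^ 2 : ℤ) : ℝ) * (1 - φ) ≤ 8) :
    ∃ k, (p = absP k ∧ q = absQ k) ∨ (p = -absP k ∧ q = -absQ k) := by
  obtain ⟨hl, hu⟩ := goldenRatio_bounds
  have key : ∀ p ∈ Finset.Icc (-2 : ℤ) 2, ∀ q ∈ Finset.Icc (-2 : ℤ) 2,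
      (∃ k, (p = absP k ∧ q = absQ k) ∨ (p = -absP k ∧ q = -absQ k)) ∨
      8000 < 1000 * (p ^ 2 + q ^ 2) + 1618 * (2 * p * q + q ^ 2) ∧ 0 ≤ 2 * p * q + q ^ 2 ∨
      8000 < 1000 * (p ^ 2 + q ^ 2) - 618 * (2 * p * q + q ^ 2) ∧ 2 * p * q + q ^ 2 ≤ 0 := by
    decide +kernel
  rcases key p (Finset.mem_Icc.2 (abs_le.1 hp)) q (Finset.mem_Icc.2 (abs_le.1 hq)) with h | h | h
  · exact h
  · exfalso
    have e1 : (8000 : ℝ) < 1000 * ((p ^ 2 + q ^ 2 : ℤ) : ℝ) + 1618 * ((2 * p * q + q ^ 2 : ℤ) : ℝ) := by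
      exact_mod_cast h.1
    have e2 : (0 : ℝ) ≤ ((2 * p * q + q ^ 2 : ℤ) : ℝ) := by exact_mod_cast h.2
    nlinarith
  · exfalso
    have e1 : (8000 : ℝ) < 1000 * ((p ^ 2 + q ^ 2 : ℤ) : ℝ) - 618 * ((2 * p * q + q ^ 2 : ℤ) : ℝ) := by
      exact_mod_cast h.1
    have e2 : ((2 * p * q + q ^ 2 : ℤ) : ℝ) ≤ (0 : ℝ) := by exact_mod_cast h.2
    nlinarith

theorem signedPerms_smul {c : ℝ} (hc : c ≠ 0) (a : Fin 4 → ℝ) :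
    (fun x : E4 => c • x) '' signedPerms a = signedPerms (c • a) := by
  ext x
  constructor
  · rintro ⟨x, ⟨σ, ε, h⟩, rfl⟩
    exact ⟨σ, ε, fun i => by rw [PiLp.smul_apply, h, Pi.smul_apply, smul_eq_mul, smul_eq_mul, mul_left_comm]⟩
  · rintro ⟨σ, ε, h⟩
    refine ⟨c⁻¹ • x, ⟨σ, ε, fun i => ?_⟩, by simp [smul_smul, hc]⟩
    rw [PiLp.smul_apply, h, Pi.smul_apply, smul_eq_mul, smul_eq_mul, mul_left_comm c⁻¹,
      inv_mul_cancel_left₀ hc]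

theorem evenSignedPerms_smul {c : ℝ} (hc : c ≠ 0) (a : Fin 4 → ℝ) :
    (fun x : E4 => c • x) '' evenSignedPerms a = evenSignedPerms (c • a) := by
  ext x
  constructor
  · rintro ⟨x, ⟨σ, ε, hσ, h⟩, rfl⟩
    exact ⟨σ, ε, hσ, fun i => by rw [PiLp.smul_apply, h, Pi.smul_apply, smul_eq_mul, smul_eq_mul, mul_left_comm]⟩
  · rintro ⟨σ, ε, hσ, h⟩
    refine ⟨c⁻¹ • x, ⟨σ, ε, hσ, fun i => ?_⟩, by simp [smul_smul, hc]⟩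
    rw [PiLp.smul_apply, h, Pi.smul_apply, smul_eq_mul, smul_eq_mul, mul_left_comm c⁻¹,
      inv_mul_cancel_left₀ hc]

theorem mem_icosianSphere_of_signs {T : Fin 4 → Fin 8} {σ : Equiv.Perm (Fin 4)} {ε : Fin 4 → ℤˣ}
    {x : E4} {r : ℕ} (h : ∀ i, x i = ((ε i : ℤ) : ℝ) * absVal (T (σ i)))
    (hT : IsIcosian (fun i => absP (T (σ i))) fun i => absQ (T (σ i)))
    (h1 : ∑ i, (absP (T i) * absP (T i) + absQ (T i) * absQ (T i)) = r)
    (h2 : ∑ i, (absP (T i) * absQ (T i) + absQ (T i) * absP (T i) + absQ (T i) * absQ (T i)) = 0) :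
    x ∈ icosianSphere r := by
  have hx : x = goldenVec (fun i => ε i * absP (T (σ i))) (fun i => ε i * absQ (T (σ i))) := by
    ext i
    rw [h, goldenVec_apply, absVal]
    push_cast
    ring
  have hε : ∀ i, (ε i : ℤ) * ε i = 1 := fun i => by
    rcases Int.units_eq_one_or (ε i) with h | h <;> rw [h] <;> norm_num
  rw [hx]
  refine goldenVec_mem (hT.congr (fun i => ?_) fun i => ?_) ?_ ?_
  · rcases Int.units_eq_one_or (ε i) with h | h <;> rw [h]
    · simp
    · simp only [Units.val_neg, Units.val_one]
      omega
  · rcases Int.units_eq_one_or (ε i) with h | h <;> rw [h]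
    · simp
    · simp only [Units.val_neg, Units.val_one]
      omega
  · rw [← h1, ← Equiv.sum_comp σ fun i => absP (T i) * absP (T i) + absQ (T i) * absQ (T i)]
    refine Finset.sum_congr rfl fun i _ => ?_
    linear_combination (absP (T (σ i)) * absP (T (σ i)) + absQ (T (σ i)) * absQ (T (σ i))) * hε i
  · rw [← h2, ← Equiv.sum_comp σ fun i =>
      absP (T i) * absQ (T i) + absQ (T i) * absP (T i) + absQ (T i) * absQ (T i)]
    refine Finset.sum_congr rfl fun i _ => ?_
    linear_combination (2 * absP (T (σ i)) * absQ (T (σ i)) + absQ (T (σ i)) * absQ (T (σ i))) * hε i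

/-- The absolute values of the coordinates of icosians of small norm. -/
theorem exists_abs_of_mem {r : ℕ} (hr : r ≤ 8) {x : E4} (hx : x ∈ icosianSphere r) :
    ∃ k : Fin 4 → Fin 8, (∀ i, |x i| = absVal (k i)) ∧
      IsIcosian (fun i => absP (k i)) (fun i => absQ (k i)) ∧
      ∑ i, (absP (k i) ^ 2 + absQ (k i) ^ 2) = r ∧
      ∑ i, (2 * absP (k i) * absQ (k i) + absQ (k i) ^ 2) = 0 := by
  obtain ⟨hn, p, q, rfl, hico⟩ := hx
  obtain ⟨h1, h2⟩ := norm_goldenVec_sq hn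
  have hφ := Real.goldenRatio_sq
  have hle : ∀ i, p i ^ 2 + q i ^ 2 ≤ 8 := fun i => by
    refine le_trans ?_ (h1.trans_le (by exact_mod_cast hr))
    exact Finset.single_le_sum (f := fun i => p i ^ 2 + q i ^ 2) (fun i _ => by positivity)
      (Finset.mem_univ i)
  -- Applied to both roots φ and 1 - φ: the conjugate vector has the same norm, so its coordinates
  -- are bounded too.
  have hsum : ∀ w : ℝ, w ^ 2 = w + 1 → ∀ i,
      ((p i ^ 2 + q i ^ 2 : ℤ) : ℝ) + ((2 * p i * q i + q i ^ 2 : ℤ) : ℝ) * w ≤ 8 := by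
    intro w hw i
    have e : ∀ i, ((p i ^ 2 + q i ^ 2 : ℤ) : ℝ) + ((2 * p i * q i + q i ^ 2 : ℤ) : ℝ) * w =
        ((p i : ℝ) + q i * w) ^ 2 := fun i => by
      push_cast
      linear_combination (-(q i : ℝ) ^ 2) * hw
    have h3 : ∑ i, (((p i ^ 2 + q i ^ 2 : ℤ) : ℝ) + ((2 * p i * q i + q i ^ 2 : ℤ) : ℝ) * w) = r := by
      rw [Finset.sum_add_distrib, ← Finset.sum_mul, ← Int.cast_sum, ← Int.cast_sum, h1, h2]
      simp
    calc _ ≤ ∑ i, (((p i ^ 2 + q i ^ 2 : ℤ) : ℝ) + ((2 * p i * q i + q i ^ 2 : ℤ) : ℝ) * w) :=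
          Finset.single_le_sum
            (f := fun i => ((p i ^ 2 + q i ^ 2 : ℤ) : ℝ) + ((2 * p i * q i + q i ^ 2 : ℤ) : ℝ) * w)
            (fun i _ => by rw [e]; positivity) (Finset.mem_univ i)
      _ = r := h3
      _ ≤ 8 := by exact_mod_cast hr
  have hk : ∀ i, ∃ k, (p i = absP k ∧ q i = absQ k) ∨ (p i = -absP k ∧ q i = -absQ k) := fun i =>
    exists_abs (abs_le.2 ⟨by nlinarith [hle i, sq_nonneg (q i)], by nlinarith [hle i, sq_nonneg (q i)]⟩)
      (abs_le.2 ⟨by nlinarith [hle i, sq_nonneg (p i)], by nlinarith [hle i, sq_nonneg (p i)]⟩)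
      (hsum φ hφ i) (hsum (1 - φ) (by linear_combination hφ) i)
  choose k hk using hk
  refine ⟨k, fun i => ?_, hico.congr (fun i => ?_) fun i => ?_, ?_, ?_⟩
  · rw [goldenVec_apply]
    rcases hk i with ⟨e1, e2⟩ | ⟨e1, e2⟩
    · rw [e1, e2]
      exact abs_of_nonneg (absVal_nonneg _)
    · rw [e1, e2, ← abs_of_nonneg (absVal_nonneg (k i)), ← abs_neg, absVal]
      push_cast
      congr 1
      ring
  · rcases hk i with ⟨e1, e2⟩ | ⟨e1, e2⟩
    · rw [e1]
    · rw [e1]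
      omega
  · rcases hk i with ⟨e1, e2⟩ | ⟨e1, e2⟩
    · rw [e2]
    · rw [e2]
      omega
  · rw [← h1]
    refine Finset.sum_congr rfl fun i _ => ?_
    rcases hk i with ⟨e1, e2⟩ | ⟨e1, e2⟩
    · rw [e1, e2]
    · rw [e1, e2, neg_sq, neg_sq]
  · rw [← h2]
    refine Finset.sum_congr rfl fun i _ => ?_
    rcases hk i with ⟨e1, e2⟩ | ⟨e1, e2⟩
    · rw [e1, e2]
    · rw [e1, e2]
      ring

theorem abs_pattern_eight : ∀ a b c d : Fin 8,
    (absP a ^ 2 + absQ a ^ 2) + (absP b ^ 2 + absQ b ^ 2) + (absP c ^ 2 + absQ c ^ 2) +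
      (absP d ^ 2 + absQ d ^ 2) = 8 →
    (2 * absP a * absQ a + absQ a ^ 2) + (2 * absP b * absQ b + absQ b ^ 2) +
      (2 * absP c * absQ c + absQ c ^ 2) + (2 * absP d * absQ d + absQ d ^ 2) = 0 →
    IsIcosian ![absP a, absP b, absP c, absP d] ![absQ a, absQ b, absQ c, absQ d] →
    (∃ T ∈ [![2, 2, 0, 0], ![7, 1, 1, 1], ![6, 3, 3, 3], ![5, 4, 4, 4]],
      ∃ σ : Equiv.Perm (Fin 4), ∀ i, (![a, b, c, d] : Fin 4 → Fin 8) i = T (σ i)) ∨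
    ∃ T ∈ [![5, 6, 1, 0], ![7, 4, 3, 0], ![2, 1, 3, 4]],
      ∃ σ : Equiv.Perm (Fin 4), Equiv.Perm.sign σ = 1 ∧
        ∀ i, (![a, b, c, d] : Fin 4 → Fin 8) i = T (σ i) := by
  decide +kernel

/-- The last two inequalities serve the facet bound of the 600-cell. They are one affine expression
evaluated at 1.618 and 1.619, so it is nonnegative at φ in between. -/
theorem abs_pattern_four : ∀ a b c d : Fin 8,
    (absP a ^ 2 + absQ a ^ 2) + (absP b ^ 2 + absQ b ^ 2) + (absP c ^ 2 + absQ c ^ 2) +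
      (absP d ^ 2 + absQ d ^ 2) = 4 →
    (2 * absP a * absQ a + absQ a ^ 2) + (2 * absP b * absQ b + absQ b ^ 2) +
      (2 * absP c * absQ c + absQ c ^ 2) + (2 * absP d * absQ d + absQ d ^ 2) = 0 →
    IsIcosian ![absP a, absP b, absP c, absP d] ![absQ a, absQ b, absQ c, absQ d] →
    ((∃ T ∈ [![2, 0, 0, 0], ![1, 1, 1, 1]],
      ∃ σ : Equiv.Perm (Fin 4), ∀ i, (![a, b, c, d] : Fin 4 → Fin 8) i = T (σ i)) ∨
    ∃ T ∈ [![0, 1, 3, 4]],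
      ∃ σ : Equiv.Perm (Fin 4), Equiv.Perm.sign σ = 1 ∧
        ∀ i, (![a, b, c, d] : Fin 4 → Fin 8) i = T (σ i)) ∧
    0 ≤ 1000 * (2 - (absP a + absQ a + absP b + 2 * absP d - absQ d)) +
      1618 * (2 - (absP a + 2 * absQ a + absQ b + absQ d - absP d)) ∧
    0 ≤ 1000 * (2 - (absP a + absQ a + absP b + 2 * absP d - absQ d)) +
      1619 * (2 - (absP a + 2 * absQ a + absQ b + absQ d - absP d)) := by
  decide +kernel

theorem eq_cons_E4 {α : Type*} (k : Fin 4 → α) : k = ![k 0, k 1, k 2, k 3] := by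
  funext i
  fin_cases i <;> rfl

theorem icosianSphere_eight : icosianSphere 8 =
    signedPerms (absVal ∘ ![2, 2, 0, 0]) ∪ signedPerms (absVal ∘ ![7, 1, 1, 1]) ∪
      signedPerms (absVal ∘ ![6, 3, 3, 3]) ∪ signedPerms (absVal ∘ ![5, 4, 4, 4]) ∪
      evenSignedPerms (absVal ∘ ![5, 6, 1, 0]) ∪ evenSignedPerms (absVal ∘ ![7, 4, 3, 0]) ∪
      evenSignedPerms (absVal ∘ ![2, 1, 3, 4]) := by
  ext x
  constructor
  · intro hx
    obtain ⟨k, h1, h2, h3, h4⟩ := exists_abs_of_mem le_rfl hx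
    rw [Fin.sum_univ_four] at h3 h4
    have h5 := abs_pattern_eight (k 0) (k 1) (k 2) (k 3) h3 h4 (h2.congr
      (fun i => by fin_cases i <;> rfl) (fun i => by fin_cases i <;> rfl))
    rw [← eq_cons_E4 k] at h5
    rcases h5 with ⟨T, hT, σ, hσ⟩ | ⟨T, hT, σ, hs, hσ⟩
    · have hmem : x ∈ signedPerms (absVal ∘ T) :=
        mem_signedPerms_of_abs σ fun i => (h1 i).trans (congrArg absVal (hσ i))
      simp only [List.mem_cons, List.not_mem_nil, or_false] at hT
      rcases hT with rfl | rfl | rfl | rfl <;> simp only [Set.mem_union, hmem, true_or, or_true]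
    · have hmem : x ∈ evenSignedPerms (absVal ∘ T) :=
        mem_evenSignedPerms_of_abs σ hs fun i => (h1 i).trans (congrArg absVal (hσ i))
      simp only [List.mem_cons, List.not_mem_nil, or_false] at hT
      rcases hT with rfl | rfl | rfl <;> simp only [Set.mem_union, hmem, true_or, or_true]
  · rintro ((((((⟨σ, ε, h⟩ | ⟨σ, ε, h⟩) | ⟨σ, ε, h⟩) | ⟨σ, ε, h⟩) | ⟨σ, ε, hσ, h⟩) | ⟨σ, ε, hσ, h⟩) |
      ⟨σ, ε, hσ, h⟩)
    iterate 7
      exact mem_icosianSphere_of_signs h (by clear h; revert σ; decide) (by decide) (by decide)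

theorem icosianSphere_four : icosianSphere 4 =
    signedPerms (absVal ∘ ![2, 0, 0, 0]) ∪ signedPerms (absVal ∘ ![1, 1, 1, 1]) ∪
      evenSignedPerms (absVal ∘ ![0, 1, 3, 4]) := by
  ext x
  constructor
  · intro hx
    obtain ⟨k, h1, h2, h3, h4⟩ := exists_abs_of_mem (by norm_num) hx
    rw [Fin.sum_univ_four] at h3 h4
    have h5 := (abs_pattern_four (k 0) (k 1) (k 2) (k 3) h3 h4 (h2.congr
      (fun i => by fin_cases i <;> rfl) (fun i => by fin_cases i <;> rfl))).1
    rw [← eq_cons_E4 k] at h5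
    rcases h5 with ⟨T, hT, σ, hσ⟩ | ⟨T, hT, σ, hs, hσ⟩
    · have hmem : x ∈ signedPerms (absVal ∘ T) :=
        mem_signedPerms_of_abs σ fun i => (h1 i).trans (congrArg absVal (hσ i))
      simp only [List.mem_cons, List.not_mem_nil, or_false] at hT
      rcases hT with rfl | rfl <;> simp only [Set.mem_union, hmem, true_or, or_true]
    · have hmem : x ∈ evenSignedPerms (absVal ∘ T) :=
        mem_evenSignedPerms_of_abs σ hs fun i => (h1 i).trans (congrArg absVal (hσ i))
      simp only [List.mem_cons, List.not_mem_nil, or_false] at hT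
      rcases hT with rfl
      simp only [Set.mem_union, hmem, or_true]
  · rintro ((⟨σ, ε, h⟩ | ⟨σ, ε, h⟩) | ⟨σ, ε, hσ, h⟩)
    iterate 3
      exact mem_icosianSphere_of_signs h (by clear h; revert σ; decide) (by decide) (by decide)

theorem vertices_cell120 : Cell.cell120.vertices = icosianSphere 8 := by
  rw [icosianSphere_eight, Cell.vertices, absVal_eq]
  congr <;> funext i <;> fin_cases i <;> rfl

theorem vertices_cell600 :
    Cell.cell600.vertices = (fun x : E4 => (1 / 2 : ℝ) • x) '' icosianSphere 4 := by
  have h2 : (1 / 2 : ℝ) ≠ 0 := by norm_num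
  rw [icosianSphere_four, Set.image_union, Set.image_union, signedPerms_smul h2,
    signedPerms_smul h2, evenSignedPerms_smul h2, Cell.vertices, absVal_eq]
  congr <;> funext i <;> fin_cases i <;> simp <;> ring

/-! ### Flags of the 600-cell and the 120-cell -/

theorem refl_goldenVec {p q a b : Fin 4 → ℤ} {s t : ℤ} (h1 : ∑ i, (a i * a i + b i * b i) = 4)
    (h2 : ∑ i, (a i * b i + b i * a i + b i * b i) = 0) (hs : ∑ i, (a i * p i + b i * q i) = 2 * s)
    (ht : ∑ i, (a i * q i + b i * p i + b i * q i) = 2 * t) :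
    refl (goldenVec a b) (goldenVec p q) = goldenVec (fun i => p i - (s * a i + t * b i))
      fun i => q i - (s * b i + t * a i + t * b i) := by
  -- The root has squared norm 4, so the reflection coefficient is half the inner product, namely s
  -- + tφ.
  rw [refl_apply, inner_goldenVec, inner_goldenVec, h1, h2, hs, ht]
  ext i
  rw [PiLp.sub_apply, PiLp.smul_apply, goldenVec_apply, goldenVec_apply, goldenVec_apply, smul_eq_mul]
  push_cast
  linear_combination (-(t : ℝ) * b i) * Real.goldenRatio_sq

/-- Simple roots of the symmetry group of the 600-cell. -/
noncomputable def icosianRoot : Fin 4 → E4 :=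
  ![goldenVec ![-1, 0, -1, 0] ![1, -1, 0, 0], goldenVec ![0, 0, 2, 0] ![0, 0, 0, 0],
    goldenVec ![0, -1, -1, 0] ![0, 1, 0, 1], goldenVec ![0, 0, 0, -2] ![0, 0, 0, 0]]

theorem refl_mem_icosianSphere {r : ℕ} (i : Fin 4) {x : E4} (hx : x ∈ icosianSphere r) :
    refl (icosianRoot i) x ∈ icosianSphere r := by
  obtain ⟨hn, p, q, rfl, h1, h2, h3, h4⟩ := hx
  refine ⟨by rw [LinearIsometryEquiv.norm_map, hn], ?_⟩
  have key : ∀ a b : Fin 4 → ℤ, ∑ i, (a i * a i + b i * b i) = 4 →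
      ∑ i, (a i * b i + b i * a i + b i * b i) = 0 →
      ∀ s t, ∑ i, (a i * p i + b i * q i) = 2 * s → ∑ i, (a i * q i + b i * p i + b i * q i) = 2 * t →
      IsIcosian (fun i => p i - (s * a i + t * b i)) (fun i => q i - (s * b i + t * a i + t * b i)) →
      ∃ p' q' : Fin 4 → ℤ, refl (goldenVec a b) (goldenVec p q) = goldenVec p' q' ∧
        IsIcosian p' q' := fun a b e1 e2 s t e3 e4 h => ⟨_, _, refl_goldenVec e1 e2 e3 e4, h⟩
  fin_cases i
  · obtain ⟨s, hs⟩ : ∃ s, -p 0 + q 0 - q 1 - p 2 = 2 * s :=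
      -- The icosian congruences make the inner product with a root divisible by two.
      ⟨(-p 0 + q 0 - q 1 - p 2) / 2, by omega⟩
    obtain ⟨t, ht⟩ : ∃ t, p 0 - p 1 - q 1 - q 2 = 2 * t := ⟨(p 0 - p 1 - q 1 - q 2) / 2, by omega⟩
    refine key _ _ (by decide) (by decide) s t ?_ ?_ ?_
    · simp [Fin.sum_univ_four]; omega
    · simp [Fin.sum_univ_four]; omega
    · simp [IsIcosian]; omega
  · refine key _ _ (by decide) (by decide) (p 2) (q 2) ?_ ?_ ?_
    · simp [Fin.sum_univ_four]
    · simp [Fin.sum_univ_four]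
    · simp [IsIcosian]; omega
  · obtain ⟨s, hs⟩ : ∃ s, -p 1 + q 1 - p 2 + q 3 = 2 * s :=
      ⟨(-p 1 + q 1 - p 2 + q 3) / 2, by omega⟩
    obtain ⟨t, ht⟩ : ∃ t, p 1 - q 2 + p 3 + q 3 = 2 * t := ⟨(p 1 - q 2 + p 3 + q 3) / 2, by omega⟩
    refine key _ _ (by decide) (by decide) s t ?_ ?_ ?_
    · simp [Fin.sum_univ_four]; omega
    · simp [Fin.sum_univ_four]; omega
    · simp [IsIcosian]; omega
  · refine key _ _ (by decide) (by decide) (-p 3) (-q 3) ?_ ?_ ?_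
    · simp [Fin.sum_univ_four]
    · simp [Fin.sum_univ_four]
    · simp [IsIcosian]; omega

theorem norm_eq_of_mem_icosianSphere {r : ℕ} {x y : E4} (hx : x ∈ icosianSphere r)
    (hy : y ∈ icosianSphere r) : ‖x‖ = ‖y‖ :=
  (sq_eq_sq₀ (norm_nonneg _) (norm_nonneg _)).1 (hx.1.trans hy.1.symm)

set_option maxHeartbeats 1000000 in
theorem exists_flag_icosian_four : Nonempty (Flag (icosianSphere 4)) := by
  obtain ⟨hl, hu⟩ := goldenRatio_bounds
  have hφ := Real.goldenRatio_sq
  -- The vertices of a tetrahedral facet; the barycenters of the flag are those of its initial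
  -- segments.
  let f : Fin 4 → E4 := ![goldenVec ![2, 0, 0, 0] ![0, 0, 0, 0], goldenVec ![0, 1, -1, 0] ![1, 0, 1, 0],
    goldenVec ![0, 1, 1, 0] ![1, 0, -1, 0], goldenVec ![0, -1, 0, -1] ![1, 1, 0, 0]]
  have hf : ∀ i, f i ∈ icosianSphere 4 := fun i => by
    fin_cases i <;> exact goldenVec_mem (by decide) (by decide) (by decide)
  refine ⟨{
    α := icosianRoot
    b := ![goldenVec ![2, 0, 0, 0] ![0, 0, 0, 0], (1 / 2 : ℝ) • goldenVec ![2, 1, -1, 0] ![1, 0, 1, 0],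
      (1 / 3 : ℝ) • goldenVec ![2, 2, 0, 0] ![2, 0, 0, 0],
      (1 / 4 : ℝ) • goldenVec ![2, 1, 0, -1] ![3, 1, 0, 0]]
    n := (1 / 2 : ℝ) • goldenVec ![1, 2, 0, -5] ![0, -1, 0, 3]
    q := φ
    finite := finite_icosianSphere 4
    norm_eq := fun v hv => norm_eq_of_mem_icosianSphere hv (hf 0)
    b_zero_mem := hf 0
    refl_mem := fun i v hv => refl_mem_icosianSphere i hv
    inner_ne := ?_
    inner_pos := ?_
    b_mem := ?_
    zero_mem := ?_
    b_one := ?_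
    inner_n_b := ?_
    inner_α_n := ?_
    inner_α_n_pos := ?_
    inner_n_le := ?_
    inner_α₀₂ := ?_
    inner_α₀₃ := ?_
    inner_α₁₃ := ?_
    norm_α := ?_
    inner_α₂₃ := ?_
    q_eq := .inr rfl }⟩
  · intro i j hij
    fin_cases i <;> fin_cases j <;> first
      | exact absurd rfl hij
      | simp [icosianRoot, inner_smul_right, inner_goldenVec, Fin.sum_univ_four]
  · intro i
    fin_cases i <;> simp [icosianRoot, inner_smul_right, inner_goldenVec, Fin.sum_univ_four] <;>
      linarith
  · intro i
    refine mem_convexHull_of_sum_eq (f := fun j : Fin (i + 1) => f (j.castLE (by omega)))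
      (fun j => hf _) ?_
    fin_cases i <;> refine ext_E4 ?_ ?_ ?_ ?_ <;>
      simp [f, Fin.sum_univ_succ, goldenVec_apply] <;> ring
  · have h : goldenVec ![-2, 0, 0, 0] ![0, 0, 0, 0] ∈ icosianSphere 4 :=
      goldenVec_mem (by decide) (by decide) (by decide)
    refine midpoint_mem_convexHull (subset_convexHull ℝ _ (hf 0)) (subset_convexHull ℝ _ h) ?_
    refine ext_E4 ?_ ?_ ?_ ?_ <;> simp [f, goldenVec_apply]
  · change _ = (1 / 2 : ℝ) • (goldenVec ![2, 0, 0, 0] ![0, 0, 0, 0] +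
      refl (goldenVec ![-1, 0, -1, 0] ![1, -1, 0, 0]) (goldenVec ![2, 0, 0, 0] ![0, 0, 0, 0]))
    rw [refl_goldenVec (s := -1) (t := 1) (by decide) (by decide) (by decide) (by decide)]
    refine ext_E4 ?_ ?_ ?_ ?_ <;> simp [goldenVec_apply]
    try ring
  · intro i
    fin_cases i <;> simp [inner_smul_right, inner_smul_left, inner_goldenVec, Fin.sum_univ_four] <;>
      norm_num
  · intro i hi
    fin_cases i <;> first
      | exact absurd rfl hi
      | simp [icosianRoot, inner_smul_right, inner_goldenVec, Fin.sum_univ_four]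
  · simp [icosianRoot, inner_smul_right, inner_goldenVec, Fin.sum_univ_four]
    linarith
  · intro v hv
    obtain ⟨k, h1, h2, h3, h4⟩ := exists_abs_of_mem (by norm_num) hv
    rw [Fin.sum_univ_four] at h3 h4
    obtain ⟨-, h5, h6⟩ := abs_pattern_four (k 0) (k 1) (k 2) (k 3) h3 h4 (h2.congr
      (fun i => by fin_cases i <;> rfl) (fun i => by fin_cases i <;> rfl))
    have e0 := (le_abs_self (v 0)).trans_eq (h1 0)
    have e1 := (le_abs_self (v 1)).trans_eq (h1 1)
    have e3 := (neg_le_abs (v 3)).trans_eq (h1 3)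
    have h5' : (0 : ℝ) ≤ 1000 * (2 - (absP (k 0) + absQ (k 0) + absP (k 1) + 2 * absP (k 3) -
        absQ (k 3))) + 1618 * (2 - (absP (k 0) + 2 * absQ (k 0) + absQ (k 1) + absQ (k 3) -
        absP (k 3))) := by exact_mod_cast h5
    have h6' : (0 : ℝ) ≤ 1000 * (2 - (absP (k 0) + absQ (k 0) + absP (k 1) + 2 * absP (k 3) -
        absQ (k 3))) + 1619 * (2 - (absP (k 0) + 2 * absQ (k 0) + absQ (k 1) + absQ (k 3) -
        absP (k 3))) := by exact_mod_cast h6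
    have h7 : (0 : ℝ) ≤ (2 - (absP (k 0) + absQ (k 0) + absP (k 1) + 2 * absP (k 3) -
        absQ (k 3))) + φ * (2 - (absP (k 0) + 2 * absQ (k 0) + absQ (k 1) + absQ (k 3) -
        absP (k 3))) := by nlinarith
    -- The facet inequality multiplied by 2(φ + 1), which simplifies its coefficients and lets
    -- absolute values be inserted term by term.
    have h8 : (φ + 1) * v 0 + v 1 - (2 - φ) * v 3 ≤ 2 * (φ + 1) := by
      have g0 := mul_le_mul_of_nonneg_left e0 (by linarith : 0 ≤ φ + 1)
      have g3 := mul_le_mul_of_nonneg_left e3 (by linarith : 0 ≤ 2 - φ)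
      have g : (φ + 1) * absVal (k 0) + absVal (k 1) + (2 - φ) * absVal (k 3) =
          (absP (k 0) + absQ (k 0) + absP (k 1) + 2 * absP (k 3) - absQ (k 3)) +
          φ * (absP (k 0) + 2 * absQ (k 0) + absQ (k 1) + absQ (k 3) - absP (k 3)) := by
        simp only [absVal]
        linear_combination ((absQ (k 0) : ℝ) - absQ (k 3)) * hφ
      linarith
    rw [inner_smul_left, inner_E4]
    simp only [goldenVec_apply]
    simp
    refine le_of_mul_le_mul_right (a := 2 * (φ + 1)) ?_ (by linarith)
    linarith [show (2⁻¹ * (v 0 + (2 + -φ) * v 1 + (-5 + 3 * φ) * v 3)) * (2 * (φ + 1)) =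
      (φ + 1) * v 0 + v 1 - (2 - φ) * v 3 by
        linear_combination (-v 1 + 3 * v 3) * hφ]
  · simp [icosianRoot, inner_goldenVec, Fin.sum_univ_four]
  · simp [icosianRoot, inner_goldenVec, Fin.sum_univ_four]
  · simp [icosianRoot, inner_goldenVec, Fin.sum_univ_four]
  · change inner ℝ (goldenVec _ _) (goldenVec _ _) = (inner ℝ (goldenVec _ _) (goldenVec _ _) : ℝ)
    rw [inner_goldenVec, inner_goldenVec]
    simp [Fin.sum_univ_four]
    try norm_num
  · change 2 * inner ℝ (goldenVec _ _) (goldenVec _ _) =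
      (-φ * inner ℝ (goldenVec _ _) (goldenVec _ _) : ℝ)
    rw [inner_goldenVec, inner_goldenVec]
    simp [Fin.sum_univ_four]
    try ring

set_option maxHeartbeats 1000000 in
theorem exists_flag_icosian_eight : Nonempty (Flag (icosianSphere 8)) := by
  obtain ⟨hl, hu⟩ := goldenRatio_bounds
  have hφ := Real.goldenRatio_sq
  -- The vertices of a pentagonal 2-face.
  let f : Fin 5 → E4 := ![goldenVec ![1, 1, 0, -2] ![1, 0, 0, 1], goldenVec ![1, 1, 0, 2] ![1, 0, 0, -1],
    goldenVec ![1, -1, -1, 1] ![1, 1, 1, -1], goldenVec ![1, -1, -1, -1] ![1, 1, 1, 1],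
    goldenVec ![1, 2, 1, 0] ![1, -1, 0, 0]]
  have hf : ∀ i, f i ∈ icosianSphere 8 := fun i => by
    fin_cases i <;> exact goldenVec_mem (by decide) (by decide) (by decide)
  have hf' : ∀ i, f i ∈ convexHull ℝ (icosianSphere 8) := fun i => subset_convexHull ℝ _ (hf i)
  refine ⟨{
    -- The 120-cell is dual to the 600-cell: the same roots in reverse order.
    α := ![icosianRoot 3, icosianRoot 2, icosianRoot 1, icosianRoot 0]
    b := ![goldenVec ![1, 1, 0, -2] ![1, 0, 0, 1], goldenVec ![1, 1, 0, 0] ![1, 0, 0, 0],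
      (1 / 5 : ℝ) • goldenVec ![5, 2, -1, 0] ![5, 1, 2, 0], goldenVec ![1, 0, 0, 0] ![1, 0, 0, 0]]
    n := goldenVec ![2, 0, 0, 0] ![-1, 0, 0, 0]
    q := 1
    finite := finite_icosianSphere 8
    norm_eq := fun v hv => norm_eq_of_mem_icosianSphere hv (hf 0)
    b_zero_mem := hf 0
    refl_mem := fun i v hv => match i with
      | 0 => refl_mem_icosianSphere 3 hv
      | 1 => refl_mem_icosianSphere 2 hv
      | 2 => refl_mem_icosianSphere 1 hv
      | 3 => refl_mem_icosianSphere 0 hv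
    inner_ne := ?_
    inner_pos := ?_
    b_mem := ?_
    zero_mem := ?_
    b_one := ?_
    inner_n_b := ?_
    inner_α_n := ?_
    inner_α_n_pos := ?_
    inner_n_le := ?_
    inner_α₀₂ := ?_
    inner_α₀₃ := ?_
    inner_α₁₃ := ?_
    norm_α := ?_
    inner_α₂₃ := ?_
    q_eq := .inl rfl }⟩
  · intro i j hij
    fin_cases i <;> fin_cases j <;> first
      | exact absurd rfl hij
      | simp [icosianRoot, inner_smul_right, inner_goldenVec, Fin.sum_univ_four]
  · intro i
    fin_cases i <;> simp [icosianRoot, inner_smul_right, inner_goldenVec, Fin.sum_univ_four] <;>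
      first | linarith | positivity
  · intro i
    fin_cases i
    · exact hf' 0
    · refine midpoint_mem_convexHull (hf' 0) (hf' 1) ?_
      refine ext_E4 ?_ ?_ ?_ ?_ <;> simp [f, goldenVec_apply] <;> ring
    · refine mem_convexHull_of_sum_eq hf ?_
      refine ext_E4 ?_ ?_ ?_ ?_ <;> simp [f, Fin.sum_univ_five, goldenVec_apply] <;> ring
    · have h : goldenVec ![1, 1, 1, 1] ![1, -1, -1, -1] ∈ icosianSphere 8 :=
        goldenVec_mem (by decide) (by decide) (by decide)
      refine midpoint_mem_convexHull (hf' 3) (subset_convexHull ℝ _ h) ?_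
      refine ext_E4 ?_ ?_ ?_ ?_ <;> simp [f, goldenVec_apply] <;> ring
  · have h : goldenVec ![-1, -1, 0, 2] ![-1, 0, 0, -1] ∈ icosianSphere 8 :=
      goldenVec_mem (by decide) (by decide) (by decide)
    refine midpoint_mem_convexHull (hf' 0) (subset_convexHull ℝ _ h) ?_
    refine ext_E4 ?_ ?_ ?_ ?_ <;> simp [f, goldenVec_apply] <;> ring
  · change _ = (1 / 2 : ℝ) • (goldenVec ![1, 1, 0, -2] ![1, 0, 0, 1] +
      refl (goldenVec ![0, 0, 0, -2] ![0, 0, 0, 0]) (goldenVec ![1, 1, 0, -2] ![1, 0, 0, 1]))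
    rw [refl_goldenVec (s := 2) (t := -1) (by decide) (by decide) (by decide) (by decide)]
    refine ext_E4 ?_ ?_ ?_ ?_ <;> simp [goldenVec_apply] <;> ring
  · intro i
    fin_cases i <;> simp [inner_smul_right, inner_goldenVec, Fin.sum_univ_four]
  · intro i hi
    fin_cases i <;> first
      | exact absurd rfl hi
      | simp [icosianRoot, inner_goldenVec, Fin.sum_univ_four]
  · simp [icosianRoot, inner_goldenVec, Fin.sum_univ_four]
    linarith
  · intro v hv
    obtain ⟨k, h1, -⟩ := exists_abs_of_mem le_rfl hv
    -- The normal is a multiple of the first coordinate vector, and the largest possible coordinate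
    -- is φ² = φ + 1.
    have h2 : absVal (k 0) ≤ φ + 1 := by
      generalize k 0 = j
      fin_cases j <;> simp [absVal, absP, absQ] <;> linarith
    have h3 := ((le_abs_self (v 0)).trans_eq (h1 0)).trans h2
    have h4 := mul_le_mul_of_nonneg_left h3 (by linarith : 0 ≤ 2 - φ)
    rw [inner_E4]
    simp only [goldenVec_apply]
    simp
    linarith
  · simp [icosianRoot, inner_goldenVec, Fin.sum_univ_four]
  · simp [icosianRoot, inner_goldenVec, Fin.sum_univ_four]
  · simp [icosianRoot, inner_goldenVec, Fin.sum_univ_four]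
  · change inner ℝ (goldenVec _ _) (goldenVec _ _) = (inner ℝ (goldenVec _ _) (goldenVec _ _) : ℝ)
    rw [inner_goldenVec, inner_goldenVec]
    simp [Fin.sum_univ_four]
    try norm_num
  · change 2 * inner ℝ (goldenVec _ _) (goldenVec _ _) =
      (-1 * inner ℝ (goldenVec _ _) (goldenVec _ _) : ℝ)
    rw [inner_goldenVec, inner_goldenVec]
    simp [Fin.sum_univ_four]
    try norm_num

/-! ### The flag of the 24-cell -/

theorem mem_hurwitzSphere {a b c d : ℤ} (h : a ^ 2 + b ^ 2 + c ^ 2 + d ^ 2 = 4)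
    (h1 : (b - a) % 2 = 0) (h2 : (c - a) % 2 = 0) (h3 : (d - a) % 2 = 0) :
    (!₂[(a : ℝ), (b : ℝ), (c : ℝ), (d : ℝ)] : E4) ∈ hurwitzSphere := by
  refine ⟨?_, ![a, b, c, d], fun i => ?_, fun i => ?_⟩
  · rw [norm_sq_E4]
    change (a : ℝ) ^ 2 + (b : ℝ) ^ 2 + (c : ℝ) ^ 2 + (d : ℝ) ^ 2 = 4
    exact_mod_cast h
  · fin_cases i <;> rfl
  · fin_cases i <;> simp [h1, h2, h3]

theorem exists_int_of_mem_hurwitzSphere {x : E4} (hx : x ∈ hurwitzSphere) :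
    ∃ a b c d : ℤ, x = !₂[(a : ℝ), (b : ℝ), (c : ℝ), (d : ℝ)] ∧
      a ^ 2 + b ^ 2 + c ^ 2 + d ^ 2 = 4 ∧ (b - a) % 2 = 0 ∧ (c - a) % 2 = 0 ∧ (d - a) % 2 = 0 := by
  obtain ⟨hn, p, hp, hpar⟩ := hx
  refine ⟨p 0, p 1, p 2, p 3, ext_E4 (hp 0) (hp 1) (hp 2) (hp 3), ?_, hpar 1, hpar 2, hpar 3⟩
  rw [norm_sq_E4, hp, hp, hp, hp] at hn
  have hn' : (p 0 : ℝ) ^ 2 + (p 1 : ℝ) ^ 2 + (p 2 : ℝ) ^ 2 + (p 3 : ℝ) ^ 2 = 4 := hn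
  exact_mod_cast hn'

theorem refl_hurwitz {a b c d k : ℤ} (hk : a - b - c - d = 2 * k) :
    refl !₂[1, -1, -1, -1] !₂[(a : ℝ), (b : ℝ), (c : ℝ), (d : ℝ)] =
      !₂[((a - k : ℤ) : ℝ), ((b + k : ℤ) : ℝ), ((c + k : ℤ) : ℝ), ((d + k : ℤ) : ℝ)] := by
  have hk' : (a : ℝ) - b - c - d = 2 * k := by exact_mod_cast hk
  rw [refl_apply, inner_E4, inner_E4]
  refine ext_E4 ?_ ?_ ?_ ?_ <;> simp <;> linarith

theorem exists_flag_hurwitz : Nonempty (Flag hurwitzSphere) := by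
  have hmem : ∀ a b c d : ℤ, a ^ 2 + b ^ 2 + c ^ 2 + d ^ 2 = 4 → (b - a) % 2 = 0 →
      (c - a) % 2 = 0 → (d - a) % 2 = 0 → ∀ x : E4,
      x = !₂[(a : ℝ), (b : ℝ), (c : ℝ), (d : ℝ)] → x ∈ hurwitzSphere := by
    rintro a b c d h h1 h2 h3 _ rfl
    exact mem_hurwitzSphere h h1 h2 h3
  have m0 : (!₂[2, 0, 0, 0] : E4) ∈ hurwitzSphere :=
    hmem 2 0 0 0 (by decide) (by decide) (by decide) (by decide) _ (by norm_num)
  have m1 : (!₂[1, 1, 1, 1] : E4) ∈ hurwitzSphere :=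
    hmem 1 1 1 1 (by decide) (by decide) (by decide) (by decide) _ (by norm_num)
  have m2 : (!₂[1, 1, 1, -1] : E4) ∈ hurwitzSphere :=
    hmem 1 1 1 (-1) (by decide) (by decide) (by decide) (by decide) _ (by norm_num)
  have m3 : (!₂[1, 1, -1, -1] : E4) ∈ hurwitzSphere :=
    hmem 1 1 (-1) (-1) (by decide) (by decide) (by decide) (by decide) _ (by norm_num)
  have m4 : (!₂[-2, 0, 0, 0] : E4) ∈ hurwitzSphere :=
    hmem (-2) 0 0 0 (by decide) (by decide) (by decide) (by decide) _ (by norm_num)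
  -- A triangular 2-face; the facet center is the midpoint of two opposite vertices of an
  -- octahedron.
  let f : Fin 3 → E4 := ![!₂[2, 0, 0, 0], !₂[1, 1, 1, 1], !₂[1, 1, 1, -1]]
  have hf : ∀ i, f i ∈ hurwitzSphere := fun i => by fin_cases i <;> assumption
  refine ⟨{
    α := ![!₂[1, -1, -1, -1], !₂[0, 0, 0, 1], !₂[0, 0, 1, -1], !₂[0, 1, -1, 0]]
    b := ![!₂[2, 0, 0, 0], !₂[3 / 2, 1 / 2, 1 / 2, 1 / 2], !₂[4 / 3, 2 / 3, 2 / 3, 0], !₂[1, 1, 0, 0]]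
    n := !₂[1 / 2, 1 / 2, 0, 0]
    q := 1
    finite := ?_
    norm_eq := fun v hv => (sq_eq_sq₀ (norm_nonneg _) (norm_nonneg _)).1 (hv.1.trans m0.1.symm)
    b_zero_mem := m0
    refl_mem := ?_
    inner_ne := ?_
    inner_pos := ?_
    b_mem := ?_
    zero_mem := ?_
    b_one := ?_
    inner_n_b := ?_
    inner_α_n := ?_
    inner_α_n_pos := ?_
    inner_n_le := ?_
    inner_α₀₂ := ?_
    inner_α₀₃ := ?_
    inner_α₁₃ := ?_
    norm_α := ?_
    inner_α₂₃ := ?_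
    q_eq := .inl rfl }⟩
  · refine ((Set.finite_Icc (fun _ : Fin 4 => (-2 : ℤ)) fun _ => (2 : ℤ)).image
      fun p => (WithLp.toLp 2 fun i => (p i : ℝ) : E4)).subset fun x hx => ?_
    obtain ⟨a, b, c, d, rfl, h, -⟩ := exists_int_of_mem_hurwitzSphere hx
    refine ⟨![a, b, c, d], ⟨fun i => ?_, fun i => ?_⟩, ext_E4 rfl rfl rfl rfl⟩ <;>
      fin_cases i <;> simp <;> nlinarith [sq_nonneg a, sq_nonneg b, sq_nonneg c, sq_nonneg d]
  · intro i x hx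
    obtain ⟨a, b, c, d, rfl, h, h1, h2, h3⟩ := exists_int_of_mem_hurwitzSphere hx
    fin_cases i
    · obtain ⟨k, hk⟩ : ∃ k, a - b - c - d = 2 * k := ⟨(a - b - c - d) / 2, by omega⟩
      change refl !₂[1, -1, -1, -1] _ ∈ _
      rw [refl_hurwitz hk]
      refine mem_hurwitzSphere ?_ (by omega) (by omega) (by omega)
      linear_combination h - 2 * k * hk
    · change refl !₂[0, 0, 0, 1] _ ∈ _
      rw [refl_e3 _ one_ne_zero]
      exact hmem a b c (-d) (by linarith) h1 h2 (by omega) _ (by simp)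
    · change refl !₂[0, 0, 1, -1] _ ∈ _
      rw [refl_e2_sub_e3]
      exact hmem a b d c (by linarith) h1 h3 h2 _ (by simp)
    · change refl !₂[0, 1, -1, 0] _ ∈ _
      rw [refl_e1_sub_e2]
      exact hmem a c b d (by linarith) h2 h1 h3 _ (by simp)
  · intro i j hij
    rw [inner_E4]
    fin_cases i <;> fin_cases j <;> first
      | exact absurd rfl hij
      | (simp; try norm_num)
  · intro i
    rw [inner_E4]
    fin_cases i <;> simp
  · intro i
    fin_cases i
    · exact subset_convexHull ℝ _ m0
    · refine midpoint_mem_convexHull (subset_convexHull ℝ _ m0) (subset_convexHull ℝ _ m1) ?_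
      refine ext_E4 ?_ ?_ ?_ ?_ <;> simp
      norm_num
    · refine mem_convexHull_of_sum_eq hf ?_
      refine ext_E4 ?_ ?_ ?_ ?_ <;> simp [f, Fin.sum_univ_three] <;> norm_num
    · refine midpoint_mem_convexHull (subset_convexHull ℝ _ m1) (subset_convexHull ℝ _ m3) ?_
      refine ext_E4 ?_ ?_ ?_ ?_ <;> simp <;> norm_num
  · refine midpoint_mem_convexHull (subset_convexHull ℝ _ m0) (subset_convexHull ℝ _ m4) ?_
    refine ext_E4 ?_ ?_ ?_ ?_ <;> simp
  · have h := refl_hurwitz (a := 2) (b := 0) (c := 0) (d := 0) (k := 1) (by decide)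
    push_cast at h
    change _ = (1 / 2 : ℝ) • (!₂[2, 0, 0, 0] + refl !₂[1, -1, -1, -1] !₂[2, 0, 0, 0])
    rw [h]
    refine ext_E4 ?_ ?_ ?_ ?_ <;> simp
    norm_num
  · intro i
    rw [inner_E4]
    fin_cases i <;> simp <;> norm_num
  · intro i hi
    rw [inner_E4]
    fin_cases i <;> first
      | exact absurd rfl hi
      | simp
  · rw [inner_E4]
    simp
  · intro x hx
    obtain ⟨a, b, c, d, rfl, h, h1, -⟩ := exists_int_of_mem_hurwitzSphere hx
    have hab : a + b ≤ 2 := by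
      have : (a + b) ^ 2 ≤ 8 := by nlinarith [sq_nonneg (a - b), sq_nonneg c, sq_nonneg d]
      nlinarith
    have hab' : (a : ℝ) + b ≤ 2 := by exact_mod_cast hab
    rw [inner_E4]
    simp
    linarith
  all_goals
    rw [inner_E4]
    try rw [inner_E4]
    simp
    try norm_num

theorem exists_flag_of_smul {V V' : Set E4} (h : Nonempty (Flag V'))
    (hV : V = (fun x : E4 => (1 / 2 : ℝ) • x) '' V') : Nonempty (Flag V) :=
  h.map fun S => S.map (1 / 2) (by norm_num) (LinearIsometryEquiv.refl ℝ E4) hV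

theorem exists_flag_vertices (k : Cell) : Nonempty (Flag k.vertices) := by
  cases k
  · exact exists_flag_cell5
  · exact exists_flag_cell8
  · exact exists_flag_of_smul exists_flag_hurwitz vertices_cell24
  · exact vertices_cell120 ▸ exists_flag_icosian_eight
  · exact exists_flag_of_smul exists_flag_icosian_four vertices_cell600

/-- The regular polytopes are convex hulls of vertex sets with a flag. -/
theorem IsCentered.exists_flag {k : Cell} {P : Set E4} (hP : IsCentered k P) :
    ∃ (V : Set E4) (_ : Flag V), P = convexHull ℝ V := by
  obtain ⟨c, A, hc, rfl⟩ := hP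
  obtain ⟨S⟩ := exists_flag_vertices k
  refine ⟨_, S.map c hc A rfl, ?_⟩
  exact (c • A.toLinearEquiv.toLinearMap).image_convexHull k.vertices

end RegularPolytope

theorem proposition11 (k : RegularPolytope.Cell) (P : Set RegularPolytope.E4)
    (hP : RegularPolytope.IsCentered k P)
    (I : RegularPolytope.graphCompl P → Type*)
    [TopologicalSpace (Bundle.TotalSpace ℝ I)]
    [∀ x, NormedAddCommGroup (I x)] [∀ x, InnerProductSpace ℝ (I x)]
    [FiberBundle ℝ I] [VectorBundle ℝ ℝ I] [IsContinuousRiemannianBundle ℝ I]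
    (hI : RegularPolytope.IsMoebiusOnLinkingCircles I) :
    (∃ ρ : RegularPolytope.rotationGroup P →*
        (Bundle.TotalSpace ℝ I ≃ₜ Bundle.TotalSpace ℝ I),
      ∀ g, RegularPolytope.IsLift g (ρ g)) ∧
    ∃ S : GroupExtension ℤˣ (RegularPolytope.liftGroup I) (RegularPolytope.rotationGroup P),
      S.rightHom = RegularPolytope.liftProj I ∧
      (∀ (x : RegularPolytope.graphCompl P) (v : I x),
        (S.inl (-1)).1.2 ⟨x, v⟩ = ⟨x, -v⟩) ∧
      S.inl.range ≤ Subgroup.center (RegularPolytope.liftGroup I) ∧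
      Nonempty S.Splitting := by
  obtain ⟨V, S, rfl⟩ := hP.exists_flag
  exact ⟨S.exists_lift hI, S.exists_split_extension hI⟩
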